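/- We consider relational data integration without constants. An instance of a schema is a finite set of facts over it, with values from a fixed countably infinite domain. An input consists of a source schema; a finite set $\Sigma$ of tuple-generating dependencies (TGDs) over it; a finite set $\mathcal M$ of mapping rules $\varphi(\vec x,\vec y)\to T(\vec x)$, one for each relation $T$ of the global schema, where $\varphi$ (the definition of $T$) is a conjunction of atoms over the source schema and $\vec x$ has no repeated variables; and a policy $p$, which is a conjunctive query over the source schema. For a source instance $D$ let $\mathcal M(D)$ be the global instance of all facts $T(\vec c)$ such that $D\models\exists\vec y\,\varphi(\vec c,\vec y)$, $\varphi$ being the definition of $T$. A global instance $V$ is realizable if $V=\mathcal M(D)$ for some source instance $D\models\Sigma$; all such $D$ are the possible source instances for $V$. The policy $p$ admits a disclosure if there are a realizable $V$ and a tuple $\vec t$ of values for the free variables of $p$ such that $p(\vec t)$ holds in every possible source instance for $V$. A TGD $\beta\to\exists\vec y\,\eta$ is linear if its body $\beta$ is a single atom. It is an inclusion dependency if moreover its head $\eta$ is a single atom, no variable occurs more than once in the body, and no variable occurs more than once in the head. A mapping rule is atomic if its definition is a single atom, and it is a projection mapping if moreover no variable is repeated in this atom. For a class $\mathcal C$ of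 TGDs and a class $\mathrm{Map}$ of mapping rules, $\mathrm{Disclose}(\mathcal C,\mathrm{Map})$ is the problem of deciding, given an input with all dependencies in $\mathcal C$ and all mapping rules in $\mathrm{Map}$, whether the policy admits a disclosure. Theorem. Both $\mathrm{Disclose}(\text{inclusion dependencies},\text{atomic mappings})$ and $\mathrm{Disclose}(\text{linear TGDs},\text{projection mappings})$ are EXPTIME-hard: every language over a finite alphabet that is decided by a deterministic Turing machine in time $2^{q(n)}$ for some polynomial $q$ has a polynomial-time many-one reduction to each of the two problems. (Relation names, variables and arities in the inputs may even be written in unary.) -/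

import Mathlib

namespace Disclosure

/-! ### Queries, dependencies and mappings

Relation names of a schema are numbered `0, 1, 2, …`; variables and data values are natural
numbers.  Queries, dependencies and mappings contain no constants. -/

/-- An atom `R(x₁, …, xₖ)`: a relation name applied to a list of variables. -/
structure Atom where
  rel : ℕ
  args : List ℕ

/-- A fact `R(c₁, …, cₖ)`: a relation name applied to a list of values. -/
structure Fact where
  rel : ℕ
  args : List ℕ

/-- A schema: the list of the arities of its relation names (name `i` has arity `S[i]`). -/
abbrev Schema := List ℕ

/-- The fact obtained from an atom by evaluating its variables. -/
def Atom.eval (a : Atom) (h : ℕ → ℕ) : Fact := ⟨a.rel, a.args.map h⟩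

/-- The atom uses a relation name of the schema with the right arity. -/
def Atom.WF (S : Schema) (a : Atom) : Prop := S[a.rel]? = some a.args.length

/-- The fact uses a relation name of the schema with the right arity. -/
def Fact.WF (S : Schema) (f : Fact) : Prop := S[f.rel]? = some f.args.length

/-- An instance of a schema is a finite set of facts over the schema. -/
def IsInstance (S : Schema) (D : Set Fact) : Prop := D.Finite ∧ ∀ f ∈ D, f.WF S

/-- The variables occurring in a conjunction of atoms. -/
def vars (l : List Atom) : List ℕ := l.flatMap Atom.args

/-- A conjunctive query with the listed free variables; the other variables of its atoms are
existentially quantified. -/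
structure CQ where
  free : List ℕ
  atoms : List Atom

/-- A nonempty conjunction of atoms over the schema, with pairwise distinct free variables, each
of which occurs in the conjunction. -/
def CQ.WF (S : Schema) (Q : CQ) : Prop :=
  Q.atoms ≠ [] ∧ (∀ a ∈ Q.atoms, a.WF S) ∧ Q.free.Nodup ∧ ∀ v ∈ Q.free, v ∈ vars Q.atoms

/-- `Q(t)` holds in `D`. -/
def CQ.Holds (Q : CQ) (D : Set Fact) (t : List ℕ) : Prop :=
  ∃ h : ℕ → ℕ, Q.free.map h = t ∧ ∀ a ∈ Q.atoms, a.eval h ∈ D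

/-- A tuple-generating dependency `body → ∃ y, head`: the variables of the head that do not occur
in the body are existentially quantified. -/
structure TGD where
  body : List Atom
  head : List Atom

/-- Body and head are nonempty conjunctions of atoms over the schema. -/
def TGD.WF (S : Schema) (σ : TGD) : Prop :=
  σ.body ≠ [] ∧ σ.head ≠ [] ∧ (∀ a ∈ σ.body, a.WF S) ∧ ∀ a ∈ σ.head, a.WF S

/-- `D` satisfies the dependency `σ`. -/
def TGD.Sat (σ : TGD) (D : Set Fact) : Prop :=
  ∀ h : ℕ → ℕ, (∀ a ∈ σ.body, a.eval h ∈ D) →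
    ∃ h' : ℕ → ℕ, (∀ v ∈ vars σ.body, h' v = h v) ∧ ∀ a ∈ σ.head, a.eval h' ∈ D

/-- Linear TGDs: the body is a single atom. -/
def TGD.IsLinear (σ : TGD) : Prop := ∃ a, σ.body = [a]

/-- Inclusion dependencies: linear TGDs with a single atom in the head, such that no variable
is repeated in the body and no variable is repeated in the head. -/
def TGD.IsIncDep (σ : TGD) : Prop :=
  ∃ a b, σ.body = [a] ∧ σ.head = [b] ∧ a.args.Nodup ∧ b.args.Nodup

/-- A set of mapping rules `φⱼ(x, y) → Tⱼ(x)`, one for each global relation `Tⱼ`, is the list of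
the definitions `φⱼ` (with their free variables `x`). -/
abbrev Mapping := List CQ

/-- The global schema: `Tⱼ` has as many arguments as its definition has free variables. -/
def Mapping.globalSchema (M : Mapping) : Schema := M.map fun φ => φ.free.length

/-- The image `M(D)` of a source instance: all facts `Tⱼ(c)` such that `φⱼ(c)` holds in `D`. -/
def Mapping.image (M : Mapping) (D : Set Fact) : Set Fact :=
  {f | ∃ φ, M[f.rel]? = some φ ∧ φ.Holds D f.args}

/-- Atomic mapping rules: the definition is a single atom. -/
def CQ.IsAtomic (φ : CQ) : Prop := ∃ a, φ.atoms = [a]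

/-- Projection mapping rules: the definition is a single atom without repeated variables. -/
def CQ.IsProjection (φ : CQ) : Prop := ∃ a, φ.atoms = [a] ∧ a.args.Nodup

/-! ### Disclosure -/

/-- A source schema with source constraints, mappings and a policy. -/
structure Input where
  source : Schema
  constraints : List TGD
  mapping : Mapping
  policy : CQ

/-- Constraints, mapping definitions and policy are over the source schema. -/
def Input.WF (I : Input) : Prop :=
  (∀ σ ∈ I.constraints, σ.WF I.source) ∧ (∀ φ ∈ I.mapping, φ.WF I.source) ∧ I.policy.WF I.source

/-- `D` is a possible source instance for `V`: it satisfies the constraints and its image is `V`. -/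
def Input.Possible (I : Input) (V D : Set Fact) : Prop :=
  IsInstance I.source D ∧ (∀ σ ∈ I.constraints, σ.Sat D) ∧ I.mapping.image D = V

/-- An instance of the global schema is realizable if it has a possible source instance. -/
def Input.Realizable (I : Input) (V : Set Fact) : Prop :=
  IsInstance I.mapping.globalSchema V ∧ ∃ D, I.Possible V D

/-- The query result `policy(t)` is disclosed at `V`: it holds on all possible source instances. -/
def Input.Disclosed (I : Input) (V : Set Fact) (t : List ℕ) : Prop :=
  ∀ D, I.Possible V D → I.policy.Holds D t

/-- The policy admits a disclosure: some result of it is disclosed at some realizable instance. -/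
def Input.AdmitsDisclosure (I : Input) : Prop :=
  ∃ V, I.Realizable V ∧ ∃ t, I.Disclosed V t

/-! ### Encoding of inputs as bit strings

Numbers are written in unary and every piece is self-delimiting. -/

def encNat (n : ℕ) : List Bool := List.replicate n true ++ [false]

def encList {α : Type} (e : α → List Bool) : List α → List Bool
  | [] => [false]
  | a :: l => true :: (e a ++ encList e l)

def encAtom (a : Atom) : List Bool := encNat a.rel ++ encList encNat a.args

def encCQ (Q : CQ) : List Bool := encList encNat Q.free ++ encList encAtom Q.atoms

def encTGD (σ : TGD) : List Bool := encList encAtom σ.body ++ encList encAtom σ.head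

def encInput (I : Input) : List Bool :=
  encList encNat I.source ++ (encList encTGD I.constraints ++
    (encList encCQ I.mapping ++ encCQ I.policy))

/-- An encoding whose values can be read off the front of any string. -/
def SelfDelimiting {α : Type} (e : α → List Bool) : Prop :=
  ∀ a b s t, e a ++ s = e b ++ t → a = b ∧ s = t

theorem encNat_selfDelimiting : SelfDelimiting encNat := by
  intro a
  induction a with
  | zero => intro b s t h; cases b <;> simp_all [encNat, List.replicate_succ]
  | succ n ih =>
    intro b s t h
    cases b with
    | zero => simp [encNat, List.replicate_succ] at h
    | succ m =>
      have := ih m s t (by simpa [encNat, List.replicate_succ] using h)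
      exact ⟨by rw [this.1], this.2⟩

theorem encList_selfDelimiting {α : Type} {e : α → List Bool} (he : SelfDelimiting e) :
    SelfDelimiting (encList e) := by
  intro a
  induction a with
  | nil => intro b s t h; cases b <;> simp_all [encList]
  | cons x l ih =>
    intro b s t h
    cases b with
    | nil => simp [encList] at h
    | cons y m =>
      simp only [encList, List.cons_append, List.append_assoc, List.cons.injEq, true_and] at h
      obtain ⟨rfl, h2⟩ := he _ _ _ _ h
      obtain ⟨rfl, h3⟩ := ih _ _ _ h2
      exact ⟨rfl, h3⟩

theorem encAtom_selfDelimiting : SelfDelimiting encAtom := by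
  rintro ⟨r, x⟩ ⟨r', x'⟩ s t h
  simp only [encAtom, List.append_assoc] at h
  obtain ⟨h1, h⟩ := encNat_selfDelimiting _ _ _ _ h
  obtain ⟨h2, h⟩ := encList_selfDelimiting encNat_selfDelimiting _ _ _ _ h
  exact ⟨by rw [h1, h2], h⟩

theorem encCQ_selfDelimiting : SelfDelimiting encCQ := by
  rintro ⟨r, x⟩ ⟨r', x'⟩ s t h
  simp only [encCQ, List.append_assoc] at h
  obtain ⟨h1, h⟩ := encList_selfDelimiting encNat_selfDelimiting _ _ _ _ h
  obtain ⟨h2, h⟩ := encList_selfDelimiting encAtom_selfDelimiting _ _ _ _ h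
  exact ⟨by rw [h1, h2], h⟩

theorem encTGD_selfDelimiting : SelfDelimiting encTGD := by
  rintro ⟨r, x⟩ ⟨r', x'⟩ s t h
  simp only [encTGD, List.append_assoc] at h
  obtain ⟨h1, h⟩ := encList_selfDelimiting encAtom_selfDelimiting _ _ _ _ h
  obtain ⟨h2, h⟩ := encList_selfDelimiting encAtom_selfDelimiting _ _ _ _ h
  exact ⟨by rw [h1, h2], h⟩

theorem encInput_injective : Function.Injective encInput := by
  rintro ⟨S, C, M, Q⟩ ⟨S', C', M', Q'⟩ h
  simp only [encInput] at h
  obtain ⟨h1, h⟩ := encList_selfDelimiting encNat_selfDelimiting _ _ _ _ h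
  obtain ⟨h2, h⟩ := encList_selfDelimiting encTGD_selfDelimiting _ _ _ _ h
  obtain ⟨h3, h⟩ := encList_selfDelimiting encCQ_selfDelimiting _ _ _ _ h
  obtain ⟨h4, -⟩ := encCQ_selfDelimiting Q Q' [] [] (by rw [h])
  rw [h1, h2, h3, h4]

/-! ### Decision problems and EXPTIME-hardness -/

/-- A decision problem: a type of inputs, coded by bit strings, and the set of yes-inputs. -/
structure DecisionProblem where
  Inst : Type
  encode : Inst → List Bool
  encode_injective : Function.Injective encode
  Yes : Inst → Prop

/-- A deterministic one-tape Turing machine (Mathlib's model `Turing.TM0`, with finitely many tape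
symbols and states) that decides the language `L` in time `2 ^ p(n)`, for a polynomial `p`.
The input symbols are embedded into the non-blank tape symbols. -/
structure ExpTimeDecider {A : Type} (L : Language A) where
  Γ : Type
  Λ : Type
  [inhabitedΓ : Inhabited Γ]
  [inhabitedΛ : Inhabited Λ]
  [finiteΓ : Finite Γ]
  [finiteΛ : Finite Λ]
  machine : Turing.TM0.Machine Γ Λ
  input : A ↪ Γ
  input_ne_blank : ∀ a, input a ≠ default
  accept : Set Λ
  time : Polynomial ℕ
  /-- On input `w` the machine halts after at most `2 ^ time(|w|)` steps, in an accepting state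
  if and only if `w ∈ L`. -/
  decides : ∀ w : List A, ∃ c : Turing.TM0.Cfg Γ Λ,
    Nonempty (StateTransition.EvalsToInTime (Turing.TM0.step machine)
      (Turing.TM0.init (w.map input)) (some c) (2 ^ time.eval w.length)) ∧
    Turing.TM0.step machine c = none ∧ (c.q ∈ accept ↔ w ∈ L)

/-- The class EXPTIME of languages. -/
def InExpTime {A : Type} (L : Language A) : Prop := Nonempty (ExpTimeDecider L)

/-- `P` is EXPTIME-hard: every language in EXPTIME, over any finite alphabet, has a polynomial-time
many-one reduction to `P`. -/
def ExpTimeHard (P : DecisionProblem) : Prop :=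
  ∀ (A : Type) [Finite A] (L : Language A), InExpTime L →
    ∃ f : List A → P.Inst,
      Nonempty (Turing.TM2ComputableInPolyTime (id : List A → List A) P.encode f) ∧
      ∀ w, w ∈ L ↔ P.Yes (f w)

/-- The problem of deciding whether a policy (an arbitrary conjunctive query) admits a disclosure
for given source constraints from the class `C` and given mapping rules from the class `Map`. -/
def disclose (C : TGD → Prop) (Map : CQ → Prop) : DecisionProblem where
  Inst := {I : Input // I.WF ∧ (∀ σ ∈ I.constraints, C σ) ∧ ∀ φ ∈ I.mapping, Map φ}
  encode I := encInput I.1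
  encode_injective _ _ h := Subtype.ext (encInput_injective h)
  Yes I := I.1.AdmitsDisclosure

end Disclosure

/-!
Hardness is proved by one reduction with two encodings. Given a language in EXPTIME and a word `w`,
the inputs `incDepInput` and `linearInput` are built so that they admit a disclosure if and only if
the machine accepts `w`.

*Critical instance.* All global facts over the single value `0` form a realizable instance, the
critical instance. A Boolean policy admits a disclosure if and only if it holds in every possible
source instance of the critical instance: if it fails in one of them, `E`, and `D` is possible for
some `V`, then the product of `D` with `E`, with the pairs `(x, 0)` renamed to `x`, is possible
for `V` as well, and the policy fails there (`not_admitsDisclosure_of_critical`). So a mapping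
rule can be used to force values to be `0`: in a possible source instance, every value it exposes
is `0`.

*Horn clauses.* Each fact has a position `c` with value `0`, and its other positions are read as
propositions that are true if their value is `0`. A pattern (`Pat`) is a Horn clause: if certain
positions agree with `c`, then another one is `0`. It is an atomic mapping rule whose atom repeats
the variable of `c`; alternatively, it is a linear dependency that copies the value to a unary
relation which a projection mapping exposes. A `Rule` is an inclusion dependency that derives from
a fact another fact which shares some of its values, at other positions. A fact that computes
something calls further facts in this way, and since values are shared, a position made `0` in the
called fact is `0` in the calling one: results are returned to the caller.

*Counters.* A counter modulo `period m`, the least common multiple of `1, …, m`, is represented by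
its residues modulo `1, …, m`, each by a block of positions of which one is marked. Adding a
constant rotates each block, which a single inclusion dependency can do. A zero test is a pattern
that equates the first positions of all blocks with `c`; a nonzero test consists of one rule for
each other position. The period is at least `2 ^ (m / 2)` (`two_pow_le_period`).

*Computation.* A fact of relation `1` holds a time and a place of the space-time diagram of a
cellular automaton whose rows have the length `period m`. It calls the facts for its three
neighbours at the previous time, or a search in the initial row, and the patterns determine its
symbol. By induction on the time, every possible source instance computes the diagram correctly
(`row_eq_zero`), reaches each of its cells since the counters run modulo the period
(`exists_call`), and sets the global flag, on which the policy depends, if an accepting symbol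
occurs. Conversely, for a diagram without accepting symbol, the intended facts together with the
all-zero facts form a possible source instance in which the policy fails (`isCounterModel`). A
Turing machine with running time `2 ^ q(n)` is simulated by such an automaton, for `m` polynomial
in `n` (`accepts_iff_exists_acc`).

*Polynomial time.* The encoded inputs are denoted by expressions made of constants, concatenation,
unary numbers, and loops over printed numbers and over the letters of the word
(`printable_incDepInput`, `printable_linearInput`). Such an expression is compiled to a program on
stacks, and the program to a stack machine, with a polynomial time bound (`Printer.computable`).
-/

namespace Disclosure

/-! ### The critical instance -/

/-- The critical global instance: all facts over the single value `0`. -/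
def criticalInstance (M : Mapping) : Set Fact :=
  {f | ∃ φ, M[f.rel]? = some φ ∧ f.args = List.replicate φ.free.length 0}

/-- The source instance consisting of all facts over the single value `0`. -/
def zeroInstance (S : Schema) : Set Fact := {f | f.WF S ∧ ∀ x ∈ f.args, x = 0}

theorem finite_zeroFacts (S : Schema) : {f : Fact | f.WF S ∧ ∀ x ∈ f.args, x = 0}.Finite := by
  refine ((Finset.range S.length).finite_toSet.image
    fun r => (⟨r, List.replicate (S.getD r 0) 0⟩ : Fact)).subset ?_
  rintro ⟨r, l⟩ ⟨h1, h2⟩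
  simp only [Fact.WF] at h1
  obtain ⟨hr, h1⟩ := List.getElem?_eq_some_iff.1 h1
  refine ⟨r, by simpa using hr, ?_⟩
  simp only [Fact.mk.injEq, true_and]
  refine (List.eq_replicate_iff.2 ⟨?_, h2⟩).symm
  simp [List.getD, hr, h1]

theorem isInstance_criticalInstance (M : Mapping) :
    IsInstance M.globalSchema (criticalInstance M) := by
  refine ⟨(finite_zeroFacts M.globalSchema).subset ?_, ?_⟩
  · rintro ⟨r, l⟩ ⟨φ, h1, h2⟩
    simp only at h1 h2
    subst h2
    exact ⟨by simp [Fact.WF, Mapping.globalSchema, h1], fun x hx => (List.mem_replicate.1 hx).2⟩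
  · rintro ⟨r, l⟩ ⟨φ, h1, h2⟩
    simp only at h1 h2
    subst h2
    simp [Fact.WF, Mapping.globalSchema, h1]

theorem Atom.WF.eval {S : Schema} {a : Atom} (ha : a.WF S) (h : ℕ → ℕ) : (a.eval h).WF S := by
  simpa [Atom.eval, Fact.WF, Atom.WF] using ha

theorem Atom.WF.eval_zero_mem {S : Schema} {a : Atom} (ha : a.WF S) :
    a.eval (fun _ => 0) ∈ zeroInstance S :=
  ⟨ha.eval _, by simp [Atom.eval]⟩

theorem possible_zeroInstance {I : Input} (hI : I.WF) :
    I.Possible (criticalInstance I.mapping) (zeroInstance I.source) := by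
  refine ⟨⟨finite_zeroFacts _, fun f hf => hf.1⟩, ?_, ?_⟩
  · intro σ hσ h hb
    refine ⟨fun _ => 0, ?_, fun a ha => ((hI.1 σ hσ).2.2.2 a ha).eval_zero_mem⟩
    intro v hv
    obtain ⟨a, ha, hv⟩ := List.mem_flatMap.1 hv
    exact ((hb a ha).2 _ (List.mem_map_of_mem hv)).symm
  · ext ⟨r, l⟩
    constructor
    · rintro ⟨φ, h1, h, rfl, h3⟩
      refine ⟨φ, h1, List.eq_replicate_iff.2 ⟨by simp, ?_⟩⟩
      intro x hx
      obtain ⟨v, hv, rfl⟩ := List.mem_map.1 hx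
      obtain ⟨a, ha, hv⟩ := List.mem_flatMap.1
        ((hI.2.1 φ (List.mem_of_getElem? h1)).2.2.2 v hv)
      exact (h3 a ha).2 _ (List.mem_map_of_mem hv)
    · rintro ⟨φ, h1, h2⟩
      refine ⟨φ, h1, fun _ => 0, ?_, fun a ha =>
        ((hI.2.1 φ (List.mem_of_getElem? h1)).2.1 a ha).eval_zero_mem⟩
      simp only at h2
      simp [h2]

theorem admitsDisclosure_of_critical {I : Input} (hI : I.WF)
    (H : ∀ D, I.Possible (criticalInstance I.mapping) D → I.policy.Holds D []) :
    I.AdmitsDisclosure :=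
  ⟨criticalInstance I.mapping, ⟨isInstance_criticalInstance _, _, possible_zeroInstance hI⟩, [], H⟩

/-- First component of the pair coded by a value: the values below `N` code the pairs `(x, 0)`,
the other ones code all pairs with a nonzero second component. -/
def fstBelow (N x : ℕ) : ℕ := if x < N then x else (x - N).unpair.1

/-- Second component of the pair coded by a value, see `fstBelow`. -/
def sndBelow (N x : ℕ) : ℕ := if x < N then 0 else (x - N).unpair.2 + 1

/-- The value that codes a pair whose first component is below `N`, see `fstBelow`. -/
def pairBelow (N a b : ℕ) : ℕ := if b = 0 then a else N + Nat.pair a (b - 1)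

theorem fstBelow_pairBelow {N a : ℕ} (b : ℕ) (ha : a < N) : fstBelow N (pairBelow N a b) = a := by
  unfold fstBelow pairBelow
  split_ifs <;> first | rfl | omega | simp

theorem sndBelow_pairBelow {N a : ℕ} (b : ℕ) (ha : a < N) : sndBelow N (pairBelow N a b) = b := by
  unfold sndBelow pairBelow
  split_ifs with h <;> first | rfl | omega | (simp; omega)

theorem pairBelow_fst_snd (N x : ℕ) : pairBelow N (fstBelow N x) (sndBelow N x) = x := by
  unfold fstBelow sndBelow pairBelow
  by_cases h : x < N <;> simp [h]
  omega

theorem sndBelow_eq_zero {N x : ℕ} : sndBelow N x = 0 ↔ x < N := by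
  unfold sndBelow
  split_ifs with h <;> simp [h]

theorem fstBelow_of_lt {N x : ℕ} (h : x < N) : fstBelow N x = x := by simp [fstBelow, h]

/-- The product of two instances, with pairs of values coded as in `fstBelow`. -/
def prodInstance (N : ℕ) (D E : Set Fact) : Set Fact :=
  {f | (⟨f.rel, f.args.map (fstBelow N)⟩ : Fact) ∈ D ∧
    (⟨f.rel, f.args.map (sndBelow N)⟩ : Fact) ∈ E}

theorem finite_prodInstance (N : ℕ) {D E : Set Fact} (hD : D.Finite) (hE : E.Finite) :
    (prodInstance N D E).Finite := by
  refine Set.Finite.of_finite_image (f := fun f : Fact =>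
    ((⟨f.rel, f.args.map (fstBelow N)⟩ : Fact), (⟨f.rel, f.args.map (sndBelow N)⟩ : Fact)))
    ((hD.prod hE).subset ?_) ?_
  · rintro _ ⟨f, hf, rfl⟩
    exact hf
  · rintro ⟨r, l⟩ - ⟨r', l'⟩ - h
    simp only [Prod.mk.injEq, Fact.mk.injEq] at h
    obtain ⟨⟨rfl, h1⟩, -, h2⟩ := h
    refine congrArg _ ?_
    have hlen : l.length = l'.length := by simpa using congrArg List.length h1
    refine List.ext_getElem hlen fun k hk hk' => ?_
    have e1 := congrArg (·[k]?) h1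
    have e2 := congrArg (·[k]?) h2
    simp [hk, hk'] at e1 e2
    rw [← pairBelow_fst_snd N l[k], ← pairBelow_fst_snd N l'[k], e1, e2]

theorem eval_mem_prodInstance {N : ℕ} {D E : Set Fact} {a : Atom} {h : ℕ → ℕ} :
    a.eval h ∈ prodInstance N D E ↔
      a.eval (fun v => fstBelow N (h v)) ∈ D ∧ a.eval (fun v => sndBelow N (h v)) ∈ E := by
  simp [prodInstance, Atom.eval, Function.comp_def]

theorem eval_congr {a : Atom} {g h : ℕ → ℕ} (H : ∀ v ∈ a.args, g v = h v) :
    a.eval g = a.eval h := by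
  simp only [Atom.eval, Fact.mk.injEq, true_and]
  exact List.map_congr_left H

theorem eval_pairBelow_mem {N : ℕ} {D E : Set Fact} {a : Atom} {h0 h1 : ℕ → ℕ}
    (hN : ∀ f ∈ D, ∀ x ∈ f.args, x < N) (m0 : a.eval h0 ∈ D) (m1 : a.eval h1 ∈ E) :
    a.eval (fun v => pairBelow N (h0 v) (h1 v)) ∈ prodInstance N D E := by
  have hlt : ∀ v ∈ a.args, h0 v < N := fun v hv => hN _ m0 _ (List.mem_map_of_mem hv)
  rw [eval_mem_prodInstance]
  constructor
  · rwa [eval_congr (h := h0) fun v hv => fstBelow_pairBelow _ (hlt v hv)]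
  · rwa [eval_congr (h := h1) fun v hv => sndBelow_pairBelow _ (hlt v hv)]

/-- Products of models of a dependency are models. -/
theorem TGD.Sat.prod {σ : TGD} {N : ℕ} {D E : Set Fact} (hN : ∀ f ∈ D, ∀ x ∈ f.args, x < N)
    (hD : σ.Sat D) (hE : σ.Sat E) : σ.Sat (prodInstance N D E) := by
  intro h hb
  obtain ⟨h0, e0, m0⟩ := hD _ fun a ha => (eval_mem_prodInstance.1 (hb a ha)).1
  obtain ⟨h1, e1, m1⟩ := hE _ fun a ha => (eval_mem_prodInstance.1 (hb a ha)).2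
  refine ⟨fun v => pairBelow N (h0 v) (h1 v), fun v hv => ?_, fun a ha =>
    eval_pairBelow_mem hN (m0 a ha) (m1 a ha)⟩
  simp only [e0 v hv, e1 v hv, pairBelow_fst_snd]

/-- If the policy fails in a possible source instance of the critical instance, then multiplying
with that instance destroys every disclosure. -/
theorem not_admitsDisclosure_of_critical {I : Input} (hfree : I.policy.free = [])
    {E : Set Fact} (hE : I.Possible (criticalInstance I.mapping) E)
    (hpol : ¬ I.policy.Holds E []) : ¬ I.AdmitsDisclosure := by
  rintro ⟨V, ⟨-, D, hD⟩, t, ht⟩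
  obtain ⟨N, hN⟩ : ∃ N, ∀ f ∈ D, ∀ x ∈ f.args, x < N := by
    have hfin : (⋃ f ∈ D, {x | x ∈ f.args}).Finite :=
      hD.1.1.biUnion fun f _ => f.args.finite_toSet
    obtain ⟨N, hN⟩ := hfin.bddAbove
    exact ⟨N + 1, fun f hf x hx => Nat.lt_succ_of_le (hN (Set.mem_biUnion hf hx))⟩
  have himg : I.mapping.image (prodInstance N D E) = V := by
    rw [← hD.2.2]
    ext ⟨r, l⟩
    constructor
    · rintro ⟨φ, h1, h, h2, h3⟩
      refine ⟨φ, h1, fun v => fstBelow N (h v), ?_,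
        fun a ha => (eval_mem_prodInstance.1 (h3 a ha)).1⟩
      have hz : (⟨r, φ.free.map fun v => sndBelow N (h v)⟩ : Fact) ∈ I.mapping.image E :=
        ⟨φ, h1, fun v => sndBelow N (h v), rfl, fun a ha => (eval_mem_prodInstance.1 (h3 a ha)).2⟩
      rw [hE.2.2] at hz
      obtain ⟨φ', h1', hz⟩ := hz
      simp only at hz h2
      have hz' := (List.eq_replicate_iff.1 hz).2
      rw [← h2]
      refine List.map_congr_left fun v hv => fstBelow_of_lt ?_
      exact sndBelow_eq_zero.1 (hz' _ (List.mem_map.2 ⟨v, hv, rfl⟩))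
    · rintro ⟨φ, h1, h, h2, h3⟩
      have hz : (⟨r, List.replicate φ.free.length 0⟩ : Fact) ∈ I.mapping.image E := by
        rw [hE.2.2]
        exact ⟨φ, h1, rfl⟩
      obtain ⟨φ', h1', g, g2, g3⟩ := hz
      obtain rfl : φ = φ' := by simpa [h1] using h1'
      refine ⟨φ, h1, fun v => pairBelow N (h v) (g v), ?_, fun a ha =>
        eval_pairBelow_mem hN (h3 a ha) (g3 a ha)⟩
      simp only at h2 g2
      rw [← h2]
      refine List.map_congr_left fun v hv => ?_
      have : g v = 0 := (List.eq_replicate_iff.1 g2).2 _ (List.mem_map_of_mem hv)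
      simp [pairBelow, this]
  have hinst : IsInstance I.source (prodInstance N D E) :=
    ⟨finite_prodInstance N hD.1.1 hE.1.1, fun f hf => by simpa [Fact.WF] using hD.1.2 _ hf.1⟩
  obtain ⟨h, -, hh⟩ := ht _ ⟨hinst, fun σ hσ => (hD.2.1 σ hσ).prod hN (hE.2.1 σ hσ), himg⟩
  exact hpol ⟨_, by simp [hfree], fun a ha => (eval_mem_prodInstance.1 (hh a ha)).2⟩

/-! ### Inputs given by rules and patterns on positions -/

/-- The argument positions of the relations of the reduction (all relations but the unary one
share them): a constant `c`, a global flag `g`, a guard `z`, a vector `a` of result flags, four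
vectors `f d` of flags for results of recursive calls, and the counters `t` (time) and `i`
(place).  A counter is kept as a one-hot mark `j ≤ b` in each block `b`, the residue of its value
modulo `b + 1`. -/
inductive Pos (K : ℕ) : Type
  | c : Pos K
  | g : Pos K
  | z : Pos K
  | a (s : Fin K) : Pos K
  | f (d : Fin 4) (s : Fin K) : Pos K
  | t (b j : ℕ) : Pos K
  | i (b j : ℕ) : Pos K
  deriving DecidableEq

/-- The marks of a counter with `m` blocks. -/
def marks (m : ℕ) : List (ℕ × ℕ) :=
  (List.range m).flatMap fun b => (List.range (b + 1)).map fun j => (b, j)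

theorem mem_marks {m : ℕ} {p : ℕ × ℕ} : p ∈ marks m ↔ p.1 < m ∧ p.2 ≤ p.1 := by
  obtain ⟨b, j⟩ := p
  simp only [marks, List.mem_flatMap, List.mem_map, List.mem_range, Prod.mk.injEq]
  constructor
  · rintro ⟨b, hb, j, hj, rfl, rfl⟩
    exact ⟨hb, by omega⟩
  · rintro ⟨h1, h2⟩
    exact ⟨b, h1, j, by omega, rfl, rfl⟩

theorem nodup_marks (m : ℕ) : (marks m).Nodup := by
  refine List.nodup_flatMap.2 ⟨fun b _ => List.nodup_range.map fun x y h => by simpa using h, ?_⟩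
  refine List.nodup_range.imp fun {b b'} h => ?_
  simp only [Function.onFun, List.disjoint_left, List.mem_map, List.mem_range]
  rintro _ ⟨j, -, rfl⟩ ⟨j', -, h'⟩
  simp only [Prod.mk.injEq] at h'
  exact h h'.1.symm

/-- The positions outside of the two counters. -/
def flagPositions (K : ℕ) : List (Pos K) :=
  [.c, .g, .z] ++ (List.finRange K).map .a ++
    (List.finRange 4).flatMap fun d => (List.finRange K).map (.f d)

/-- The positions of a relation, in the order of its arguments. -/
def positions (K m : ℕ) : List (Pos K) :=
  flagPositions K ++ (marks m).map (fun p => .t p.1 p.2) ++ (marks m).map (fun p => .i p.1 p.2)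

section positions

variable {K m : ℕ}

theorem c_mem : Pos.c ∈ positions K m := by simp [positions, flagPositions]

theorem g_mem : Pos.g ∈ positions K m := by simp [positions, flagPositions]

theorem z_mem : Pos.z ∈ positions K m := by simp [positions, flagPositions]

theorem a_mem (s : Fin K) : Pos.a s ∈ positions K m := by simp [positions, flagPositions]

theorem f_mem (d : Fin 4) (s : Fin K) : Pos.f d s ∈ positions K m := by
  simp [positions, flagPositions]

theorem t_mem {b j : ℕ} : Pos.t b j ∈ positions K m ↔ b < m ∧ j ≤ b := by
  simp [positions, flagPositions, mem_marks]

theorem i_mem {b j : ℕ} : Pos.i b j ∈ positions K m ↔ b < m ∧ j ≤ b := by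
  simp [positions, flagPositions, mem_marks]

theorem nodup_positions : (positions K m).Nodup := by
  have ht : Function.Injective fun p : ℕ × ℕ => (Pos.t p.1 p.2 : Pos K) := by
    rintro ⟨_, _⟩ ⟨_, _⟩ h
    simpa using h
  have hi : Function.Injective fun p : ℕ × ℕ => (Pos.i p.1 p.2 : Pos K) := by
    rintro ⟨_, _⟩ ⟨_, _⟩ h
    simpa using h
  have ha : Function.Injective (Pos.a : Fin K → Pos K) := fun _ _ h => by simpa using h
  have hf : ∀ d, Function.Injective (Pos.f d : Fin K → Pos K) := fun _ _ _ h => by simpa using h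
  refine List.nodup_append.2 ⟨List.nodup_append.2 ⟨List.nodup_append.2 ⟨?_, ?_, ?_⟩,
    (nodup_marks m).map ht, ?_⟩, (nodup_marks m).map hi, ?_⟩
  · refine List.nodup_append.2 ⟨by simp, (List.nodup_finRange K).map ha, ?_⟩
    simp
  · refine List.nodup_flatMap.2 ⟨fun d _ => (List.nodup_finRange K).map (hf d), ?_⟩
    refine (List.nodup_finRange 4).imp fun {d d'} h => ?_
    simp [Function.onFun, List.disjoint_left, h.symm]
  · simp; grind
  · simp [flagPositions]; grind
  · simp [flagPositions]; grind

end positions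

/-- A number below `tagBound K` that tells apart the kinds of positions. -/
def Pos.tag {K : ℕ} : Pos K → ℕ
  | .c => 0
  | .g => 1
  | .z => 2
  | .t _ _ => 3
  | .i _ _ => 4
  | .a s => 5 + s
  | .f d s => 5 + K + (d * K + s)

/-- The bound on the tags of positions. -/
def tagBound (K : ℕ) : ℕ := 5 + 5 * K

/-- A polynomial that numbers pairs. -/
def pairNum (b j : ℕ) : ℕ := (b + j) * (b + j) + b

theorem pairNum_injective {b j b' j' : ℕ} (h : pairNum b j = pairNum b' j') : b = b' ∧ j = j' := by
  have h1 : Nat.sqrt (pairNum b j) = b + j := Nat.sqrt_add_eq _ (by omega)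
  have h2 : Nat.sqrt (pairNum b' j') = b' + j' := Nat.sqrt_add_eq _ (by omega)
  have h3 : b + j = b' + j' := by rw [← h1, h, h2]
  unfold pairNum at h
  rw [h3] at h
  omega

/-- The number of the mark of a position in a counter. -/
def Pos.num {K : ℕ} : Pos K → ℕ
  | .t b j => pairNum b j
  | .i b j => pairNum b j
  | _ => 0

theorem Pos.tag_lt {K : ℕ} (p : Pos K) : p.tag < tagBound K := by
  rcases p with _ | _ | _ | s | ⟨d, s⟩ | _ | _ <;> simp only [tag, tagBound] <;> try omega
  have h1 : (d : ℕ) ≤ 3 := by omega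
  have h2 : (d : ℕ) * K ≤ 3 * K := Nat.mul_le_mul_right _ h1
  have := s.2
  omega

theorem Pos.tag_num_injective {K : ℕ} {p q : Pos K} (h : p.tag = q.tag) (h' : p.num = q.num) :
    p = q := by
  have key : ∀ (d : Fin 4) (s : Fin K), (d * K + s) / K = d ∧ (d * K + s) % K = s := by
    intro d s
    have hK : 0 < K := by have := s.2; omega
    constructor
    · rw [mul_comm, Nat.mul_add_div hK, Nat.div_eq_of_lt s.2, add_zero]
    · rw [mul_comm, Nat.mul_add_mod, Nat.mod_eq_of_lt s.2]
  rcases p with _ | _ | _ | s | ⟨d, s⟩ | ⟨b, j⟩ | ⟨b, j⟩ <;>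
    rcases q with _ | _ | _ | s' | ⟨d', s'⟩ | ⟨b', j'⟩ | ⟨b', j'⟩ <;>
    simp only [tag, num] at h h' <;> first | rfl | omega | skip
  · rw [show s = s' from Fin.ext (by omega)]
  · have h3 : (d * K + s : ℕ) = d' * K + s' := by omega
    rw [show d = d' from Fin.ext (by rw [← (key d s).1, h3, (key d' s').1]),
      show s = s' from Fin.ext (by rw [← (key d s).2, h3, (key d' s').2])]
  · obtain ⟨rfl, rfl⟩ := pairNum_injective h'
    rfl
  · obtain ⟨rfl, rfl⟩ := pairNum_injective h'
    rfl

/-- The universally quantified variable at a position. -/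
def Pos.var {K : ℕ} (p : Pos K) : ℕ := 2 * tagBound K * p.num + p.tag

/-- The existentially quantified variable at a position. -/
def Pos.fresh {K : ℕ} (p : Pos K) : ℕ := 2 * tagBound K * p.num + (tagBound K + p.tag)

theorem mul_add_inj_of_lt {w x y r s : ℕ} (hr : r < w) (hs : s < w) (h : w * x + r = w * y + s) :
    x = y ∧ r = s := by
  have hw : 0 < w := by omega
  have h1 := congrArg (· / w) h
  have h2 := congrArg (· % w) h
  simp only [Nat.mul_add_div hw, Nat.div_eq_of_lt hr, Nat.div_eq_of_lt hs, add_zero] at h1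
  simp only [Nat.mul_add_mod, Nat.mod_eq_of_lt hr, Nat.mod_eq_of_lt hs] at h2
  exact ⟨h1, h2⟩

theorem Pos.var_injective {K : ℕ} : Function.Injective (Pos.var (K := K)) := fun p q h => by
  have h1 := p.tag_lt
  have h2 := q.tag_lt
  obtain ⟨h3, h4⟩ := mul_add_inj_of_lt (by omega) (by omega) h
  exact tag_num_injective h4 h3

theorem Pos.fresh_injective {K : ℕ} : Function.Injective (Pos.fresh (K := K)) := fun p q h => by
  have h1 := p.tag_lt
  have h2 := q.tag_lt
  obtain ⟨h3, h4⟩ := mul_add_inj_of_lt (by omega) (by omega) h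
  exact tag_num_injective (by omega) h3

theorem Pos.fresh_ne_var {K : ℕ} (p q : Pos K) : p.fresh ≠ q.var := fun h => by
  have h1 := p.tag_lt
  have h2 := q.tag_lt
  obtain ⟨h3, h4⟩ := mul_add_inj_of_lt (by omega) (by omega) h
  omega

/-- The fact of relation `r` with the value `v p` at each position `p`. -/
def fact {K : ℕ} (m r : ℕ) (v : Pos K → ℕ) : Fact := ⟨r, (positions K m).map v⟩

/-- The inclusion dependency from `src` to `tgt` in which the position `p` of the head takes over
the value of the position `pull p` of the body, or is existentially quantified. -/
structure Rule (K : ℕ) where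
  src : ℕ
  tgt : ℕ
  pull : Pos K → Option (Pos K)

/-- The variable at a position of the head of a rule. -/
def Rule.headVar {K : ℕ} (ρ : Rule K) (p : Pos K) : ℕ := ((ρ.pull p).map Pos.var).getD p.fresh

/-- The dependency denoted by a rule. -/
def Rule.toTGD {K : ℕ} (m : ℕ) (ρ : Rule K) : TGD :=
  ⟨[⟨ρ.src, (positions K m).map Pos.var⟩], [⟨ρ.tgt, (positions K m).map ρ.headVar⟩]⟩

/-- The set of facts is closed under the rule. -/
def Rule.Closed {K : ℕ} (m : ℕ) (ρ : Rule K) (D : Set Fact) : Prop :=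
  ∀ v, fact m ρ.src v ∈ D → ∃ v', fact m ρ.tgt v' ∈ D ∧
    ∀ p ∈ positions K m, ∀ q, ρ.pull p = some q → v' p = v q

/-- The relation `3` is unary, the other ones have an argument for each position. -/
def RelOk (n r : ℕ) : Prop := r ≠ 3 ∧ r < 5 + n

/-- The relations of the rule are those of the schema, relation `0` is not derived, and no
position of the body is taken over twice, as an inclusion dependency requires. -/
structure Rule.Valid {K : ℕ} (m n : ℕ) (ρ : Rule K) : Prop where
  src_ok : RelOk n ρ.src
  tgt_ok : RelOk n ρ.tgt
  tgt_ne : ρ.tgt ≠ 0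
  pull_mem : ∀ p ∈ positions K m, ∀ q, ρ.pull p = some q → q ∈ positions K m
  pull_inj : ∀ p ∈ positions K m, ∀ p' ∈ positions K m, ∀ q, ρ.pull p = some q →
    ρ.pull p' = some q → p = p'

/-- A pattern: if, in a fact of relation `rel`, the positions in `eq` agree with the position `c`,
then the value at position `out` is exposed. -/
structure Pat (K : ℕ) where
  rel : ℕ
  eq : Pos K → Bool
  out : Pos K

/-- The atom of relation `r` in which the positions in `eq` are equated with `c`. -/
def eqAtom {K : ℕ} (m r : ℕ) (eq : Pos K → Bool) : Atom :=
  ⟨r, (positions K m).map fun p => if eq p then (Pos.c : Pos K).var else p.var⟩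

/-- The pattern as an atomic mapping rule. -/
def Pat.toCQ {K : ℕ} (m : ℕ) (P : Pat K) : CQ := ⟨[P.out.var], [eqAtom m P.rel P.eq]⟩

/-- The pattern as a linear dependency that copies the value to the unary relation. -/
def Pat.toTGD {K : ℕ} (m : ℕ) (P : Pat K) : TGD := ⟨[eqAtom m P.rel P.eq], [⟨3, [P.out.var]⟩]⟩

/-- All values exposed by the pattern are `0`. -/
def Pat.Ok {K : ℕ} (m : ℕ) (P : Pat K) (D : Set Fact) : Prop :=
  ∀ v, fact m P.rel v ∈ D → (∀ p ∈ positions K m, P.eq p → v p = v .c) → v P.out = 0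

/-- The pattern is about a relation of the schema other than relation `0`, and the exposed
position is not among the equated ones. -/
structure Pat.Valid {K : ℕ} (m n : ℕ) (P : Pat K) : Prop where
  rel_ok : RelOk n P.rel
  rel_ne : P.rel ≠ 0
  out_mem : P.out ∈ positions K m
  out_eq : P.eq P.out = false

/-- The exposed positions of relation `0`: the constant, and the marks of the value `0` of both
counters. -/
def exposed (K m : ℕ) : List (Pos K) :=
  .c :: ((List.range m).map (fun b => .t b 0) ++ (List.range m).map (fun b => .i b 0))

/-- The mapping rule for relation `0`. -/
def initCQ (K m : ℕ) : CQ := ⟨(exposed K m).map Pos.var, [⟨0, (positions K m).map Pos.var⟩]⟩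

/-- The Boolean policy: the global flag of some fact of relation `0` is equal to `c`. -/
def policyCQ (K m : ℕ) : CQ := ⟨[], [eqAtom (K := K) m 0 fun p => p = .g]⟩

/-- The mapping rule that exposes the unary relation. -/
def unaryCQ : CQ := ⟨[0], [⟨3, [0]⟩]⟩

/-- The common source schema of the two inputs. -/
def sourceSchema (K m n : ℕ) : Schema :=
  List.replicate 3 (positions K m).length ++ 1 :: List.replicate (n + 1) (positions K m).length

/-- The input with inclusion dependencies and atomic mapping rules. -/
def incDepInput {K : ℕ} (m n : ℕ) (rs : List (Rule K)) (ps : List (Pat K)) : Input where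
  source := sourceSchema K m n
  constraints := rs.map (Rule.toTGD m)
  mapping := initCQ K m :: ps.map (Pat.toCQ m)
  policy := policyCQ K m

/-- The input with linear dependencies and projection mapping rules. -/
def linearInput {K : ℕ} (m n : ℕ) (rs : List (Rule K)) (ps : List (Pat K)) : Input where
  source := sourceSchema K m n
  constraints := rs.map (Rule.toTGD m) ++ ps.map (Pat.toTGD m)
  mapping := [initCQ K m, unaryCQ]
  policy := policyCQ K m

/-- What rules and patterns require of a source instance of the critical instance. -/
structure IsModel {K : ℕ} (m : ℕ) (rs : List (Rule K)) (ps : List (Pat K)) (D : Set Fact) :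
    Prop where
  closed : ∀ ρ ∈ rs, ρ.Closed m D
  ok : ∀ P ∈ ps, P.Ok m D
  init_nonempty : ∃ v : Pos K → ℕ, fact m 0 v ∈ D
  init_exposed : ∀ v : Pos K → ℕ, fact m 0 v ∈ D → ∀ p ∈ exposed K m, v p = 0

section

variable {K m n : ℕ} {D : Set Fact}

theorem eval_map_var (r : ℕ) (h : ℕ → ℕ) :
    (⟨r, (positions K m).map Pos.var⟩ : Atom).eval h = fact m r fun p : Pos K => h p.var := by
  simp [Atom.eval, fact, Function.comp_def]

theorem eval_eqAtom (r : ℕ) (eq : Pos K → Bool) (h : ℕ → ℕ) :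
    (eqAtom m r eq).eval h = fact m r fun p => if eq p then h (Pos.c : Pos K).var else h p.var := by
  simp only [Atom.eval, fact, eqAtom, List.map_map, Fact.mk.injEq, true_and]
  refine List.map_congr_left fun p _ => ?_
  simp only [Function.comp_apply]
  split_ifs <;> rfl

theorem fact_congr {r : ℕ} {v w : Pos K → ℕ} (h : ∀ p ∈ positions K m, v p = w p) :
    fact m r v = fact m r w := by
  simp only [fact, Fact.mk.injEq, true_and]
  exact List.map_congr_left h

theorem exists_valuation (v : Pos K → ℕ) : ∃ h : ℕ → ℕ, ∀ p : Pos K, h p.var = v p :=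
  ⟨Function.extend Pos.var v 0, fun p => Pos.var_injective.extend_apply v 0 p⟩

theorem mem_vars_singleton {a : Atom} {x : ℕ} : x ∈ vars [a] ↔ x ∈ a.args := by simp [vars]

theorem Rule.sat_iff {ρ : Rule K} (hρ : ρ.Valid m n) : (ρ.toTGD m).Sat D ↔ ρ.Closed m D := by
  constructor
  · intro H v hv
    obtain ⟨h, hh⟩ := exists_valuation v
    obtain ⟨h', e, hm⟩ := H h (by simpa [Rule.toTGD, eval_map_var, hh] using hv)
    refine ⟨fun p => h' (ρ.headVar p), ?_, fun p hp q hq => ?_⟩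
    · simpa [Rule.toTGD, Atom.eval, fact, Function.comp_def] using hm
    · simp only [headVar, hq, Option.map_some, Option.getD_some]
      rw [e, hh]
      exact mem_vars_singleton.2 (List.mem_map_of_mem (hρ.pull_mem p hp q hq))
  · intro H h hb
    obtain ⟨v', hv', e⟩ := H (fun p => h p.var) (by simpa [Rule.toTGD, eval_map_var] using hb)
    have hvar : ∀ q : Pos K, Function.extend Pos.fresh v' h q.var = h q.var := fun q =>
      Function.extend_apply' _ _ _ (by rintro ⟨p, hp⟩; exact Pos.fresh_ne_var p q hp)
    refine ⟨Function.extend Pos.fresh v' h, fun x hx => ?_, ?_⟩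
    · obtain ⟨q, -, rfl⟩ := List.mem_map.1 (mem_vars_singleton.1 hx)
      exact hvar q
    · simp only [toTGD, List.mem_singleton, forall_eq]
      convert hv'
      simp only [Atom.eval, fact, List.map_map, Fact.mk.injEq, true_and]
      refine List.map_congr_left fun p hp => ?_
      simp only [Function.comp_apply, headVar]
      rcases hq : ρ.pull p with _ | q
      · exact Pos.fresh_injective.extend_apply v' h p
      · simp [hvar, e p hp q hq]

theorem Rule.isIncDep {ρ : Rule K} (hρ : ρ.Valid m n) : (ρ.toTGD m).IsIncDep := by
  refine ⟨_, _, rfl, rfl, nodup_positions.map Pos.var_injective, ?_⟩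
  refine List.Nodup.map_on (fun p hp q hq h => ?_) nodup_positions
  simp only [headVar] at h
  rcases h1 : ρ.pull p with _ | p' <;> rcases h2 : ρ.pull q with _ | q' <;>
    simp only [h1, h2, Option.map_none, Option.map_some, Option.getD_none, Option.getD_some] at h
  · exact Pos.fresh_injective h
  · exact absurd h (Pos.fresh_ne_var _ _)
  · exact absurd h.symm (Pos.fresh_ne_var _ _)
  · rw [Pos.var_injective h] at h1
    exact hρ.pull_inj p hp q hq q' h1 h2

theorem sourceSchema_getElem? {r : ℕ} (hr : RelOk n r) :
    (sourceSchema K m n)[r]? = some (positions K m).length := by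
  obtain ⟨h1, h2⟩ := hr
  unfold sourceSchema
  by_cases h3 : r < 3
  · rw [List.getElem?_append_left (by simpa using h3)]
    simp only [List.getElem?_replicate, h3, if_true]
  · obtain ⟨k, rfl⟩ : ∃ k, r = 4 + k := ⟨r - 4, by omega⟩
    rw [List.getElem?_append_right (by simp; omega)]
    simp only [List.length_replicate, show 4 + k - 3 = k + 1 by omega, List.getElem?_cons_succ]
    simp [show k < n + 1 by omega]

theorem relOk_zero : RelOk n 0 := ⟨by omega, by omega⟩

theorem atom_wf {r : ℕ} (hr : RelOk n r) (f : Pos K → ℕ) :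
    (⟨r, (positions K m).map f⟩ : Atom).WF (sourceSchema K m n) := by
  simpa [Atom.WF] using sourceSchema_getElem? hr

theorem eqAtom_wf {r : ℕ} (hr : RelOk n r) (eq : Pos K → Bool) :
    (eqAtom m r eq).WF (sourceSchema K m n) :=
  atom_wf hr _

theorem fact_wf {r : ℕ} (hr : RelOk n r) (v : Pos K → ℕ) :
    (fact m r v).WF (sourceSchema K m n) := by
  simpa [Fact.WF, fact] using sourceSchema_getElem? hr

theorem unaryAtom_wf (x : ℕ) : (⟨3, [x]⟩ : Atom).WF (sourceSchema K m n) := by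
  simp [Atom.WF, sourceSchema]

theorem Rule.toTGD_wf {ρ : Rule K} (hρ : ρ.Valid m n) : (ρ.toTGD m).WF (sourceSchema K m n) := by
  simp only [TGD.WF, toTGD, List.mem_singleton, forall_eq]
  exact ⟨by simp, by simp, atom_wf hρ.src_ok _, atom_wf hρ.tgt_ok _⟩

theorem Pat.out_mem_args {P : Pat K} (hP : P.Valid m n) :
    P.out.var ∈ vars [eqAtom m P.rel P.eq] :=
  mem_vars_singleton.2 (List.mem_map.2 ⟨P.out, hP.out_mem, by simp [hP.out_eq]⟩)

theorem Pat.toTGD_wf {P : Pat K} (hP : P.Valid m n) : (P.toTGD m).WF (sourceSchema K m n) := by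
  simp only [TGD.WF, toTGD, List.mem_singleton, forall_eq]
  exact ⟨by simp, by simp, eqAtom_wf hP.rel_ok _, unaryAtom_wf _⟩

theorem Pat.toCQ_wf {P : Pat K} (hP : P.Valid m n) : (P.toCQ m).WF (sourceSchema K m n) := by
  simp only [CQ.WF, toCQ, List.mem_singleton, forall_eq]
  exact ⟨by simp, eqAtom_wf hP.rel_ok _, by simp, P.out_mem_args hP⟩

theorem exposed_subset : ∀ p ∈ exposed K m, p ∈ positions K m := by
  intro p hp
  simp only [exposed, List.mem_cons, List.mem_append, List.mem_map, List.mem_range] at hp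
  rcases hp with rfl | ⟨b, hb, rfl⟩ | ⟨b, hb, rfl⟩
  · exact c_mem
  · exact t_mem.2 ⟨hb, by omega⟩
  · exact i_mem.2 ⟨hb, by omega⟩

theorem nodup_exposed : (exposed K m).Nodup := by
  refine List.nodup_cons.2 ⟨by simp, List.nodup_append.2 ⟨?_, ?_, by simp⟩⟩
  · exact List.nodup_range.map fun x y h => by simpa using h
  · exact List.nodup_range.map fun x y h => by simpa using h

theorem initCQ_wf : (initCQ K m).WF (sourceSchema K m n) := by
  simp only [CQ.WF, initCQ, List.mem_singleton, forall_eq]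
  refine ⟨by simp, atom_wf relOk_zero _, nodup_exposed.map Pos.var_injective, fun x hx => ?_⟩
  obtain ⟨p, hp, rfl⟩ := List.mem_map.1 hx
  exact mem_vars_singleton.2 (List.mem_map_of_mem (exposed_subset p hp))

theorem policyCQ_wf : (policyCQ K m).WF (sourceSchema K m n) := by
  simp only [CQ.WF, policyCQ, List.mem_singleton, forall_eq]
  exact ⟨by simp, eqAtom_wf relOk_zero _, by simp, by simp⟩

theorem unaryCQ_wf : unaryCQ.WF (sourceSchema K m n) := by
  simp only [CQ.WF, unaryCQ, List.mem_singleton, forall_eq]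
  exact ⟨by simp, unaryAtom_wf _, by simp, by simp [vars]⟩

variable {rs : List (Rule K)} {ps : List (Pat K)}

theorem incDepInput_wf (hrs : ∀ ρ ∈ rs, ρ.Valid m n) (hps : ∀ P ∈ ps, P.Valid m n) :
    (incDepInput m n rs ps).WF := by
  refine ⟨fun σ hσ => ?_, fun φ hφ => ?_, policyCQ_wf⟩
  · obtain ⟨ρ, hρ, rfl⟩ := List.mem_map.1 hσ
    exact Rule.toTGD_wf (hrs ρ hρ)
  · rcases List.mem_cons.1 hφ with rfl | hφ
    · exact initCQ_wf
    · obtain ⟨P, hP, rfl⟩ := List.mem_map.1 hφ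
      exact Pat.toCQ_wf (hps P hP)

theorem linearInput_wf (hrs : ∀ ρ ∈ rs, ρ.Valid m n) (hps : ∀ P ∈ ps, P.Valid m n) :
    (linearInput m n rs ps).WF := by
  refine ⟨fun σ hσ => ?_, fun φ hφ => ?_, policyCQ_wf⟩
  · rcases List.mem_append.1 hσ with hσ | hσ
    · obtain ⟨ρ, hρ, rfl⟩ := List.mem_map.1 hσ
      exact Rule.toTGD_wf (hrs ρ hρ)
    · obtain ⟨P, hP, rfl⟩ := List.mem_map.1 hσ
      exact Pat.toTGD_wf (hps P hP)
  · simp only [linearInput, List.mem_cons, List.not_mem_nil, or_false] at hφ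
    rcases hφ with rfl | rfl
    · exact initCQ_wf
    · exact unaryCQ_wf

theorem incDepInput_classes (hrs : ∀ ρ ∈ rs, ρ.Valid m n) :
    (∀ σ ∈ (incDepInput m n rs ps).constraints, σ.IsIncDep) ∧
      ∀ φ ∈ (incDepInput m n rs ps).mapping, φ.IsAtomic := by
  refine ⟨fun σ hσ => ?_, fun φ hφ => ?_⟩
  · obtain ⟨ρ, hρ, rfl⟩ := List.mem_map.1 hσ
    exact Rule.isIncDep (hrs ρ hρ)
  · rcases List.mem_cons.1 hφ with rfl | hφ
    · exact ⟨_, rfl⟩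
    · obtain ⟨P, hP, rfl⟩ := List.mem_map.1 hφ
      exact ⟨_, rfl⟩

theorem linearInput_classes :
    (∀ σ ∈ (linearInput m n rs ps).constraints, σ.IsLinear) ∧
      ∀ φ ∈ (linearInput m n rs ps).mapping, φ.IsProjection := by
  refine ⟨fun σ hσ => ?_, fun φ hφ => ?_⟩
  · rcases List.mem_append.1 hσ with hσ | hσ
    · obtain ⟨ρ, hρ, rfl⟩ := List.mem_map.1 hσ
      exact ⟨_, rfl⟩
    · obtain ⟨P, hP, rfl⟩ := List.mem_map.1 hσ
      exact ⟨_, rfl⟩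
  · simp only [linearInput, List.mem_cons, List.not_mem_nil, or_false] at hφ
    rcases hφ with rfl | rfl
    · exact ⟨_, rfl, nodup_positions.map Pos.var_injective⟩
    · exact ⟨_, rfl, by simp⟩

theorem policyCQ_holds_iff :
    (policyCQ K m).Holds D [] ↔ ∃ v : Pos K → ℕ, fact m 0 v ∈ D ∧ v .g = v .c := by
  constructor
  · rintro ⟨h, -, hh⟩
    have := hh _ (List.mem_singleton.2 rfl)
    rw [eval_eqAtom] at this
    exact ⟨_, this, by simp only [decide_true, if_true]; split_ifs <;> rfl⟩
  · rintro ⟨v, hv, e⟩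
    obtain ⟨h, hh⟩ := exists_valuation v
    refine ⟨h, rfl, ?_⟩
    simp only [policyCQ, List.mem_singleton, forall_eq, eval_eqAtom, hh]
    convert hv using 2
    funext p
    by_cases hp : p = .g <;> simp [hp, e]

theorem initCQ_holds_iff {l : List ℕ} :
    (initCQ K m).Holds D l ↔ ∃ v : Pos K → ℕ, fact m 0 v ∈ D ∧ (exposed K m).map v = l := by
  constructor
  · rintro ⟨h, h1, hh⟩
    have := hh _ (List.mem_singleton.2 rfl)
    rw [eval_map_var] at this
    exact ⟨_, this, by simpa [initCQ, Function.comp_def] using h1⟩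
  · rintro ⟨v, hv, e⟩
    obtain ⟨h, hh⟩ := exists_valuation v
    refine ⟨h, by simpa [initCQ, Function.comp_def, hh] using e, ?_⟩
    simpa [initCQ, eval_map_var, hh] using hv

/-- The mapping rule for relation `0` takes a fact of that relation with exposed values `0` for
granted, and forbids other exposed values. -/
theorem initCQ_image_iff :
    (∀ l, (initCQ K m).Holds D l ↔ l = List.replicate (initCQ K m).free.length 0) ↔
      (∃ v : Pos K → ℕ, fact m 0 v ∈ D) ∧
        ∀ v : Pos K → ℕ, fact m 0 v ∈ D → ∀ p ∈ exposed K m, v p = 0 := by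
  simp only [initCQ_holds_iff]
  constructor
  · intro H
    obtain ⟨v, hv, -⟩ := (H _).2 rfl
    refine ⟨⟨v, hv⟩, fun v hv p hp => ?_⟩
    exact (List.eq_replicate_iff.1 ((H _).1 ⟨v, hv, rfl⟩)).2 _ (List.mem_map_of_mem hp)
  · rintro ⟨⟨v, hv⟩, H⟩ l
    have key : ∀ v : Pos K → ℕ, fact m 0 v ∈ D →
        (exposed K m).map v = List.replicate (initCQ K m).free.length 0 := fun v hv =>
      List.eq_replicate_iff.2 ⟨by simp [initCQ], fun x hx => by
        obtain ⟨p, hp, rfl⟩ := List.mem_map.1 hx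
        exact H v hv p hp⟩
    constructor
    · rintro ⟨v, hv, rfl⟩
      exact key v hv
    · rintro rfl
      exact ⟨v, hv, key v hv⟩

theorem Pat.holds_toCQ_iff {P : Pat K} (hP : P.Valid m n) {l : List ℕ} :
    (P.toCQ m).Holds D l ↔ ∃ v : Pos K → ℕ, fact m P.rel v ∈ D ∧
      (∀ p ∈ positions K m, P.eq p → v p = v .c) ∧ l = [v P.out] := by
  constructor
  · rintro ⟨h, h1, hh⟩
    have := hh _ (List.mem_singleton.2 rfl)
    rw [eval_eqAtom] at this
    refine ⟨_, this, fun p _ hp => by simp only [hp, if_true]; split_ifs <;> rfl, ?_⟩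
    simp only [hP.out_eq]
    exact h1.symm
  · rintro ⟨v, hv, e, rfl⟩
    obtain ⟨h, hh⟩ := exists_valuation v
    refine ⟨h, by simp [toCQ, hh], ?_⟩
    simp only [toCQ, List.mem_singleton, forall_eq, eval_eqAtom, hh]
    convert hv using 1
    refine fact_congr fun p hp => ?_
    split_ifs with h1
    · exact (e p hp h1).symm
    · rfl

theorem Pat.sat_toTGD_iff {P : Pat K} (hP : P.Valid m n) :
    (P.toTGD m).Sat D ↔ ∀ v : Pos K → ℕ, fact m P.rel v ∈ D →
      (∀ p ∈ positions K m, P.eq p → v p = v .c) → (⟨3, [v P.out]⟩ : Fact) ∈ D := by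
  constructor
  · intro H v hv e
    obtain ⟨h, hh⟩ := exists_valuation v
    obtain ⟨h', e', hm⟩ := H h (by
      simp only [toTGD, List.mem_singleton, forall_eq, eval_eqAtom, hh]
      convert hv using 1
      refine fact_congr fun p hp => ?_
      split_ifs with h1
      · exact (e p hp h1).symm
      · rfl)
    have := hm _ (List.mem_singleton.2 rfl)
    simpa [Atom.eval, e' _ (P.out_mem_args hP), hh] using this
  · intro H h hb
    have := hb _ (List.mem_singleton.2 rfl)
    rw [eval_eqAtom] at this
    refine ⟨h, fun _ _ => rfl, ?_⟩
    simpa [toTGD, Atom.eval, hP.out_eq] using H _ this fun p _ hp => by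
      simp only [hp, if_true]
      split_ifs <;> rfl

theorem unaryCQ_holds_iff {l : List ℕ} :
    unaryCQ.Holds D l ↔ ∃ x, (⟨3, [x]⟩ : Fact) ∈ D ∧ l = [x] := by
  constructor
  · rintro ⟨h, h1, hh⟩
    exact ⟨h 0, by simpa [unaryCQ, Atom.eval] using hh, by simpa [unaryCQ] using h1.symm⟩
  · rintro ⟨x, hx, rfl⟩
    exact ⟨fun _ => x, by simp [unaryCQ], by simpa [unaryCQ, Atom.eval] using hx⟩

theorem image_eq_criticalInstance_iff {M : Mapping} :
    M.image D = criticalInstance M ↔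
      ∀ φ ∈ M, ∀ l, φ.Holds D l ↔ l = List.replicate φ.free.length 0 := by
  constructor
  · intro H φ hφ l
    obtain ⟨r, hr⟩ := List.mem_iff_getElem?.1 hφ
    have := Set.ext_iff.1 H ⟨r, l⟩
    simpa [Mapping.image, criticalInstance, hr] using this
  · intro H
    ext ⟨r, l⟩
    simp only [Mapping.image, criticalInstance, Set.mem_ofPred_eq]
    exact exists_congr fun φ => and_congr_right fun h => H φ (List.mem_of_getElem? h) l

theorem isModel_of_possible_incDepInput (hrs : ∀ ρ ∈ rs, ρ.Valid m n)
    (hps : ∀ P ∈ ps, P.Valid m n)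
    (h : (incDepInput m n rs ps).Possible (criticalInstance (incDepInput m n rs ps).mapping) D) :
    IsModel m rs ps D := by
  obtain ⟨-, h2, h3⟩ := h
  rw [image_eq_criticalInstance_iff] at h3
  have h4 := initCQ_image_iff.1 (h3 _ List.mem_cons_self)
  refine ⟨fun ρ hρ => (Rule.sat_iff (hrs ρ hρ)).1 (h2 _ (List.mem_map_of_mem hρ)),
    fun P hP v hv e => ?_, h4.1, h4.2⟩
  have := (h3 _ (List.mem_cons_of_mem _ (List.mem_map_of_mem hP)) [v P.out]).1
    ((Pat.holds_toCQ_iff (hps P hP)).2 ⟨v, hv, e, rfl⟩)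
  simpa [Pat.toCQ] using this

theorem isModel_of_possible_linearInput (hrs : ∀ ρ ∈ rs, ρ.Valid m n)
    (hps : ∀ P ∈ ps, P.Valid m n)
    (h : (linearInput m n rs ps).Possible (criticalInstance (linearInput m n rs ps).mapping) D) :
    IsModel m rs ps D := by
  obtain ⟨-, h2, h3⟩ := h
  rw [image_eq_criticalInstance_iff] at h3
  have h4 := initCQ_image_iff.1 (h3 _ List.mem_cons_self)
  refine ⟨fun ρ hρ => (Rule.sat_iff (hrs ρ hρ)).1
      (h2 _ (List.mem_append_left _ (List.mem_map_of_mem hρ))), fun P hP v hv e => ?_, h4.1, h4.2⟩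
  have h5 := (Pat.sat_toTGD_iff (hps P hP)).1
    (h2 _ (List.mem_append_right _ (List.mem_map_of_mem hP))) v hv e
  have := (h3 unaryCQ (by simp [linearInput]) [v P.out]).1 (unaryCQ_holds_iff.2 ⟨_, h5, rfl⟩)
  simpa [unaryCQ] using this

/-- A countermodel: a model which has the all-zero facts of all relations but relation `0`. -/
structure IsCounterModel {K : ℕ} (m n : ℕ) (rs : List (Rule K)) (ps : List (Pat K))
    (D : Set Fact) : Prop extends IsModel m rs ps D where
  inst : IsInstance (sourceSchema K m n) D
  zero_mem : ∀ r, RelOk n r → r ≠ 0 → fact (K := K) m r (fun _ => 0) ∈ D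
  unary_iff : ∀ x, (⟨3, [x]⟩ : Fact) ∈ D ↔ x = 0
  policy : ∀ v : Pos K → ℕ, fact m 0 v ∈ D → v .g ≠ v .c

theorem IsCounterModel.possible_incDepInput (hrs : ∀ ρ ∈ rs, ρ.Valid m n)
    (hps : ∀ P ∈ ps, P.Valid m n) (h : IsCounterModel m n rs ps D) :
    (incDepInput m n rs ps).Possible (criticalInstance (incDepInput m n rs ps).mapping) D := by
  refine ⟨h.inst, fun σ hσ => ?_, image_eq_criticalInstance_iff.2 fun φ hφ => ?_⟩
  · obtain ⟨ρ, hρ, rfl⟩ := List.mem_map.1 hσ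
    exact (Rule.sat_iff (hrs ρ hρ)).2 (h.closed ρ hρ)
  · rcases List.mem_cons.1 hφ with rfl | hφ
    · exact initCQ_image_iff.2 ⟨h.init_nonempty, h.init_exposed⟩
    · obtain ⟨P, hP, rfl⟩ := List.mem_map.1 hφ
      intro l
      rw [Pat.holds_toCQ_iff (hps P hP)]
      constructor
      · rintro ⟨v, hv, e, rfl⟩
        simp [h.ok P hP v hv e, Pat.toCQ]
      · rintro rfl
        exact ⟨_, h.zero_mem _ (hps P hP).rel_ok (hps P hP).rel_ne, by simp, by simp [Pat.toCQ]⟩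

theorem IsCounterModel.possible_linearInput (hrs : ∀ ρ ∈ rs, ρ.Valid m n)
    (hps : ∀ P ∈ ps, P.Valid m n) (h : IsCounterModel m n rs ps D) :
    (linearInput m n rs ps).Possible (criticalInstance (linearInput m n rs ps).mapping) D := by
  refine ⟨h.inst, fun σ hσ => ?_, image_eq_criticalInstance_iff.2 fun φ hφ => ?_⟩
  · rcases List.mem_append.1 hσ with hσ | hσ
    · obtain ⟨ρ, hρ, rfl⟩ := List.mem_map.1 hσ
      exact (Rule.sat_iff (hrs ρ hρ)).2 (h.closed ρ hρ)
    · obtain ⟨P, hP, rfl⟩ := List.mem_map.1 hσ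
      exact (Pat.sat_toTGD_iff (hps P hP)).2 fun v hv e => (h.unary_iff _).2 (h.ok P hP v hv e)
  · simp only [linearInput, List.mem_cons, List.not_mem_nil, or_false] at hφ
    rcases hφ with rfl | rfl
    · exact initCQ_image_iff.2 ⟨h.init_nonempty, h.init_exposed⟩
    · intro l
      rw [unaryCQ_holds_iff]
      simp [h.unary_iff, unaryCQ]

theorem IsCounterModel.not_policy (h : IsCounterModel m n rs ps D) :
    ¬ (policyCQ K m).Holds D [] := by
  rw [policyCQ_holds_iff]
  rintro ⟨v, hv, e⟩
  exact h.policy v hv e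

end

/-! ### Cellular automata and the rules that run them -/

/-- A one-dimensional cellular automaton with accepting and blank symbols. -/
structure Automaton (K : ℕ) where
  step : Fin K → Fin K → Fin K → Fin K
  acc : Fin K → Bool
  blank : Fin K

/-- The period of a counter with `m` blocks. -/
def period (m : ℕ) : ℕ := (Finset.range m).lcm (· + 1)

/-- The mark `j` of block `b` is set when the counter has value `x`. -/
def Marked (b j : ℕ) (x : ℤ) : Prop := ((b + 1 : ℕ) : ℤ) ∣ x - j

theorem period_dvd {m : ℕ} {x : ℤ} : (period m : ℤ) ∣ x ↔ ∀ b < m, Marked b 0 x := by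
  simp only [Marked, period, Int.natCast_dvd, Finset.lcm_dvd_iff, Finset.mem_range, Nat.cast_zero,
    sub_zero]

theorem period_pos (m : ℕ) : 0 < period m := by
  refine Nat.pos_of_ne_zero fun h => ?_
  rw [period, Finset.lcm_eq_zero_iff] at h
  simp at h

theorem marked_mod {b j : ℕ} {x : ℤ} :
    Marked b (j % (b + 1)) x ↔ ((b + 1 : ℕ) : ℤ) ∣ x - j := by
  unfold Marked
  rw [Int.natCast_mod]
  exact ⟨fun h => (Int.ModEq.dvd ((Int.mod_modEq (j : ℤ) _).symm.trans (Int.modEq_iff_dvd.2 h))),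
    fun h => (Int.ModEq.dvd ((Int.mod_modEq (j : ℤ) _).trans (Int.modEq_iff_dvd.2 h)))⟩

theorem marked_pred {b j : ℕ} {x : ℤ} :
    Marked b j (x - 1) ↔ Marked b ((j + 1) % (b + 1)) x := by
  rw [marked_mod, Marked]
  push_cast
  rw [show x - 1 - (j : ℤ) = x - (j + 1) by ring]

theorem marked_shift {b j : ℕ} {x : ℤ} (d : ℕ) :
    Marked b j (x + d - 1) ↔ Marked b ((j + 1 + d * b) % (b + 1)) x := by
  rw [marked_mod, Marked]
  push_cast
  rw [show x + d - 1 - (j : ℤ) = (x - (j + 1 + d * b)) + (b + 1) * d by ring]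
  exact dvd_add_left (dvd_mul_right _ _)

theorem marked_congr {m b j : ℕ} {x y : ℤ} (hb : b < m) (h : (period m : ℤ) ∣ x - y) :
    Marked b j x ↔ Marked b j y := by
  have h1 : ((b + 1 : ℕ) : ℤ) ∣ x - y := by simpa [Marked] using period_dvd.1 h b hb
  unfold Marked
  rw [show x - (j : ℤ) = (x - y) + (y - j) by ring]
  exact dvd_add_right h1

/-- A counter is nonzero if and only if one of its marks at a nonzero residue is set. -/
theorem not_period_dvd {m : ℕ} {x : ℤ} :
    ¬ (period m : ℤ) ∣ x ↔ ∃ b j, b < m ∧ j < b ∧ Marked b (j + 1) x := by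
  rw [period_dvd]
  push Not
  constructor
  · rintro ⟨b, hb, h⟩
    have hpos : (0 : ℤ) < (b + 1 : ℕ) := by positivity
    have h0 := Int.emod_nonneg x hpos.ne'
    have h1 := Int.emod_lt_of_pos x hpos
    have h2 : x % (b + 1 : ℕ) ≠ 0 := fun e => h (by simpa [Marked] using Int.dvd_of_emod_eq_zero e)
    obtain ⟨k, hk⟩ := Int.eq_ofNat_of_zero_le h0
    refine ⟨b, k - 1, hb, by omega, ?_⟩
    unfold Marked
    rw [show ((k - 1 + 1 : ℕ) : ℤ) = x % (b + 1 : ℕ) by omega]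
    exact Int.dvd_self_sub_emod
  · rintro ⟨b, j, hb, hj, h⟩
    refine ⟨b, hb, fun h' => ?_⟩
    unfold Marked at h h'
    have h3 : ((b + 1 : ℕ) : ℤ) ∣ ((j + 1 : ℕ) : ℤ) := by
      simpa using dvd_sub h' h
    have := Nat.le_of_dvd (by omega) (Int.natCast_dvd_natCast.1 h3)
    omega

variable {K : ℕ}

/-- The content of the cell `i` of the initial row for the word `u`, repeated with the period. -/
def lookup (A : Automaton K) (m : ℕ) : List (Fin K) → ℤ → Fin K
  | [], _ => A.blank
  | s :: u, i => if (period m : ℤ) ∣ i then s else lookup A m u (i - 1)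

/-- The content of the cell `i` in row `r` of the space-time diagram. -/
def row (A : Automaton K) (m : ℕ) (u : List (Fin K)) : ℕ → ℤ → Fin K
  | 0, i => lookup A m u i
  | r + 1, i => A.step (row A m u r (i - 1)) (row A m u r i) (row A m u r (i + 1))

/-- The marks at nonzero residues. -/
def nonzeroMarks (m : ℕ) : List (ℕ × ℕ) :=
  (List.range m).flatMap fun b => (List.range b).map fun j => (b, j + 1)

theorem mem_nonzeroMarks {m : ℕ} {p : ℕ × ℕ} :
    p ∈ nonzeroMarks m ↔ ∃ b j, b < m ∧ j < b ∧ p = (b, j + 1) := by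
  simp only [nonzeroMarks, List.mem_flatMap, List.mem_map, List.mem_range]
  constructor
  · rintro ⟨b, hb, j, hj, rfl⟩
    exact ⟨b, j, hb, hj, rfl⟩
  · rintro ⟨b, j, hb, hj, rfl⟩
    exact ⟨b, hb, j, hj, rfl⟩

/-- The start of the computation: the flag and both counters are copied. -/
def pullInit : Pos K → Option (Pos K)
  | .c => some .c
  | .g => some .g
  | .t b j => some (.t b j)
  | .i b j => some (.i b j)
  | _ => none

/-- A recursive call for the previous row and the `d`-th neighbour: the time counter is decremented,
`d - 1` is added to the place counter. -/
def pullMove (d : Fin 3) : Pos K → Option (Pos K)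
  | .c => some .c
  | .g => some .g
  | .a s => some (.f d.castSucc s)
  | .t b j => some (.t b ((j + 1) % (b + 1)))
  | .i b j => some (.i b ((j + 1 + d * b) % (b + 1)))
  | _ => none

/-- The call of a search for the content of a cell of the initial row. -/
def pullLook : Pos K → Option (Pos K)
  | .c => some .c
  | .a s => some (.f 3 s)
  | .i b j => some (.i b j)
  | _ => none

/-- The next call of the search: the place counter is decremented. -/
def pullNext : Pos K → Option (Pos K)
  | .c => some .c
  | .a s => some (.f 0 s)
  | .i b j => some (.i b ((j + 1) % (b + 1)))
  | _ => none

/-- The call of a test whether the position `q` equals `c`. -/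
def pullTest (q : Pos K) : Pos K → Option (Pos K)
  | .c => some .c
  | .g => some q
  | .z => some .z
  | _ => none

/-- The rules for an input word of length `n`. Relation `0` holds the initial fact, relation `1` the
cells of the space-time diagram, relation `2` the tests, and relation `4 + k` the level `k` of the
search in the initial row, which compares the place with the position of the `k`-th letter. -/
def rules (K m n : ℕ) : List (Rule K) :=
  [⟨0, 1, pullInit⟩, ⟨1, 1, pullMove 0⟩, ⟨1, 1, pullMove 1⟩, ⟨1, 1, pullMove 2⟩,
      ⟨1, 4, pullLook⟩] ++
    ((nonzeroMarks m).map (fun p => ⟨1, 2, pullTest (.t p.1 p.2)⟩) ++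
      (List.range n).flatMap fun k => ⟨4 + k, 5 + k, pullNext⟩ ::
        (nonzeroMarks m).map fun p => ⟨4 + k, 2, pullTest (.i p.1 p.2)⟩)

/-- The transition of the automaton, at a nonzero time. -/
def stepPat (A : Automaton K) (s₁ s₂ s₃ : Fin K) : Pat K where
  rel := 1
  eq
    | .z => true
    | .f d s => decide (d = 0 ∧ s = s₁ ∨ d = 1 ∧ s = s₂ ∨ d = 2 ∧ s = s₃)
    | _ => false
  out := .a (A.step s₁ s₂ s₃)

/-- At time zero, the result is that of the search in the initial row. -/
def basePat (s : Fin K) : Pat K where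
  rel := 1
  eq
    | .f d s' => decide (d = 3 ∧ s' = s)
    | .t _ j => decide (j = 0)
    | _ => false
  out := .a s

/-- The symbol `s` sets the global flag. -/
def acceptPat (s : Fin K) : Pat K where
  rel := 1
  eq
    | .a s' => decide (s' = s)
    | _ => false
  out := .g

/-- A successful test sets the guard. -/
def testPat : Pat K where
  rel := 2
  eq
    | .g => true
    | _ => false
  out := .z

/-- The search at level `k` is successful if the place counter is zero. -/
def letterPat (k : ℕ) (s : Fin K) : Pat K where
  rel := 4 + k
  eq
    | .i _ j => decide (j = 0)
    | _ => false
  out := .a s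

/-- The search at level `k` takes over the result of the next level at a nonzero place. -/
def nextPat (k : ℕ) (s : Fin K) : Pat K where
  rel := 4 + k
  eq
    | .z => true
    | .f d s' => decide (d = 0 ∧ s' = s)
    | _ => false
  out := .a s

/-- At the end of the input word, the result of the search is the blank. -/
def blankPat (A : Automaton K) (n : ℕ) : Pat K := ⟨4 + n, fun _ => false, .a A.blank⟩

/-- The patterns for the input word `u`. -/
def patterns (A : Automaton K) (u : List (Fin K)) : List (Pat K) :=
  ((List.finRange K).flatMap fun s₁ => (List.finRange K).flatMap fun s₂ =>
      (List.finRange K).map fun s₃ => stepPat A s₁ s₂ s₃) ++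
    ((List.finRange K).map basePat ++ (((List.finRange K).filter A.acc).map acceptPat ++
      (testPat :: (u.zipIdx.map (fun p => letterPat p.2 p.1) ++
        ((List.range u.length).flatMap (fun k => (List.finRange K).map (nextPat k)) ++
          [blankPat A u.length])))))

variable {m : ℕ}

theorem mod_add_inj {b j j' c : ℕ} (hj : j ≤ b) (hj' : j' ≤ b)
    (h : (j + c) % (b + 1) = (j' + c) % (b + 1)) : j = j' := by
  have h1 : j ≡ j' [MOD b + 1] := Nat.ModEq.add_right_cancel' c h
  rwa [Nat.ModEq, Nat.mod_eq_of_lt (by omega), Nat.mod_eq_of_lt (by omega)] at h1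

theorem valid_rules {n : ℕ} : ∀ ρ ∈ rules K m n, ρ.Valid m n := by
  have key : ∀ (r r' : ℕ) (f : Pos K → Option (Pos K)), RelOk n r → RelOk n r' → r' ≠ 0 →
      (∀ p ∈ positions K m, ∀ q, f p = some q → q ∈ positions K m) →
      (∀ p ∈ positions K m, ∀ p' ∈ positions K m, ∀ q, f p = some q → f p' = some q → p = p') →
      Rule.Valid m n ⟨r, r', f⟩ := fun r r' f h1 h2 h3 h4 h5 => ⟨h1, h2, h3, h4, h5⟩
  have mod_le : ∀ x b : ℕ, x % (b + 1) ≤ b := fun x b => Nat.le_of_lt_succ (Nat.mod_lt _ (by omega))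
  have ok : ∀ {r}, r ≠ 3 → r < 5 + n → RelOk n r := fun h h' => ⟨h, h'⟩
  have hmove : ∀ d : Fin 3, Rule.Valid (K := K) m n ⟨1, 1, pullMove d⟩ := by
    intro d
    refine key _ _ _ (ok (by omega) (by omega)) (ok (by omega) (by omega)) (by omega) ?_ ?_
    · rintro (_ | _ | _ | s | ⟨e, s⟩ | ⟨b, j⟩ | ⟨b, j⟩) hp q hq <;>
        simp only [pullMove, Option.some.injEq, reduceCtorEq] at hq <;> subst hq <;>
        simp only [c_mem, g_mem, f_mem, t_mem, i_mem] at hp ⊢ <;> exact ⟨hp.1, mod_le _ _⟩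
    · rintro (_ | _ | _ | s | ⟨e, s⟩ | ⟨b, j⟩ | ⟨b, j⟩) hp
        (_ | _ | _ | s' | ⟨e', s'⟩ | ⟨b', j'⟩ | ⟨b', j'⟩) hp' q hq hq' <;>
        simp only [pullMove, Option.some.injEq, reduceCtorEq] at hq hq' <;> subst hq <;>
        simp only [reduceCtorEq, Pos.f.injEq, Pos.t.injEq, Pos.i.injEq] at hq' <;>
        first
        | rfl
        | rw [hq'.2]
        | (obtain ⟨rfl, h⟩ := hq'
           first
           | exact congrArg _ (mod_add_inj (t_mem.1 hp).2 (t_mem.1 hp').2 h.symm)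
           | exact congrArg _ (mod_add_inj (i_mem.1 hp).2 (i_mem.1 hp').2
               (by simpa [add_assoc] using h.symm)))
  have htest : ∀ r (q : Pos K), RelOk n r → q ∈ positions K m → q ≠ .c → q ≠ .z →
      Rule.Valid m n ⟨r, 2, pullTest q⟩ := by
    intro r q hr hq hc hz
    refine key _ _ _ hr (ok (by omega) (by omega)) (by omega) ?_ ?_
    · rintro (_ | _ | _ | s | ⟨e, s⟩ | ⟨b, j⟩ | ⟨b, j⟩) hp q' hq' <;>
        simp only [pullTest, Option.some.injEq, reduceCtorEq] at hq' <;> subst hq' <;> assumption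
    · rintro (_ | _ | _ | s | ⟨e, s⟩ | ⟨b, j⟩ | ⟨b, j⟩) -
        (_ | _ | _ | s' | ⟨e', s'⟩ | ⟨b', j'⟩ | ⟨b', j'⟩) - q₁ hq₁ hq₂ <;>
        simp only [pullTest, Option.some.injEq, reduceCtorEq] at hq₁ hq₂ <;> grind
  intro ρ hρ
  simp only [rules, List.mem_append, List.mem_cons, List.not_mem_nil, or_false, List.mem_map,
    List.mem_flatMap, List.mem_range, mem_nonzeroMarks] at hρ
  rcases hρ with (rfl | rfl | rfl | rfl | rfl) |
    (⟨p, ⟨b, j, hb, hj, rfl⟩, rfl⟩ | ⟨k, hk, rfl | ⟨p, ⟨b, j, hb, hj, rfl⟩, rfl⟩⟩)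
  · refine key _ _ _ relOk_zero (ok (by omega) (by omega)) (by omega) ?_ ?_
    · rintro (_ | _ | _ | s | ⟨e, s⟩ | ⟨b, j⟩ | ⟨b, j⟩) hp q hq <;>
        simp only [pullInit, Option.some.injEq, reduceCtorEq] at hq <;> subst hq <;> exact hp
    · rintro (_ | _ | _ | s | ⟨e, s⟩ | ⟨b, j⟩ | ⟨b, j⟩) -
        (_ | _ | _ | s' | ⟨e', s'⟩ | ⟨b', j'⟩ | ⟨b', j'⟩) - q hq hq' <;>
        simp only [pullInit, Option.some.injEq, reduceCtorEq] at hq hq' <;> grind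
  · exact hmove 0
  · exact hmove 1
  · exact hmove 2
  · refine key _ _ _ (ok (by omega) (by omega)) (ok (by omega) (by omega)) (by omega) ?_ ?_
    · rintro (_ | _ | _ | s | ⟨e, s⟩ | ⟨b, j⟩ | ⟨b, j⟩) hp q hq <;>
        simp only [pullLook, Option.some.injEq, reduceCtorEq] at hq <;> subst hq <;>
        simp only [c_mem, f_mem, i_mem] at hp ⊢ <;> exact hp
    · rintro (_ | _ | _ | s | ⟨e, s⟩ | ⟨b, j⟩ | ⟨b, j⟩) -
        (_ | _ | _ | s' | ⟨e', s'⟩ | ⟨b', j'⟩ | ⟨b', j'⟩) - q hq hq' <;>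
        simp only [pullLook, Option.some.injEq, reduceCtorEq] at hq hq' <;> grind
  · exact htest _ _ (ok (by omega) (by omega)) (t_mem.2 ⟨hb, by omega⟩) (by simp) (by simp)
  · refine key _ _ _ (ok (by omega) (by omega)) (ok (by omega) (by omega)) (by omega) ?_ ?_
    · rintro (_ | _ | _ | s | ⟨e, s⟩ | ⟨b, j⟩ | ⟨b, j⟩) hp q hq <;>
        simp only [pullNext, Option.some.injEq, reduceCtorEq] at hq <;> subst hq <;>
        simp only [c_mem, f_mem, i_mem] at hp ⊢ <;> exact ⟨hp.1, mod_le _ _⟩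
    · rintro (_ | _ | _ | s | ⟨e, s⟩ | ⟨b, j⟩ | ⟨b, j⟩) hp
        (_ | _ | _ | s' | ⟨e', s'⟩ | ⟨b', j'⟩ | ⟨b', j'⟩) hp' q hq hq' <;>
        simp only [pullNext, Option.some.injEq, reduceCtorEq] at hq hq' <;> subst hq <;>
        simp only [reduceCtorEq, Pos.f.injEq, Pos.i.injEq] at hq' <;>
        first
        | rfl
        | rw [hq'.2]
        | (obtain ⟨rfl, h⟩ := hq'
           exact congrArg _ (mod_add_inj (i_mem.1 hp).2 (i_mem.1 hp').2 h.symm))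
  · exact htest _ _ (ok (by omega) (by omega)) (i_mem.2 ⟨hb, by omega⟩) (by simp) (by simp)

theorem mem_patterns {A : Automaton K} {u : List (Fin K)} {P : Pat K} :
    P ∈ patterns A u ↔ (∃ s₁ s₂ s₃, stepPat A s₁ s₂ s₃ = P) ∨ (∃ s, basePat s = P) ∨
      (∃ s, A.acc s ∧ acceptPat s = P) ∨ P = testPat ∨
      (∃ k s, u[k]? = some s ∧ letterPat k s = P) ∨ (∃ k < u.length, ∃ s, nextPat k s = P) ∨
      P = blankPat A u.length := by
  simp only [patterns, List.mem_append, List.mem_cons, List.not_mem_nil, or_false, List.mem_map,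
    List.mem_flatMap, List.mem_range, List.mem_finRange, true_and, List.mem_filter, Prod.exists,
    List.mk_mem_zipIdx_iff_getElem?]
  rw [exists_comm (p := fun s k => u[k]? = some s ∧ letterPat k s = P)]

theorem valid_patterns {A : Automaton K} {u : List (Fin K)} :
    ∀ P ∈ patterns A u, P.Valid m u.length := by
  intro P hP
  rw [mem_patterns] at hP
  rcases hP with ⟨s₁, s₂, s₃, rfl⟩ | ⟨s, rfl⟩ | ⟨s, -, rfl⟩ | rfl | ⟨k, s, hk, rfl⟩ |
    ⟨k, hk, s, rfl⟩ | rfl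
  · exact ⟨⟨by simp [stepPat], by simp [stepPat]; omega⟩, by simp [stepPat], a_mem _, rfl⟩
  · exact ⟨⟨by simp [basePat], by simp [basePat]; omega⟩, by simp [basePat], a_mem _, rfl⟩
  · exact ⟨⟨by simp [acceptPat], by simp [acceptPat]; omega⟩, by simp [acceptPat], g_mem, rfl⟩
  · exact ⟨⟨by simp [testPat], by simp [testPat]; omega⟩, by simp [testPat], z_mem, rfl⟩
  · obtain ⟨hk, -⟩ := List.getElem?_eq_some_iff.1 hk
    exact ⟨⟨by simp [letterPat]; omega, by simp [letterPat]; omega⟩, by simp [letterPat],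
      a_mem _, rfl⟩
  · exact ⟨⟨by simp [nextPat]; omega, by simp [nextPat]; omega⟩, by simp [nextPat], a_mem _, rfl⟩
  · exact ⟨⟨by simp [blankPat]; omega, by simp [blankPat]⟩, by simp [blankPat], a_mem _, rfl⟩

/-! ### Every model derives the space-time diagram -/

section derivation

variable {K m : ℕ} {A : Automaton K} {u : List (Fin K)} {D : Set Fact}

/-- The value assignment has the value `0` at all marks of the value `x` of the place counter. -/
def PlaceAt (m : ℕ) (v : Pos K → ℕ) (x : ℤ) : Prop :=
  ∀ b < m, ∀ j ≤ b, Marked b j x → v (.i b j) = 0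

/-- The value assignment has the value `0` at all marks of the value `x` of the time counter. -/
def TimeAt (m : ℕ) (v : Pos K → ℕ) (x : ℤ) : Prop :=
  ∀ b < m, ∀ j ≤ b, Marked b j x → v (.t b j) = 0

theorem mod_succ_le (x b : ℕ) : x % (b + 1) ≤ b := Nat.le_of_lt_succ (Nat.mod_lt _ (by omega))

theorem PlaceAt.shift {v v' : Pos K → ℕ} {x : ℤ} (h : PlaceAt m v x) (d : ℕ)
    (e : ∀ b < m, ∀ j ≤ b, v' (.i b j) = v (.i b ((j + 1 + d * b) % (b + 1)))) :
    PlaceAt m v' (x + d - 1) := fun b hb j hj hx => by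
  rw [e b hb j hj]
  exact h b hb _ (mod_succ_le _ _) ((marked_shift d).1 hx)

theorem TimeAt.pred {v v' : Pos K → ℕ} {x : ℤ} (h : TimeAt m v x)
    (e : ∀ b < m, ∀ j ≤ b, v' (.t b j) = v (.t b ((j + 1) % (b + 1)))) :
    TimeAt m v' (x - 1) := fun b hb j hj hx => by
  rw [e b hb j hj]
  exact h b hb _ (mod_succ_le _ _) (marked_pred.1 hx)

/-- Tests of marks at nonzero residues make sure that the guard is set. -/
theorem guard_eq_zero (hD : IsModel m (rules K m u.length) (patterns A u) D) {r : ℕ} {q : Pos K}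
    (hr : (⟨r, 2, pullTest q⟩ : Rule K) ∈ rules K m u.length) {v : Pos K → ℕ}
    (hv : fact m r v ∈ D) (hc : v .c = 0) (hq : v q = 0) : v .z = 0 := by
  obtain ⟨v', hv', e⟩ := hD.closed _ hr v hv
  have h1 : v' .c = v .c := e _ c_mem _ rfl
  have h2 : v' .g = v q := e _ g_mem _ rfl
  have h3 : v' .z = v .z := e _ z_mem _ rfl
  rw [← h3]
  refine hD.ok testPat (mem_patterns.2 (by simp)) v' hv' ?_
  rintro (_ | _ | _ | s | ⟨d, s⟩ | ⟨b, j⟩ | ⟨b, j⟩) - hp <;> simp only [testPat] at hp <;>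
    try exact absurd hp Bool.false_ne_true
  rw [h1, h2, hc, hq]

/-- The search at level `u₁.length` finds the content of a cell in the rest `u₂` of the input
word. -/
theorem lookup_eq_zero (hD : IsModel m (rules K m u.length) (patterns A u) D) :
    ∀ (u₂ u₁ : List (Fin K)), u = u₁ ++ u₂ → ∀ (i : ℤ) (v : Pos K → ℕ),
      fact m (4 + u₁.length) v ∈ D → v .c = 0 → PlaceAt m v i → v (.a (lookup A m u₂ i)) = 0 := by
  intro u₂
  induction u₂ with
  | nil =>
    intro u₁ hu i v hv hc hi
    simp only [List.append_nil] at hu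
    subst hu
    exact hD.ok (blankPat A u.length) (mem_patterns.2 (by simp)) v hv (by simp [blankPat])
  | cons s u₂ ih =>
    intro u₁ hu i v hv hc hi
    have hk : u₁.length < u.length := by simp [hu]
    simp only [lookup]
    split_ifs with hL
    · refine hD.ok (letterPat u₁.length s) (mem_patterns.2 ?_) v hv ?_
      · exact .inr (.inr (.inr (.inr (.inl ⟨_, s, by simp [hu], rfl⟩))))
      · rintro (_ | _ | _ | s | ⟨d, s⟩ | ⟨b, j⟩ | ⟨b, j⟩) hp hp' <;>
          simp only [letterPat, decide_eq_true_eq] at hp' <;>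
          try exact absurd hp' Bool.false_ne_true
        subst hp'
        rw [hc]
        exact hi b (i_mem.1 hp).1 0 (Nat.zero_le _) (period_dvd.1 hL b (i_mem.1 hp).1)
    · obtain ⟨b, j, hb, hj, hbj⟩ := not_period_dvd.1 hL
      have hz : v .z = 0 := by
        refine guard_eq_zero hD (q := .i b (j + 1)) ?_ hv hc (hi b hb _ (by omega) hbj)
        simp only [rules, List.mem_append, List.mem_flatMap, List.mem_range, List.mem_cons,
          List.mem_map]
        exact .inr (.inr ⟨_, hk, .inr ⟨(b, j + 1), mem_nonzeroMarks.2 ⟨b, j, hb, hj, rfl⟩, rfl⟩⟩)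
      obtain ⟨v', hv', e⟩ := hD.closed ⟨4 + u₁.length, 5 + u₁.length, pullNext⟩ (by
        simp only [rules, List.mem_append, List.mem_flatMap, List.mem_range, List.mem_cons]
        exact .inr (.inr ⟨_, hk, .inl rfl⟩)) v hv
      have h1 := ih (u₁ ++ [s]) (by simp [hu]) (i - 1) v'
        (by simpa [add_assoc, add_comm, add_left_comm] using hv') (by rw [e _ c_mem _ rfl, hc])
        (by simpa using hi.shift 0 fun b hb j hj => e _ (i_mem.2 ⟨hb, hj⟩) _ (by simp [pullNext]))
      rw [e _ (a_mem _) _ rfl] at h1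
      refine hD.ok (nextPat u₁.length (lookup A m u₂ (i - 1))) (mem_patterns.2 ?_) v hv ?_
      · exact .inr (.inr (.inr (.inr (.inr (.inl ⟨_, hk, _, rfl⟩)))))
      · rintro (_ | _ | _ | s | ⟨d, s⟩ | ⟨b, j⟩ | ⟨b, j⟩) - hp' <;>
          simp only [nextPat, decide_eq_true_eq] at hp' <;> try exact absurd hp' Bool.false_ne_true
        · rw [hz, hc]
        · rw [hp'.1, hp'.2, h1, hc]

/-- In every model, the fact for a cell has the flag of the correct symbol set. -/
theorem row_eq_zero (hD : IsModel m (rules K m u.length) (patterns A u) D) :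
    ∀ r < period m, ∀ (i : ℤ) (v : Pos K → ℕ), fact m 1 v ∈ D → v .c = 0 → TimeAt m v r →
      PlaceAt m v i → v (.a (row A m u r i)) = 0 := by
  intro r
  induction r with
  | zero =>
    intro _ i v hv hc ht hi
    obtain ⟨v', hv', e⟩ := hD.closed ⟨1, 4, pullLook⟩ (by simp [rules]) v hv
    have h1 := lookup_eq_zero hD u [] rfl i v' hv' (by rw [e _ c_mem _ rfl, hc])
      (fun b hb j hj hx => by rw [e _ (i_mem.2 ⟨hb, hj⟩) _ rfl]; exact hi b hb j hj hx)
    rw [e _ (a_mem _) _ rfl] at h1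
    refine hD.ok (basePat (lookup A m u i)) (mem_patterns.2 (.inr (.inl ⟨_, rfl⟩))) v hv ?_
    rintro (_ | _ | _ | s | ⟨d, s⟩ | ⟨b, j⟩ | ⟨b, j⟩) hp hp' <;>
      simp only [basePat, decide_eq_true_eq] at hp' <;> try exact absurd hp' Bool.false_ne_true
    · rw [hp'.1, hp'.2, h1, hc]
    · subst hp'
      rw [hc]
      exact ht b (t_mem.1 hp).1 0 (Nat.zero_le _) (by simp [Marked])
  | succ r ih =>
    intro hr i v hv hc ht hi
    have hL : ¬ (period m : ℤ) ∣ ((r + 1 : ℕ) : ℤ) := fun h => by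
      have := Nat.le_of_dvd (by omega) (Int.natCast_dvd_natCast.1 h)
      omega
    obtain ⟨b, j, hb, hj, hbj⟩ := not_period_dvd.1 hL
    have hz : v .z = 0 := by
      refine guard_eq_zero hD (q := .t b (j + 1)) ?_ hv hc (ht b hb _ (by omega) hbj)
      simp only [rules, List.mem_append, List.mem_map]
      exact .inr (.inl ⟨(b, j + 1), mem_nonzeroMarks.2 ⟨b, j, hb, hj, rfl⟩, rfl⟩)
    have child : ∀ d : Fin 3, v (.f d.castSucc (row A m u r (i + (d : ℕ) - 1))) = 0 := by
      intro d
      obtain ⟨v', hv', e⟩ := hD.closed ⟨1, 1, pullMove d⟩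
        (by fin_cases d <;> simp [rules]) v hv
      have h1 := ih (by omega) (i + (d : ℕ) - 1) v' hv' (by rw [e _ c_mem _ rfl, hc])
        (by simpa using ht.pred fun b hb j hj => e _ (t_mem.2 ⟨hb, hj⟩) _ rfl)
        (hi.shift d fun b hb j hj => e _ (i_mem.2 ⟨hb, hj⟩) _ rfl)
      rwa [e _ (a_mem _) _ rfl] at h1
    have c0 := child 0
    have c1 := child 1
    have c2 := child 2
    simp only [Fin.val_zero, Fin.val_one, Fin.val_two, Nat.cast_zero, Nat.cast_one, Nat.cast_ofNat,
      add_zero, add_sub_cancel_right, show i + 2 - 1 = i + 1 by ring] at c0 c1 c2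
    refine hD.ok (stepPat A _ _ _) (mem_patterns.2 (.inl ⟨_, _, _, rfl⟩)) v hv ?_
    rintro (_ | _ | _ | s | ⟨d, s⟩ | ⟨b, j⟩ | ⟨b, j⟩) - hp' <;>
      simp only [stepPat, decide_eq_true_eq] at hp' <;> try exact absurd hp' Bool.false_ne_true
    · rw [hz, hc]
    · rw [hc]
      rcases hp' with ⟨rfl, rfl⟩ | ⟨rfl, rfl⟩ | ⟨rfl, rfl⟩
      · exact c0
      · exact c1
      · exact c2

/-- Every cell of the space-time diagram is called, if the counters are read modulo the period. -/
theorem exists_call (hD : IsModel m (rules K m u.length) (patterns A u) D) {v₀ : Pos K → ℕ}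
    (hv₀ : fact m 0 v₀ ∈ D) : ∀ (s : ℕ) (i : ℤ), |i| ≤ s → ∃ v : Pos K → ℕ, fact m 1 v ∈ D ∧
      v .c = 0 ∧ v .g = v₀ .g ∧ TimeAt m v (-s) ∧ PlaceAt m v i := by
  have h0 := hD.init_exposed v₀ hv₀
  intro s
  induction s with
  | zero =>
    intro i hi
    obtain ⟨v, hv, e⟩ := hD.closed ⟨0, 1, pullInit⟩ (by simp [rules]) v₀ hv₀
    have hzero : ∀ b j : ℕ, j ≤ b → Marked b j 0 → j = 0 := fun b j hj h => by
      have h1 : b + 1 ∣ j := by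
        have h2 : ((b + 1 : ℕ) : ℤ) ∣ (j : ℤ) := by simpa [Marked] using h
        exact Int.natCast_dvd_natCast.1 h2
      exact Nat.eq_zero_of_dvd_of_lt h1 (by omega)
    obtain rfl : i = 0 := by simpa using hi
    refine ⟨v, hv, ?_, e _ g_mem _ rfl, fun b hb j hj h => ?_, fun b hb j hj h => ?_⟩
    · rw [e _ c_mem _ rfl]
      exact h0 _ (by simp [exposed])
    · rw [e _ (t_mem.2 ⟨hb, hj⟩) _ rfl, hzero b j hj (by simpa using h)]
      exact h0 _ (by simp [exposed, hb])
    · rw [e _ (i_mem.2 ⟨hb, hj⟩) _ rfl, hzero b j hj h]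
      exact h0 _ (by simp [exposed, hb])
  | succ s ih =>
    intro i hi
    -- a neighbour of the cell that is closer to the origin
    obtain ⟨d, hd⟩ : ∃ d : Fin 3, |i - ((d : ℕ) - 1)| ≤ s := by
      rw [abs_le] at hi
      push_cast at hi
      rcases lt_trichotomy i 0 with h | h | h
      · exact ⟨0, by rw [abs_le]; simp; omega⟩
      · exact ⟨1, by simp [h]⟩
      · exact ⟨2, by rw [abs_le]; simp; omega⟩
    obtain ⟨v, hv, hc, hg, ht, hi'⟩ := ih _ hd
    obtain ⟨v', hv', e⟩ := hD.closed ⟨1, 1, pullMove d⟩ (by fin_cases d <;> simp [rules]) v hv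
    refine ⟨v', hv', by rw [e _ c_mem _ rfl, hc], by rw [e _ g_mem _ rfl, hg], ?_, ?_⟩
    · rw [show (-((s + 1 : ℕ) : ℤ)) = -s - 1 by push_cast; ring]
      exact ht.pred fun b hb j hj => e _ (t_mem.2 ⟨hb, hj⟩) _ rfl
    · have := hi'.shift d fun b hb j hj => e _ (i_mem.2 ⟨hb, hj⟩) _ rfl
      rwa [show i - (((d : ℕ) : ℤ) - 1) + (d : ℕ) - 1 = i by ring] at this

/-- An accepting symbol in the space-time diagram sets the global flag of the initial fact. -/
theorem IsModel.policy_holds (hD : IsModel m (rules K m u.length) (patterns A u) D) {r : ℕ} {i : ℤ}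
    (hr : r < period m) (hacc : A.acc (row A m u r i)) : (policyCQ K m).Holds D [] := by
  obtain ⟨v₀, hv₀⟩ := hD.init_nonempty
  -- a number `s` of steps back from time `0` that leads to time `r` modulo the period, and is large
  -- enough to reach the place `i`
  obtain ⟨s, hs, hle⟩ : ∃ s : ℕ, (period m : ℤ) ∣ r - -s ∧ |i| ≤ s := by
    refine ⟨period m * (i.natAbs + 1) - r, ?_, ?_⟩
    · have h1 : r ≤ period m * (i.natAbs + 1) := hr.le.trans (Nat.le_mul_of_pos_right _ (by omega))
      push_cast [h1]
      exact ⟨|i| + 1, by ring⟩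
    · have h1 : i.natAbs + r ≤ period m * (i.natAbs + 1) := by
        nlinarith [Nat.mul_le_mul_right i.natAbs (show 1 ≤ period m by omega)]
      rw [Int.abs_eq_natAbs]
      omega
  obtain ⟨v, hv, hc, hg, ht, hi⟩ := exists_call hD hv₀ s i hle
  have ha := row_eq_zero hD r hr i v hv hc
    (fun b hb j hj h => ht b hb j hj ((marked_congr hb hs).1 h)) hi
  have h0 : v .g = 0 := by
    refine hD.ok (acceptPat (row A m u r i)) (mem_patterns.2 ?_) v hv ?_
    · exact .inr (.inr (.inl ⟨_, hacc, rfl⟩))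
    · rintro (_ | _ | _ | s | ⟨d, s⟩ | ⟨b, j⟩ | ⟨b, j⟩) - hp' <;>
        simp only [acceptPat, decide_eq_true_eq] at hp' <;> try exact absurd hp' Bool.false_ne_true
      rw [hp', ha, hc]
  refine policyCQ_holds_iff.2 ⟨v₀, hv₀, ?_⟩
  rw [← hg, h0, hD.init_exposed v₀ hv₀ .c (by simp [exposed])]

end derivation

/-! ### The countermodel of a rejecting run -/

section countermodel

variable {K : ℕ} (m : ℕ) (A : Automaton K) (u : List (Fin K))

/-- The content of a cell at an arbitrary integer time, read modulo the period. -/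
def cell (t i : ℤ) : Fin K := row A m u (t % period m).toNat i

/-- The positions with value `0` in the initial fact. -/
def initVec : Pos K → Prop
  | .c => True
  | .t _ j => j = 0
  | .i _ j => j = 0
  | _ => False

/-- The positions with value `0` in the fact that computes the cell `i` at time `t`. -/
def cellVec (t i : ℤ) : Pos K → Prop
  | .c => True
  | .g => False
  | .z => ¬ (period m : ℤ) ∣ t
  | .a s => s = cell m A u t i
  | .f d s => s = if d = 3 then lookup A m u i else cell m A u (t - 1) (i + (d : ℕ) - 1)
  | .t b j => Marked b j t
  | .i b j => Marked b j i

/-- The positions with value `0` in the fact that computes the cell `i` of the initial row for the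
word `w`. -/
def lookVec (w : List (Fin K)) (i : ℤ) : Pos K → Prop
  | .c => True
  | .z => ¬ (period m : ℤ) ∣ i
  | .a s => s = lookup A m w i
  | .f _ s => s = lookup A m w.tail (i - 1)
  | .i b j => Marked b j i
  | _ => False

/-- The positions with value `0` in the fact that tests whether `y` holds, with guard `x`. -/
def testVec (x y : Prop) : Pos K → Prop
  | .c => True
  | .g => y
  | .z => x
  | _ => False

/-- The facts of the countermodel, given by their positions with value `0`. The all-zero facts make
every mapping rule produce its fact of the critical instance. A test fact, whose flag and guard are
those of its caller, has the guard set if the flag is. -/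
inductive CounterFact : ℕ → (Pos K → Prop) → Prop
  | init : CounterFact 0 initVec
  | cell (t i : ℤ) : CounterFact 1 (cellVec m A u t i)
  | look (k : ℕ) (hk : k ≤ u.length) (i : ℤ) : CounterFact (4 + k) (lookVec m A (u.drop k) i)
  | test (x y : Prop) (h : y → x) : CounterFact 2 (testVec x y)
  | zero (r : ℕ) (h : RelOk u.length r) (h0 : r ≠ 0) : CounterFact r fun _ => True

open Classical in
/-- The value assignment that is `0` on the given positions and `1` elsewhere. -/
noncomputable def vecVal (w : Pos K → Prop) (p : Pos K) : ℕ := if w p then 0 else 1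

/-- The countermodel. -/
def counterModel : Set Fact :=
  insert ⟨3, [0]⟩ {f | ∃ r w, CounterFact m A u r w ∧ f = fact m r (vecVal w)}

variable {m A u}

theorem vecVal_eq_zero {w : Pos K → Prop} {p : Pos K} : vecVal w p = 0 ↔ w p := by
  simp [vecVal]

theorem vecVal_eq_vecVal {w w' : Pos K → Prop} {p q : Pos K} :
    vecVal w p = vecVal w' q ↔ (w p ↔ w' q) := by
  unfold vecVal
  split_ifs <;> simp_all

theorem CounterFact.relOk {r : ℕ} {w : Pos K → Prop} (h : CounterFact m A u r w) :
    RelOk u.length r := by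
  cases h with
  | zero r h h0 => exact h
  | _ => exact ⟨by omega, by omega⟩

theorem CounterFact.c {r : ℕ} {w : Pos K → Prop} (h : CounterFact m A u r w) : w .c := by
  cases h <;> trivial

theorem CounterFact.of_init {w : Pos K → Prop} (h : CounterFact m A u 0 w) : w = initVec := by
  generalize hr : 0 = r at h
  cases h with
  | init => rfl
  | zero r h h0 => exact absurd hr.symm h0
  | _ => omega

theorem CounterFact.of_cell {w : Pos K → Prop} (h : CounterFact m A u 1 w) :
    (w = fun _ => True) ∨ ∃ t i, w = cellVec m A u t i := by
  generalize hr : 1 = r at h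
  cases h with
  | cell t i => exact .inr ⟨t, i, rfl⟩
  | zero => exact .inl rfl
  | _ => omega

theorem CounterFact.of_test {w : Pos K → Prop} (h : CounterFact m A u 2 w) :
    (w = fun _ => True) ∨ ∃ x y : Prop, (y → x) ∧ w = testVec x y := by
  generalize hr : 2 = r at h
  cases h with
  | test x y h => exact .inr ⟨x, y, h, rfl⟩
  | zero => exact .inl rfl
  | _ => omega

theorem CounterFact.of_look {k : ℕ} {w : Pos K → Prop} (h : CounterFact m A u (4 + k) w) :
    (w = fun _ => True) ∨ ∃ i, w = lookVec m A (u.drop k) i := by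
  generalize hr : 4 + k = r at h
  cases h with
  | look k' hk' i =>
    obtain rfl : k = k' := by omega
    exact .inr ⟨i, rfl⟩
  | zero => exact .inl rfl
  | _ => omega

theorem fact_mem_counterModel {r : ℕ} {v : Pos K → ℕ} (hr : r ≠ 3) :
    fact m r v ∈ counterModel m A u ↔
      ∃ w, CounterFact m A u r w ∧ ∀ p ∈ positions K m, v p = vecVal w p := by
  constructor
  · rintro (h | ⟨r', w, hw, h⟩)
    · simp only [fact, Fact.mk.injEq] at h
      exact absurd h.1 hr
    · simp only [fact, Fact.mk.injEq] at h
      obtain ⟨rfl, h⟩ := h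
      exact ⟨w, hw, List.map_inj_left.1 h⟩
  · rintro ⟨w, hw, h⟩
    exact .inr ⟨r, w, hw, fact_congr h⟩

theorem finite_counterModel : (counterModel m A u).Finite := by
  refine Set.Finite.insert _ ?_
  have h1 : {l : List ℕ | l.length = (positions K m).length ∧
      ∀ x ∈ l, x ∈ ({0, 1} : Set ℕ)}.Finite := by
    have h2 := List.finite_length_eq (Fin 2) (positions K m).length
    refine (h2.image (List.map Fin.val)).subset ?_
    rintro l ⟨hl, hx⟩
    have hx' : ∀ x ∈ l, x < 2 := fun x h => by
      rcases hx x h with rfl | rfl <;> omega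
    lift l to List (Fin 2) using hx'
    exact ⟨l, by simpa using hl, rfl⟩
  refine (((Set.finite_Iio (5 + u.length)).prod h1).image fun q : ℕ × List ℕ =>
    (⟨q.1, q.2⟩ : Fact)).subset ?_
  rintro _ ⟨r, w, hw, rfl⟩
  refine ⟨(r, (positions K m).map (vecVal w)), ⟨hw.relOk.2, by simp, ?_⟩, rfl⟩
  intro x hx
  obtain ⟨p, -, rfl⟩ := List.mem_map.1 hx
  unfold vecVal
  split_ifs <;> simp

/-- Rules and patterns can be checked on the sets of positions with value `0`. -/
theorem closed_counterModel {ρ : Rule K} (hs : ρ.src ≠ 3) (ht : ρ.tgt ≠ 3)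
    (hρ : ∀ p ∈ positions K m, ∀ q, ρ.pull p = some q → q ∈ positions K m)
    (H : ∀ w, CounterFact m A u ρ.src w → ∃ w', CounterFact m A u ρ.tgt w' ∧
      ∀ p ∈ positions K m, ∀ q, ρ.pull p = some q → (w' p ↔ w q)) :
    ρ.Closed m (counterModel m A u) := by
  intro v hv
  obtain ⟨w, hw, e⟩ := (fact_mem_counterModel hs).1 hv
  obtain ⟨w', hw', e'⟩ := H w hw
  refine ⟨vecVal w', (fact_mem_counterModel ht).2 ⟨w', hw', fun _ _ => rfl⟩, fun p hp q hq => ?_⟩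
  rw [e q (hρ p hp q hq)]
  exact vecVal_eq_vecVal.2 (e' p hp q hq)

theorem ok_counterModel {P : Pat K} (hr : P.rel ≠ 3) (hout : P.out ∈ positions K m)
    (H : ∀ w, CounterFact m A u P.rel w → w .c → (∀ p ∈ positions K m, P.eq p → w p) → w P.out) :
    P.Ok m (counterModel m A u) := by
  intro v hv hp
  obtain ⟨w, hw, e⟩ := (fact_mem_counterModel hr).1 hv
  rw [e _ hout, vecVal_eq_zero]
  have hc : w .c := hw.c
  refine H w hw hc fun p hp' hq => ?_
  have := hp p hp' hq
  rw [e p hp', e .c c_mem, vecVal_eq_zero.2 hc] at this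
  exact vecVal_eq_zero.1 this

theorem cell_of_not_dvd {t : ℤ} (h : ¬ (period m : ℤ) ∣ t) (i : ℤ) :
    cell m A u t i = A.step (cell m A u (t - 1) (i - 1)) (cell m A u (t - 1) i)
      (cell m A u (t - 1) (i + 1)) := by
  have hpos : (0 : ℤ) < period m := by exact_mod_cast period_pos m
  have h1 : (t % period m).toNat = ((t - 1) % period m).toNat + 1 := by
    have h2 : t % period m ≠ 0 := fun h' => h (Int.dvd_of_emod_eq_zero h')
    have h3 := Int.emod_nonneg t hpos.ne'
    have h4 := Int.emod_lt_of_pos t hpos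
    have h5 : (t - 1) % period m = t % period m - 1 := by
      rw [← Int.emod_sub_emod]
      exact Int.emod_eq_of_lt (by omega) (by omega)
    omega
  simp only [cell, h1, row]

theorem cell_of_dvd {t : ℤ} (h : (period m : ℤ) ∣ t) (i : ℤ) :
    cell m A u t i = lookup A m u i := by
  simp [cell, Int.emod_eq_zero_of_dvd h, row]

/-- If no symbol of the space-time diagram is accepting, then the facts that describe it are a
model in which the policy fails. -/
theorem isCounterModel (hacc : ∀ r < period m, ∀ i, ¬ A.acc (row A m u r i)) :
    IsCounterModel m u.length (rules K m u.length) (patterns A u) (counterModel m A u) := by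
  have hcell : ∀ t i, ¬ A.acc (cell m A u t i) := fun t i => by
    have hpos : (0 : ℤ) < period m := by exact_mod_cast period_pos m
    have h3 := Int.emod_nonneg t hpos.ne'
    have h4 := Int.emod_lt_of_pos t hpos
    exact hacc _ (by omega) i
  have hzero : ∀ r, RelOk u.length r → r ≠ 0 →
      CounterFact m A u r fun _ => True := CounterFact.zero
  have hinit : ∀ v : Pos K → ℕ, fact m 0 v ∈ counterModel m A u →
      ∀ p ∈ positions K m, v p = vecVal initVec p := by
    intro v hv
    obtain ⟨w, hw, e⟩ := (fact_mem_counterModel (by omega)).1 hv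
    rwa [hw.of_init] at e
  refine ⟨⟨fun ρ hρ => ?_, fun P hP => ?_, ?_, ?_⟩, ⟨finite_counterModel, ?_⟩, ?_, ?_, ?_⟩
  · have hval := valid_rules (m := m) ρ hρ
    refine closed_counterModel hval.src_ok.1 hval.tgt_ok.1 hval.pull_mem fun w hw => ?_
    have htriv : w = (fun _ => True) → ∃ w', CounterFact m A u ρ.tgt w' ∧
        ∀ p ∈ positions K m, ∀ q, ρ.pull p = some q → (w' p ↔ w q) := fun h =>
      ⟨_, hzero _ hval.tgt_ok hval.tgt_ne, fun p _ q _ => by simp [h]⟩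
    have hmove : ∀ (d : Fin 3) w, CounterFact m A u 1 w → ∃ w', CounterFact m A u 1 w' ∧
        ∀ p ∈ positions K m, ∀ q, pullMove d p = some q → (w' p ↔ w q) := by
      intro d w hw
      rcases hw.of_cell with rfl | ⟨t, i, rfl⟩
      · exact ⟨_, hzero 1 ⟨by omega, by omega⟩ (by omega), by simp⟩
      · refine ⟨_, .cell (t - 1) (i + (d : ℕ) - 1), ?_⟩
        rintro (_ | _ | _ | s | ⟨e, s⟩ | ⟨b, j⟩ | ⟨b, j⟩) - q hq <;>
          simp only [pullMove, Option.some.injEq, reduceCtorEq] at hq <;> subst hq <;>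
          simp only [cellVec]
        · fin_cases d <;> simp
        · exact marked_pred
        · exact marked_shift _
    simp only [rules, List.mem_append, List.mem_cons, List.not_mem_nil, or_false, List.mem_map,
      List.mem_flatMap, List.mem_range, mem_nonzeroMarks] at hρ
    rcases hρ with (rfl | rfl | rfl | rfl | rfl) |
      (⟨p, ⟨b, j, hb, hj, rfl⟩, rfl⟩ | ⟨k, hk, rfl | ⟨p, ⟨b, j, hb, hj, rfl⟩, rfl⟩⟩)
    · obtain rfl := hw.of_init
      refine ⟨_, .cell 0 0, ?_⟩
      have hmk : ∀ b j : ℕ, j ≤ b → (Marked b j 0 ↔ j = 0) := fun b j hj => by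
        constructor
        · intro h
          have h2 : ((b + 1 : ℕ) : ℤ) ∣ (j : ℤ) := by simpa [Marked] using h
          exact Nat.eq_zero_of_dvd_of_lt (Int.natCast_dvd_natCast.1 h2) (by omega)
        · rintro rfl
          simp [Marked]
      rintro (_ | _ | _ | s | ⟨e, s⟩ | ⟨b, j⟩ | ⟨b, j⟩) hp q hq <;>
        simp only [pullInit, Option.some.injEq, reduceCtorEq] at hq <;> subst hq <;>
        simp only [cellVec, initVec]
      · exact hmk b j (t_mem.1 hp).2
      · exact hmk b j (i_mem.1 hp).2
    · exact hmove 0 w hw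
    · exact hmove 1 w hw
    · exact hmove 2 w hw
    · rcases hw.of_cell with h | ⟨t, i, rfl⟩
      · exact htriv h
      · refine ⟨_, .look 0 (Nat.zero_le _) i, ?_⟩
        rintro (_ | _ | _ | s | ⟨e, s⟩ | ⟨b, j⟩ | ⟨b, j⟩) - q hq <;>
          simp only [pullLook, Option.some.injEq, reduceCtorEq] at hq <;> subst hq <;>
          simp [cellVec, lookVec]
    · rcases hw.of_cell with h | ⟨t, i, rfl⟩
      · exact htriv h
      · refine ⟨_, .test (¬ (period m : ℤ) ∣ t) (Marked b (j + 1) t)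
          (fun h => not_period_dvd.2 ⟨b, j, hb, hj, h⟩), ?_⟩
        rintro (_ | _ | _ | s | ⟨e, s⟩ | ⟨b, j⟩ | ⟨b, j⟩) - q hq <;>
          simp only [pullTest, Option.some.injEq, reduceCtorEq] at hq <;> subst hq <;>
          simp [cellVec, testVec]
    · rcases hw.of_look with h | ⟨i, rfl⟩
      · exact htriv h
      · have h1 := CounterFact.look (m := m) (A := A) (k + 1) hk (i - 1)
        rw [show 4 + (k + 1) = 5 + k by ring] at h1
        refine ⟨_, h1, ?_⟩
        rintro (_ | _ | _ | s | ⟨e, s⟩ | ⟨b, j⟩ | ⟨b, j⟩) - q hq <;>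
          simp only [pullNext, Option.some.injEq, reduceCtorEq] at hq <;> subst hq <;>
          simp only [lookVec, List.tail_drop]
        exact marked_pred
    · rcases hw.of_look with h | ⟨i, rfl⟩
      · exact htriv h
      · refine ⟨_, .test (¬ (period m : ℤ) ∣ i) (Marked b (j + 1) i)
          (fun h => not_period_dvd.2 ⟨b, j, hb, hj, h⟩), ?_⟩
        rintro (_ | _ | _ | s | ⟨e, s⟩ | ⟨b, j⟩ | ⟨b, j⟩) - q hq <;>
          simp only [pullTest, Option.some.injEq, reduceCtorEq] at hq <;> subst hq <;>
          simp [lookVec, testVec]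
  · have hval := valid_patterns (m := m) P hP
    refine ok_counterModel hval.rel_ok.1 hval.out_mem fun w hw hc he => ?_
    rw [mem_patterns] at hP
    rcases hP with ⟨s₁, s₂, s₃, rfl⟩ | ⟨s, rfl⟩ | ⟨s, hs, rfl⟩ | rfl | ⟨k, s, hk, rfl⟩ |
      ⟨k, hk, s, rfl⟩ | rfl
    · rcases hw.of_cell with rfl | ⟨t, i, rfl⟩
      · trivial
      · have h0 := he .z z_mem rfl
        have h1 := he (.f 0 s₁) (f_mem _ _) (by simp [stepPat])
        have h2 := he (.f 1 s₂) (f_mem _ _) (by simp [stepPat])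
        have h3 := he (.f 2 s₃) (f_mem _ _) (by simp [stepPat])
        simp only [cellVec] at h0 h1 h2 h3
        simp only [stepPat, cellVec, cell_of_not_dvd h0, h1, h2, h3]
        simp [show i + 2 - 1 = i + 1 by ring]
    · rcases hw.of_cell with rfl | ⟨t, i, rfl⟩
      · trivial
      · have h0 : (period m : ℤ) ∣ t := period_dvd.2 fun b hb =>
          he (.t b 0) (t_mem.2 ⟨hb, Nat.zero_le _⟩) (by simp [basePat])
        have h1 := he (.f 3 s) (f_mem _ _) (by simp [basePat])
        simp only [cellVec, if_true] at h1
        simpa only [basePat, cellVec, cell_of_dvd h0] using h1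
    · rcases hw.of_cell with rfl | ⟨t, i, rfl⟩
      · trivial
      · have h1 := he (.a s) (a_mem _) (by simp [acceptPat])
        simp only [cellVec] at h1
        exact absurd (h1 ▸ hs) (hcell t i)
    · rcases hw.of_test with rfl | ⟨x, y, h, rfl⟩
      · trivial
      · exact h (he .g g_mem rfl)
    · rcases hw.of_look with rfl | ⟨i, rfl⟩
      · trivial
      · have h0 : (period m : ℤ) ∣ i := period_dvd.2 fun b hb =>
          he (.i b 0) (i_mem.2 ⟨hb, Nat.zero_le _⟩) (by simp [letterPat])
        obtain ⟨hk', rfl⟩ := List.getElem?_eq_some_iff.1 hk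
        simp only [letterPat, lookVec]
        rw [List.drop_eq_getElem_cons hk', lookup, if_pos h0]
    · rcases hw.of_look with rfl | ⟨i, rfl⟩
      · trivial
      · have h0 := he .z z_mem rfl
        have h1 := he (.f 0 s) (f_mem _ _) (by simp [nextPat])
        simp only [lookVec, List.tail_drop] at h0 h1
        simp only [nextPat, lookVec]
        rw [List.drop_eq_getElem_cons hk, lookup, if_neg h0, h1]
    · rcases hw.of_look with rfl | ⟨i, rfl⟩
      · trivial
      · simp [blankPat, lookVec, lookup]
  · exact ⟨_, (fact_mem_counterModel (by omega)).2 ⟨_, .init, fun _ _ => rfl⟩⟩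
  · intro v hv p hp
    rw [hinit v hv p (exposed_subset p hp), vecVal_eq_zero]
    simp only [exposed, List.mem_cons, List.mem_append, List.mem_map, List.mem_range] at hp
    rcases hp with rfl | ⟨b, hb, rfl⟩ | ⟨b, hb, rfl⟩ <;> simp [initVec]
  · rintro f (rfl | ⟨r, w, hw, rfl⟩)
    · simp [Fact.WF, sourceSchema]
    · exact fact_wf hw.relOk _
  · intro r hr h0
    refine (fact_mem_counterModel hr.1).2 ⟨_, hzero r hr h0, fun p _ => ?_⟩
    simp [vecVal]
  · intro x
    constructor
    · rintro (h | ⟨r, w, hw, h⟩)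
      · simpa using h
      · simp only [fact, Fact.mk.injEq] at h
        exact absurd h.1.symm hw.relOk.1
    · rintro rfl
      exact .inl rfl
  · intro v hv e
    rw [hinit v hv _ g_mem, hinit v hv _ c_mem, vecVal_eq_vecVal] at e
    simp [initVec] at e

end countermodel

/-! ### Disclosure means that the automaton accepts -/

section

variable {K m : ℕ} {A : Automaton K} {u : List (Fin K)}

theorem incDepInput_admitsDisclosure_iff :
    (incDepInput m u.length (rules K m u.length) (patterns A u)).AdmitsDisclosure ↔
      ∃ r < period m, ∃ i, A.acc (row A m u r i) := by
  constructor
  · intro H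
    by_contra! hacc
    have hc := isCounterModel (A := A) (u := u) (m := m) fun r hr i => by simpa using hacc r hr i
    exact not_admitsDisclosure_of_critical rfl
      (hc.possible_incDepInput valid_rules valid_patterns) hc.not_policy H
  · rintro ⟨r, hr, i, hacc⟩
    exact admitsDisclosure_of_critical (incDepInput_wf valid_rules valid_patterns) fun D hD =>
      (isModel_of_possible_incDepInput valid_rules valid_patterns hD).policy_holds hr hacc

theorem linearInput_admitsDisclosure_iff :
    (linearInput m u.length (rules K m u.length) (patterns A u)).AdmitsDisclosure ↔
      ∃ r < period m, ∃ i, A.acc (row A m u r i) := by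
  constructor
  · intro H
    by_contra! hacc
    have hc := isCounterModel (A := A) (u := u) (m := m) fun r hr i => by simpa using hacc r hr i
    exact not_admitsDisclosure_of_critical rfl
      (hc.possible_linearInput valid_rules valid_patterns) hc.not_policy H
  · rintro ⟨r, hr, i, hacc⟩
    exact admitsDisclosure_of_critical (linearInput_wf valid_rules valid_patterns) fun D hD =>
      (isModel_of_possible_linearInput valid_rules valid_patterns hD).policy_holds hr hacc

end

/-! ### The period of a counter is exponential -/

theorem dvd_period {m n : ℕ} (h0 : n ≠ 0) (h : n ≤ m) : n ∣ period m := by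
  obtain ⟨b, rfl⟩ := Nat.exists_eq_succ_of_ne_zero h0
  exact Finset.dvd_lcm (f := fun b => b + 1) (Finset.mem_range.2 h)

/-- The central binomial coefficient has no prime power factor above `2 * k`. -/
theorem centralBinom_dvd_period (k : ℕ) : k.centralBinom ∣ period (2 * k) := by
  rw [← Nat.factorization_prime_le_iff_dvd (Nat.centralBinom_ne_zero k) (period_pos _).ne']
  intro p hp
  rcases Nat.eq_zero_or_pos k with rfl | hk
  · simp
  refine Nat.factorization_choose_le_log.trans ?_
  rw [← hp.pow_dvd_iff_le_factorization (period_pos _).ne']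
  exact dvd_period (pow_ne_zero _ hp.ne_zero) (Nat.pow_log_le_self p (by omega))

theorem two_pow_le_period (k : ℕ) : 2 ^ k ≤ period (2 * k) := by
  rcases Nat.eq_zero_or_pos k with rfl | hk
  · exact period_pos _
  have h1 := Nat.four_pow_le_two_mul_self_mul_centralBinom k hk
  have h2 := Nat.le_of_dvd (period_pos _) (centralBinom_dvd_period k)
  have h3 : 2 * k ≤ 2 ^ k := by
    obtain ⟨k, rfl⟩ : ∃ j, k = j + 1 := ⟨k - 1, by omega⟩
    have := Nat.lt_two_pow_self (n := k)
    rw [pow_succ]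
    omega
  have h4 : 2 ^ k * 2 ^ k ≤ 2 ^ k * period (2 * k) := by
    calc 2 ^ k * 2 ^ k = 4 ^ k := by rw [← mul_pow]; norm_num
      _ ≤ 2 * k * k.centralBinom := h1
      _ ≤ 2 ^ k * period (2 * k) := Nat.mul_le_mul h3 h2
  exact Nat.le_of_mul_le_mul_left h4 (by positivity)

/-! ### Simulation of a Turing machine by a cellular automaton -/

section simulation

open Turing

variable {Q Γ : Type}

/-- A configuration of a Turing machine with absolute tape positions. -/
structure AbsCfg (Q Γ : Type) where
  q : Q
  tape : ℤ → Γ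
  head : ℤ

variable (M : Q → Γ → Option (Q × TM0.Stmt Γ))

/-- The next configuration; a halting configuration is repeated. -/
def AbsCfg.next (c : AbsCfg Q Γ) : AbsCfg Q Γ :=
  match M c.q (c.tape c.head) with
  | none => c
  | some (q, .move .right) => ⟨q, c.tape, c.head + 1⟩
  | some (q, .move .left) => ⟨q, c.tape, c.head - 1⟩
  | some (q, .write a) => ⟨q, Function.update c.tape c.head a, c.head⟩

/-- The content of a tape cell, including the state of the machine if the head is there. -/
def AbsCfg.cell (c : AbsCfg Q Γ) (j : ℤ) : Option Q × Γ :=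
  (open Classical in if j = c.head then some c.q else none, c.tape j)

/-- The state in which the head leaves a cell in the given direction, if it does. -/
def leaving (d : Dir) : Option Q × Γ → Option Q
  | (none, _) => none
  | (some q, a) =>
    match M q a with
    | some (q', .move d') => if d' = d then some q' else none
    | _ => none

/-- The next content of a cell, in terms of the contents of the cell and its two neighbours. -/
def cellStep (l : Option Q × Γ) : Option Q × Γ → Option Q × Γ → Option Q × Γ
  | (none, a), r => ((leaving M .right l).orElse fun _ => leaving M .left r, a)
  | (some q, a), _ =>
    match M q a with
    | none => (some q, a)
    | some (q', .write b) => (some q', b)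
    | some (_, .move _) => (none, a)

theorem leaving_of_fst_eq_none {d : Dir} {x : Option Q × Γ} (h : x.1 = none) :
    leaving M d x = none := by
  obtain ⟨_ | q, a⟩ := x
  · rfl
  · simp at h

theorem cellStep_congr {l l' c r r' : Option Q × Γ} (hl : l = l' ∨ l.1 = none ∧ l'.1 = none)
    (hr : r = r' ∨ r.1 = none ∧ r'.1 = none) : cellStep M l c r = cellStep M l' c r' := by
  have h1 : leaving M .right l = leaving M .right l' := by
    rcases hl with rfl | ⟨h, h'⟩
    · rfl
    · rw [leaving_of_fst_eq_none M h, leaving_of_fst_eq_none M h']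
  have h2 : leaving M .left r = leaving M .left r' := by
    rcases hr with rfl | ⟨h, h'⟩
    · rfl
    · rw [leaving_of_fst_eq_none M h, leaving_of_fst_eq_none M h']
  obtain ⟨_ | q, a⟩ := c
  · simp only [cellStep, h1, h2]
  · rfl

theorem AbsCfg.cell_of_ne {c : AbsCfg Q Γ} {j : ℤ} (h : j ≠ c.head) :
    c.cell j = (none, c.tape j) := by
  simp [cell, h]

theorem AbsCfg.cell_head (c : AbsCfg Q Γ) : c.cell c.head = (some c.q, c.tape c.head) := by
  simp [cell]

theorem AbsCfg.cell_next (c : AbsCfg Q Γ) (j : ℤ) :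
    (c.next M).cell j = cellStep M (c.cell (j - 1)) (c.cell j) (c.cell (j + 1)) := by
  by_cases h : j = c.head
  · subst h
    rw [cell_head]
    rcases hM : M c.q (c.tape c.head) with _ | ⟨q, _ | _⟩
    · simp [next, hM, cellStep, cell_head]
    · rename_i d
      cases d <;> simp [next, hM, cellStep, cell] <;> omega
    · simp [next, hM, cellStep, cell]
  · have hl : leaving M .right (c.cell (j - 1)) =
        if j - 1 = c.head then leaving M .right (some c.q, c.tape c.head) else none := by
      split_ifs with h'
      · rw [h', cell_head]
      · rw [cell_of_ne h']
        rfl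
    have hr : leaving M .left (c.cell (j + 1)) =
        if j + 1 = c.head then leaving M .left (some c.q, c.tape c.head) else none := by
      split_ifs with h'
      · rw [h', cell_head]
      · rw [cell_of_ne h']
        rfl
    rw [cell_of_ne h]
    simp only [cellStep, hl, hr]
    rcases hM : M c.q (c.tape c.head) with _ | ⟨q, d | a⟩
    · simp [next, hM, cell, leaving, h]
    · cases d
      · have h1 : (j = c.head - 1) ↔ (j + 1 = c.head) := by omega
        by_cases h2 : j + 1 = c.head <;> simp [next, hM, cell, leaving, h1, h2]
      · have h1 : (j = c.head + 1) ↔ (j - 1 = c.head) := by omega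
        by_cases h2 : j - 1 = c.head <;> simp [next, hM, cell, leaving, h1, h2]
    · simp [next, hM, cell, leaving, h]

theorem AbsCfg.head_iterate_le (c : AbsCfg Q Γ) (r : ℕ) :
    |((AbsCfg.next M)^[r] c).head - c.head| ≤ r := by
  induction r with
  | zero => simp
  | succ r ih =>
    rw [Function.iterate_succ_apply']
    generalize (AbsCfg.next M)^[r] c = d at ih
    rw [abs_le] at ih ⊢
    push_cast
    rcases hM : M d.q (d.tape d.head) with _ | ⟨q, _ | _⟩
    · simp only [next, hM]
      omega
    · rename_i e
      cases e <;> simp only [next, hM] <;> omega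
    · simp only [next, hM]
      omega

variable {K : ℕ} [Inhabited Γ] (e : Option Q × Γ ≃ Fin K)

/-- The cellular automaton of a machine; it accepts when the machine halts in an accepting state. -/
noncomputable def machineAutomaton (accept : Set Q) : Automaton K where
  step s₁ s₂ s₃ := e (cellStep M (e.symm s₁) (e.symm s₂) (e.symm s₃))
  acc s := open Classical in
    decide (∃ q ∈ accept, (e.symm s).1 = some q ∧ M q (e.symm s).2 = none)
  blank := e (none, default)

variable {accept : Set Q} {m : ℕ} {u : List (Fin K)}

theorem lookup_add_mul (A : Automaton K) (k : ℤ) : ∀ (u : List (Fin K)) (j : ℤ), 0 ≤ j →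
    j < period m → lookup A m u (j + k * period m) = u.getD j.toNat A.blank := by
  intro u
  induction u with
  | nil => simp [lookup]
  | cons s u ih =>
    intro j h0 hj
    by_cases hd : (period m : ℤ) ∣ j + k * period m
    · have : (period m : ℤ) ∣ j := (dvd_add_left (dvd_mul_left _ _)).1 hd
      obtain rfl := Int.eq_zero_of_dvd_of_nonneg_of_lt h0 hj this
      simp [lookup]
    · have hj0 : j ≠ 0 := by
        rintro rfl
        simp at hd
      obtain ⟨i, rfl⟩ : ∃ i : ℕ, j = i + 1 := ⟨j.toNat - 1, by omega⟩
      simp only [lookup, hd, if_false]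
      rw [show (i : ℤ) + 1 + k * period m - 1 = i + k * period m by ring,
        ih i (by omega) (by omega)]
      simp [show ((i : ℤ) + 1).toNat = i + 1 by omega]

/-- As long as the head stays within distance `B` of the origin, the space-time diagram consists of
copies of the configurations of the machine, at a distance of the period. -/
theorem row_eq_cell {c : AbsCfg Q Γ} {B : ℕ} (hB : ∀ r, |((AbsCfg.next M)^[r] c).head| ≤ B)
    (hL : 2 * B + 2 < period m)
    (h0 : ∀ j : ℤ, -(B + 1) ≤ j → j < period m - (B + 1) → ∀ k : ℤ,
      lookup (machineAutomaton M e accept) m u (j + k * period m) = e (c.cell j)) :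
    ∀ (r : ℕ) (j : ℤ), -(B + 1) ≤ j → j < period m - (B + 1) → ∀ k : ℤ,
      row (machineAutomaton M e accept) m u r (j + k * period m) =
        e (((AbsCfg.next M)^[r] c).cell j) := by
  intro r
  induction r with
  | zero => exact h0
  | succ r ih =>
    intro j h1 h2 k
    rw [Function.iterate_succ_apply', AbsCfg.cell_next]
    have hb := hB r
    rw [abs_le] at hb
    simp only [row, ih j h1 h2 k]
    generalize (AbsCfg.next M)^[r] c = d at *
    -- the neighbours may belong to another copy, where the head is not nearby either
    obtain ⟨l, hl, hl'⟩ : ∃ l,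
        row (machineAutomaton M e accept) m u r (j + k * period m - 1) = e l ∧
        (l = d.cell (j - 1) ∨ l.1 = none ∧ (d.cell (j - 1)).1 = none) := by
      by_cases hj : -(B + 1) ≤ j - 1
      · exact ⟨_, by rw [← ih (j - 1) hj (by omega) k]; congr 1; ring, .inl rfl⟩
      · refine ⟨_, by rw [← ih (j - 1 + period m) (by omega) (by omega) (k - 1)]; congr 1; ring,
          .inr ⟨?_, ?_⟩⟩
        · rw [AbsCfg.cell_of_ne (by omega)]
        · rw [AbsCfg.cell_of_ne (by omega)]
    obtain ⟨l', hr, hr'⟩ : ∃ l,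
        row (machineAutomaton M e accept) m u r (j + k * period m + 1) = e l ∧
        (l = d.cell (j + 1) ∨ l.1 = none ∧ (d.cell (j + 1)).1 = none) := by
      by_cases hj : j + 1 < period m - (B + 1)
      · exact ⟨_, by rw [← ih (j + 1) (by omega) hj k]; congr 1; ring, .inl rfl⟩
      · refine ⟨_, by rw [← ih (j + 1 - period m) (by omega) (by omega) (k + 1)]; congr 1; ring,
          .inr ⟨?_, ?_⟩⟩
        · rw [AbsCfg.cell_of_ne (by omega)]
        · rw [AbsCfg.cell_of_ne (by omega)]
    rw [hl, hr]
    simp only [machineAutomaton, Equiv.symm_apply_apply]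
    rw [cellStep_congr M hl' hr']

/-- The automaton accepts if and only if the machine halts in an accepting state. -/
theorem exists_acc_row_iff {c : AbsCfg Q Γ} {B : ℕ}
    (hB : ∀ r, |((AbsCfg.next M)^[r] c).head| ≤ B) (hL : 2 * B + 2 < period m)
    (h0 : ∀ j : ℤ, -(B + 1) ≤ j → j < period m - (B + 1) → ∀ k : ℤ,
      lookup (machineAutomaton M e accept) m u (j + k * period m) = e (c.cell j)) :
    (∃ r < period m, ∃ i,
        (machineAutomaton M e accept).acc (row (machineAutomaton M e accept) m u r i)) ↔
      ∃ r < period m, ((AbsCfg.next M)^[r] c).q ∈ accept ∧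
        M ((AbsCfg.next M)^[r] c).q (((AbsCfg.next M)^[r] c).tape ((AbsCfg.next M)^[r] c).head) =
          none := by
  have key := row_eq_cell (accept := accept) M e hB hL h0
  refine exists_congr fun r => and_congr_right fun _ => ?_
  constructor
  · rintro ⟨i, hi⟩
    obtain ⟨j, k, h1, h2, rfl⟩ : ∃ j k : ℤ, -(B + 1) ≤ j ∧ j < period m - (B + 1) ∧
        i = j + k * period m := by
      have hpos : (0 : ℤ) < period m := by omega
      refine ⟨(i + (B + 1)) % period m - (B + 1), (i + (B + 1)) / period m, ?_, ?_, ?_⟩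
      · have := Int.emod_nonneg (i + (B + 1)) hpos.ne'
        omega
      · have := Int.emod_lt_of_pos (i + (B + 1)) hpos
        omega
      · have := Int.emod_add_mul_ediv (i + (B + 1)) (period m)
        linarith
    rw [key r j h1 h2 k] at hi
    simp only [machineAutomaton, Equiv.symm_apply_apply, decide_eq_true_eq] at hi
    obtain ⟨q, hq, e1, e2⟩ := hi
    by_cases hj : j = ((AbsCfg.next M)^[r] c).head
    · subst hj
      rw [AbsCfg.cell_head] at e1 e2
      simp only [Option.some.injEq] at e1
      subst e1
      exact ⟨hq, e2⟩
    · rw [AbsCfg.cell_of_ne hj] at e1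
      simp at e1
  · rintro ⟨hq, hM⟩
    have hb := hB r
    rw [abs_le] at hb
    refine ⟨((AbsCfg.next M)^[r] c).head, ?_⟩
    have h3 := key r ((AbsCfg.next M)^[r] c).head (by omega) (by omega) 0
    rw [zero_mul, add_zero] at h3
    rw [h3, AbsCfg.cell_head]
    simp only [machineAutomaton, Equiv.symm_apply_apply, decide_eq_true_eq]
    exact ⟨_, hq, rfl, hM⟩

end simulation

section decider

open Turing

variable {Γ Λ : Type} [Inhabited Γ] [Inhabited Λ] (M : TM0.Machine Γ Λ)

/-- The machine with an additional state `none`, in which it moves to the right and starts. The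
first letter of the word for the automaton then is the same for all input words, even for the
empty one. -/
def delayed : Option Λ → Γ → Option (Option Λ × TM0.Stmt Γ)
  | none, _ => some (some default, .move .right)
  | some q, a => (M q a).map fun p => (some p.1, p.2)

/-- The start of the delayed machine: the head is at the left of the input word. -/
def delayedInit (w : List Γ) : AbsCfg (Option Λ) Γ :=
  ⟨none, fun j => if 0 < j then w.getD (j - 1).toNat default else default, 0⟩

/-- The configuration `x` represents `c`. -/
def Represents (c : TM0.Cfg Γ Λ) (x : AbsCfg (Option Λ) Γ) : Prop :=
  x.q = some c.q ∧ ∀ j, x.tape j = c.Tape.nth (j - x.head)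

/-- One step of a machine that stays in halting configurations. -/
def stepOrStay (c : TM0.Cfg Γ Λ) : TM0.Cfg Γ Λ := (TM0.step M c).getD c

variable {M}

theorem Represents.next {c : TM0.Cfg Γ Λ} {x : AbsCfg (Option Λ) Γ} (h : Represents c x) :
    Represents (stepOrStay M c) (x.next (delayed M)) := by
  obtain ⟨q, T⟩ := c
  obtain ⟨q', tape, head⟩ := x
  obtain ⟨h1, h2⟩ := h
  simp only at h1 h2
  subst h1
  have h3 : tape head = T.head := by simp [h2]
  simp only [AbsCfg.next, delayed, h3]
  rcases hM : M q T.head with _ | ⟨q', d | a⟩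
  · simp only [Option.map_none, stepOrStay, TM0.step, hM, Option.getD_none]
    exact ⟨rfl, h2⟩
  · cases d <;> simp only [Option.map_some, stepOrStay, TM0.step, hM, Option.getD_some] <;>
      refine ⟨rfl, fun j => ?_⟩ <;> simp only [h2, Tape.move_left_nth, Tape.move_right_nth] <;>
      congr 1 <;> ring
  · simp only [Option.map_some, stepOrStay, TM0.step, hM, Option.getD_some]
    refine ⟨rfl, fun j => ?_⟩
    simp only [Tape.write_nth, Function.update_apply, h2, sub_eq_zero]

theorem nth_mk₁ (w : List Γ) (j : ℤ) :
    (Tape.mk₁ w).nth j = if 0 ≤ j then w.getD j.toNat default else default := by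
  split_ifs with h
  · obtain ⟨k, rfl⟩ := Int.eq_ofNat_of_zero_le h
    rw [Tape.mk₁, Tape.mk₂, Tape.mk'_nth_nat, ListBlank.nth_mk, ← List.getD_default_eq_getI]
    rfl
  · obtain ⟨k, rfl⟩ : ∃ k : ℕ, j = -(k + 1 : ℕ) := ⟨(-j).toNat - 1, by omega⟩
    change (ListBlank.mk []).nth k = default
    simp [ListBlank.nth_mk]

theorem represents_init (w : List Γ) :
    Represents (TM0.init w : TM0.Cfg Γ Λ) ((delayedInit w).next (delayed M)) := by
  refine ⟨rfl, fun j => ?_⟩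
  simp only [AbsCfg.next, delayed, delayedInit, TM0.init, nth_mk₁, zero_add]
  exact if_congr (by omega) rfl rfl

theorem represents_iterate (w : List Γ) (r : ℕ) :
    Represents ((stepOrStay M)^[r] (TM0.init w))
      ((AbsCfg.next (delayed M))^[r + 1] (delayedInit w)) := by
  induction r with
  | zero => exact represents_init (M := M) w
  | succ r ih =>
    rw [Function.iterate_succ_apply', Function.iterate_succ_apply' _ (r + 1)]
    exact ih.next

theorem iterate_getD_of_iterate_bind {α : Type} (f : α → Option α) :
    ∀ (n : ℕ) (a c : α), (flip bind f)^[n] (some a) = some c →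
      (fun x => (f x).getD x)^[n] a = c := by
  intro n
  induction n with
  | zero => intro a c h; simpa using h
  | succ n ih =>
    intro a c h
    rw [Function.iterate_succ_apply] at h ⊢
    change (flip bind f)^[n] (f a) = some c at h
    rcases hf : f a with _ | b
    · rw [hf] at h
      have : ∀ n, (flip bind f)^[n] none = none := fun n => Function.iterate_fixed rfl n
      rw [this] at h
      simp at h
    · rw [hf] at h
      simpa using ih b c h

theorem iterate_getD_of_eq_none {α : Type} (f : α → Option α) {c : α} (h : f c = none) (n : ℕ) :
    (fun x => (f x).getD x)^[n] c = c :=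
  Function.iterate_fixed (by simp [h]) n

theorem step_eq_none_iff {c : TM0.Cfg Γ Λ} : TM0.step M c = none ↔ M c.q c.Tape.head = none := by
  obtain ⟨q, T⟩ := c
  simp [TM0.step]

/-- The word for the initial row of the automaton of the delayed machine. -/
def delayedWord {K : ℕ} (e : Option (Option Λ) × Γ ≃ Fin K) (w : List Γ) : List (Fin K) :=
  e (some none, default) :: w.map fun a => e (none, a)

theorem lookup_delayedWord {K m B : ℕ} (e : Option (Option Λ) × Γ ≃ Fin K)
    (accept : Set (Option Λ)) (w : List Γ) (hL : w.length + B + 2 ≤ period m) (j : ℤ)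
    (h1 : -(B + 1) ≤ j) (h2 : j < period m - (B + 1)) (k : ℤ) :
    lookup (machineAutomaton (delayed M) e accept) m (delayedWord e w) (j + k * period m) =
      e ((delayedInit w).cell j) := by
  by_cases h0 : 0 ≤ j
  · rw [lookup_add_mul _ _ _ _ h0 (by omega)]
    obtain ⟨i, rfl⟩ := Int.eq_ofNat_of_zero_le h0
    rcases i with _ | i
    · simp [delayedWord, AbsCfg.cell, delayedInit]
    · rw [AbsCfg.cell_of_ne (by simp [delayedInit]; omega)]
      simp only [delayedWord, Int.toNat_natCast, List.getD_cons_succ, machineAutomaton, delayedInit]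
      rw [if_pos (by omega), show (((i + 1 : ℕ) : ℤ) - 1).toNat = i by omega]
      by_cases hi : i < w.length <;> simp [List.getD, hi]
  · rw [show j + k * period m = (j + period m) + (k - 1) * period m by ring,
      lookup_add_mul _ _ _ _ (by omega) (by omega),
      AbsCfg.cell_of_ne (by simp [delayedInit]; omega)]
    simp only [delayedInit, show ¬ 0 < j by omega, if_false]
    rw [List.getD, List.getElem?_eq_none (by simp [delayedWord]; omega)]
    rfl

/-- A machine that halts within `2 ^ N` steps accepts if and only if the automaton does. -/
theorem accepts_iff_exists_acc {K : ℕ} (e : Option (Option Λ) × Γ ≃ Fin K) {accept : Set Λ}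
    {w : List Γ} {N : ℕ} {c : TM0.Cfg Γ Λ}
    (hrun : Nonempty (StateTransition.EvalsToInTime (TM0.step M) (TM0.init w) (some c) (2 ^ N)))
    (hc : TM0.step M c = none) {m : ℕ} (hm : m = 2 * (N + w.length + 4)) :
    c.q ∈ accept ↔ ∃ r < period m, ∃ i,
      (machineAutomaton (delayed M) e (some '' accept)).acc
        (row (machineAutomaton (delayed M) e (some '' accept)) m (delayedWord e w) r i) := by
  obtain ⟨⟨⟨s, hs⟩, hle⟩⟩ := hrun
  simp only at hle
  have hs' : (stepOrStay M)^[s] (TM0.init w) = c := iterate_getD_of_iterate_bind _ _ _ _ hs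
  have hstay : ∀ r, s ≤ r → (stepOrStay M)^[r] (TM0.init w) = c := fun r hr => by
    obtain ⟨k, rfl⟩ := Nat.exists_eq_add_of_le' hr
    rw [Function.iterate_add_apply, hs']
    exact iterate_getD_of_eq_none _ hc k
  have hper : 2 ^ N * 2 ^ w.length * 16 ≤ period m := by
    have := two_pow_le_period (N + w.length + 4)
    rw [← hm, pow_add, pow_add] at this
    exact this
  have hw := Nat.lt_two_pow_self (n := w.length)
  have hN : 1 ≤ 2 ^ N := Nat.one_le_two_pow
  have hNw : 2 ^ N + 2 ^ w.length ≤ 2 ^ N * 2 ^ w.length + 1 := by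
    have : 1 ≤ 2 ^ w.length := Nat.one_le_two_pow
    nlinarith
  have hmul : 2 ^ N ≤ 2 ^ N * 2 ^ w.length := Nat.le_mul_of_pos_right _ (by positivity)
  -- after `s + 1` steps the head does not move any more
  have hB : ∀ r,
      |((AbsCfg.next (delayed M))^[r] (delayedInit w)).head| ≤ ((2 ^ N + 1 : ℕ) : ℤ) := by
    intro r
    have hsmall : ∀ r ≤ s + 1, |((AbsCfg.next (delayed M))^[r] (delayedInit w)).head| ≤
        ((2 ^ N + 1 : ℕ) : ℤ) := fun r hr => by
      have := AbsCfg.head_iterate_le (delayed M) (delayedInit w) r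
      simp only [delayedInit, sub_zero] at this ⊢
      omega
    by_cases hr : r ≤ s + 1
    · exact hsmall r hr
    · obtain ⟨k, rfl⟩ : ∃ k, r = k + (s + 1) := ⟨r - (s + 1), by omega⟩
      have hrep := represents_iterate (M := M) w s
      rw [hs'] at hrep
      have hfix : AbsCfg.next (delayed M) ((AbsCfg.next (delayed M))^[s + 1] (delayedInit w)) =
          (AbsCfg.next (delayed M))^[s + 1] (delayedInit w) := by
        generalize (AbsCfg.next (delayed M))^[s + 1] (delayedInit w) = x at hrep
        have h1 : x.tape x.head = c.Tape.head := by simp [hrep.2]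
        have h2 : delayed M x.q (x.tape x.head) = none := by
          rw [hrep.1, h1, delayed, step_eq_none_iff.1 hc]
          rfl
        simp only [AbsCfg.next, h2]
      rw [Function.iterate_add_apply, Function.iterate_fixed hfix]
      exact hsmall _ le_rfl
  rw [exists_acc_row_iff (delayed M) e hB (by omega)
    fun j h1 h2 k => lookup_delayedWord e _ w (by omega) j h1 h2 k]
  constructor
  · intro hacc
    refine ⟨s + 1, by omega, ?_⟩
    have hrep := represents_iterate (M := M) w s
    rw [hs'] at hrep
    generalize (AbsCfg.next (delayed M))^[s + 1] (delayedInit w) = x at hrep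
    refine ⟨hrep.1 ▸ Set.mem_image_of_mem _ hacc, ?_⟩
    rw [hrep.1, hrep.2, sub_self, Tape.nth_zero, delayed, step_eq_none_iff.1 hc]
    rfl
  · rintro ⟨r, -, hacc, hnone⟩
    rcases r with _ | r
    · simp [delayedInit, delayed] at hnone
    · have hrep := represents_iterate (M := M) w r
      generalize (AbsCfg.next (delayed M))^[r + 1] (delayedInit w) = x at hrep hacc hnone
      rw [hrep.1, hrep.2, sub_self, Tape.nth_zero, delayed, Option.map_eq_none_iff,
        ← step_eq_none_iff] at hnone
      have hfin : (stepOrStay M)^[r] (TM0.init w) = c := by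
        rw [← hstay (s + r) (by omega), Function.iterate_add_apply]
        exact (iterate_getD_of_eq_none _ hnone s).symm
      rw [hrep.1, hfin] at hacc
      simpa using hacc

end decider

/-! ### Stack programs and their compilation to stack machines -/

/-- Structured programs on stacks over `A`, indexed by `I`, and stacks of bits, indexed by `J`.
A loop empties a stack: as long as the stack is not empty, an element is popped and the body for
that element is executed. -/
inductive Prog (A I J : Type) : Type
  | nop : Prog A I J
  | pushA (i : I) (a : A) : Prog A I J
  | pushB (j : J) (b : Bool) : Prog A I J
  | seq (p q : Prog A I J) : Prog A I J
  | loopA (i : I) (body : A → Prog A I J) : Prog A I J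
  | loopB (j : J) (body : Bool → Prog A I J) : Prog A I J

/-- The contents of the stacks. -/
abbrev Store (A I J : Type) := (I → List A) × (J → List Bool)

namespace Prog

open Function

variable {A I J : Type}

/-- The labels of the machine that runs a program. -/
def Lab : Prog A I J → Type
  | nop => Unit
  | pushA _ _ => Unit
  | pushB _ _ => Unit
  | seq p q => Lab p ⊕ Lab q
  | loopA _ body => Option (Σ a, Lab (body a))
  | loopB _ body => Option (Σ b, Lab (body b))

theorem finite_lab [Finite A] : ∀ p : Prog A I J, Finite (Lab p)
  | nop => inferInstanceAs (Finite Unit)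
  | pushA _ _ => inferInstanceAs (Finite Unit)
  | pushB _ _ => inferInstanceAs (Finite Unit)
  | seq p q => by
    have := finite_lab p
    have := finite_lab q
    exact inferInstanceAs (Finite (Lab p ⊕ Lab q))
  | loopA _ body => by
    have := fun a => finite_lab (body a)
    exact inferInstanceAs (Finite (Option (Σ a, Lab (body a))))
  | loopB _ body => by
    have := fun a => finite_lab (body a)
    exact inferInstanceAs (Finite (Option (Σ a, Lab (body a))))

variable [DecidableEq I] [DecidableEq J]

/-- `Exec p s s' n`: the program transforms the store `s` into `s'` in `n` steps. -/
inductive Exec : Prog A I J → Store A I J → Store A I J → ℕ → Prop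
  | nop (s) : Exec nop s s 1
  | pushA (i a s) : Exec (pushA i a) s (update s.1 i (a :: s.1 i), s.2) 1
  | pushB (j b s) : Exec (pushB j b) s (s.1, update s.2 j (b :: s.2 j)) 1
  | seq {p q s s' s'' n n'} : Exec p s s' n → Exec q s' s'' n' → Exec (seq p q) s s'' (n + n')
  | loopA_nil {i body s} : s.1 i = [] → Exec (loopA i body) s s 1
  | loopA_cons {i body s a l s' s'' n n'} : s.1 i = a :: l →
      Exec (body a) (update s.1 i l, s.2) s' n → Exec (loopA i body) s' s'' n' →
      Exec (loopA i body) s s'' (1 + n + n')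
  | loopB_nil {j body s} : s.2 j = [] → Exec (loopB j body) s s 1
  | loopB_cons {j body s b l s' s'' n n'} : s.2 j = b :: l →
      Exec (body b) (s.1, update s.2 j l) s' n → Exec (loopB j body) s' s'' n' →
      Exec (loopB j body) s s'' (1 + n + n')

/-- The stacks that occur in a program. -/
def used [Fintype A] : Prog A I J → Finset (I ⊕ J)
  | nop => ∅
  | pushA i _ => {.inl i}
  | pushB j _ => {.inr j}
  | seq p q => used p ∪ used q
  | loopA i body => insert (.inl i) (Finset.univ.biUnion fun a => used (body a))
  | loopB j body => insert (.inr j) (Finset.univ.biUnion fun b => used (body b))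

/-- The label at which the execution of a program starts. -/
def entry : (p : Prog A I J) → Lab p
  | nop => ()
  | pushA _ _ => ()
  | pushB _ _ => ()
  | seq p _ => .inl (entry p)
  | loopA _ _ => (none : Option _)
  | loopB _ _ => (none : Option _)

/-- The alphabets of the stacks of the machine, for a set `F` of stacks. -/
abbrev Alphabet (A : Type) (F : Finset (I ⊕ J)) (x : F) : Type :=
  Sum.casesOn (motive := fun _ => Type) x.1 (fun _ => A) (fun _ => Bool)

/-- The statements of the machine: the last popped element is kept in the internal state. -/
abbrev Code (A : Type) (F : Finset (I ⊕ J)) (Λ : Type) : Type :=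
  Turing.TM2.Stmt (Alphabet A F) Λ (Option (A ⊕ Bool))

/-- The code of a program, with labels embedded by `ι`, that is left with a jump to `exit`. -/
def code (F : Finset (I ⊕ J)) {Λ : Type} :
    (p : Prog A I J) → (Lab p → Λ) → Λ → Lab p → Code A F Λ
  | nop, _, exit, _ => .load (fun _ => none) (.goto fun _ => exit)
  | pushA i a, _, exit, _ =>
    if h : .inl i ∈ F then
      .push ⟨.inl i, h⟩ (fun _ => a) (.load (fun _ => none) (.goto fun _ => exit))
    else .halt
  | pushB j b, _, exit, _ =>
    if h : .inr j ∈ F then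
      .push ⟨.inr j, h⟩ (fun _ => b) (.load (fun _ => none) (.goto fun _ => exit))
    else .halt
  | seq p q, ι, exit, l =>
    match l with
    | .inl l => code F p (fun l => ι (.inl l)) (ι (.inr (entry q))) l
    | .inr l => code F q (fun l => ι (.inr l)) exit l
  | loopA i body, ι, exit, l =>
    match l with
    | none =>
      if h : .inl i ∈ F then
        .pop ⟨.inl i, h⟩ (fun _ o => Option.map Sum.inl o) (.goto fun v =>
          match v with
          | some (.inl a) => ι (some ⟨a, entry (body a)⟩)
          | _ => exit)
      else .halt
    | some ⟨a, l⟩ => code F (body a) (fun l => ι (some ⟨a, l⟩)) (ι none) l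
  | loopB j body, ι, exit, l =>
    match l with
    | none =>
      if h : .inr j ∈ F then
        .pop ⟨.inr j, h⟩ (fun _ o => Option.map Sum.inr o) (.goto fun v =>
          match v with
          | some (.inr b) => ι (some ⟨b, entry (body b)⟩)
          | _ => exit)
      else .halt
    | some ⟨b, l⟩ => code F (body b) (fun l => ι (some ⟨b, l⟩)) (ι none) l

theorem code_loopA_entry {F : Finset (I ⊕ J)} {Λ : Type} {i : I} {body : A → Prog A I J}
    {ι : Lab (loopA i body) → Λ} {exit : Λ} :
    code F (loopA i body) ι exit (entry _) =
      if h : .inl i ∈ F then .pop ⟨.inl i, h⟩ (fun _ o => Option.map Sum.inl o)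
        (.goto fun v =>
          match v with
          | some (.inl a) => ι (some ⟨a, entry (body a)⟩)
          | _ => exit)
      else .halt := rfl

theorem code_loopB_entry {F : Finset (I ⊕ J)} {Λ : Type} {j : J} {body : Bool → Prog A I J}
    {ι : Lab (loopB j body) → Λ} {exit : Λ} :
    code F (loopB j body) ι exit (entry _) =
      if h : .inr j ∈ F then .pop ⟨.inr j, h⟩ (fun _ o => Option.map Sum.inr o)
        (.goto fun v =>
          match v with
          | some (.inr a) => ι (some ⟨a, entry (body a)⟩)
          | _ => exit)
      else .halt := rfl

/-- The stacks of the machine that hold a given store. -/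
def stk (F : Finset (I ⊕ J)) (s : Store A I J) : (x : F) → List (Alphabet A F x)
  | ⟨.inl i, _⟩ => s.1 i
  | ⟨.inr j, _⟩ => s.2 j

theorem update_stk_inl {F : Finset (I ⊕ J)} {i : I} (h : .inl i ∈ F) (s : Store A I J)
    (l : List A) : update (stk F s) ⟨.inl i, h⟩ l = stk F (update s.1 i l, s.2) := by
  funext x
  obtain ⟨i' | j', hx⟩ := x
  · by_cases hi : i' = i
    · subst hi
      simp [stk]
    · rw [update_of_ne (by simpa using hi)]
      simp [stk, hi]
  · rw [update_of_ne (by simp)]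
    simp [stk]

theorem update_stk_inr {F : Finset (I ⊕ J)} {j : J} (h : .inr j ∈ F) (s : Store A I J)
    (l : List Bool) : update (stk F s) ⟨.inr j, h⟩ l = stk F (s.1, update s.2 j l) := by
  funext x
  obtain ⟨i' | j', hx⟩ := x
  · rw [update_of_ne (by simp)]
    simp [stk]
  · by_cases hi : j' = j
    · subst hi
      simp [stk]
    · rw [update_of_ne (by simpa using hi)]
      simp [stk, hi]

/-- The configurations of the machine. -/
abbrev MCfg (A : Type) (F : Finset (I ⊕ J)) (Λ : Type) : Type :=
  Turing.TM2.Cfg (Alphabet A F) Λ (Option (A ⊕ Bool))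

/-- The machine reaches the configuration `c'` from `c` in `n` steps. -/
def Runs {F : Finset (I ⊕ J)} {Λ : Type} (M : Λ → Code A F Λ) (c c' : MCfg A F Λ) (n : ℕ) : Prop :=
  (flip bind (Turing.TM2.step M))^[n] (some c) = some c'

theorem Runs.trans {F : Finset (I ⊕ J)} {Λ : Type} {M : Λ → Code A F Λ} {c c' c'' : MCfg A F Λ}
    {n n' : ℕ} (h : Runs M c c' n) (h' : Runs M c' c'' n') : Runs M c c'' (n + n') := by
  unfold Runs at *
  rw [add_comm, iterate_add_apply, h, h']

theorem runs_one {F : Finset (I ⊕ J)} {Λ : Type} {M : Λ → Code A F Λ} (l : Λ)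
    (v : Option (A ⊕ Bool)) (S : (x : F) → List (Alphabet A F x)) :
    Runs M ⟨some l, v, S⟩ (Turing.TM2.stepAux (M l) v S) 1 := rfl

/-- The code of a program simulates the program. -/
theorem Exec.runs [Fintype A] {F : Finset (I ⊕ J)} {Λ : Type} {M : Λ → Code A F Λ}
    {p : Prog A I J} {s s' : Store A I J} {n : ℕ} (h : Exec p s s' n) :
    ∀ (ι : Lab p → Λ) (exit : Λ), (∀ l, M (ι l) = code F p ι exit l) → p.used ⊆ F →
      ∀ v, Runs M ⟨some (ι (entry p)), v, stk F s⟩ ⟨some exit, none, stk F s'⟩ n := by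
  induction h with
  | nop s =>
    intro ι exit hM hF v
    have := runs_one (M := M) (ι (entry .nop)) v (stk F s)
    rwa [hM] at this
  | pushA i a s =>
    intro ι exit hM hF v
    have hi : .inl i ∈ F := hF (by simp [used])
    have := runs_one (M := M) (ι (entry (.pushA i a))) v (stk F s)
    simp only [hM, code, hi, dif_pos, Turing.TM2.stepAux] at this
    erw [update_stk_inl] at this
    exact this
  | pushB j b s =>
    intro ι exit hM hF v
    have hi : .inr j ∈ F := hF (by simp [used])
    have := runs_one (M := M) (ι (entry (.pushB j b))) v (stk F s)
    simp only [hM, code, hi, dif_pos, Turing.TM2.stepAux] at this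
    erw [update_stk_inr] at this
    exact this
  | seq _ _ ih ih' =>
    intro ι exit hM hF v
    simp only [used, Finset.union_subset_iff] at hF
    exact (ih (fun l => ι (.inl l)) _ (fun l => hM (.inl l)) hF.1 v).trans
      (ih' (fun l => ι (.inr l)) _ (fun l => hM (.inr l)) hF.2 _)
  | @loopA_nil i body s h0 =>
    intro ι exit hM hF v
    have hi : .inl i ∈ F := hF (by simp [used])
    have := runs_one (M := M) (ι (entry (.loopA i body))) v (stk F s)
    simp only [hM, code_loopA_entry, hi, dif_pos, Turing.TM2.stepAux] at this
    erw [update_stk_inl] at this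
    simp only [stk, h0, List.head?_nil, Option.map_none, List.tail_nil] at this
    rwa [← h0, update_eq_self] at this
  | @loopA_cons i body s a l s' s'' n n' h0 _ _ ih ih' =>
    intro ι exit hM hF v
    have hi : .inl i ∈ F := hF (by simp [used])
    have h1 := runs_one (M := M) (ι (entry (.loopA i body))) v (stk F s)
    simp only [hM, code_loopA_entry, hi, dif_pos, Turing.TM2.stepAux] at h1
    erw [update_stk_inl] at h1
    simp only [stk, h0, List.head?_cons, Option.map_some, List.tail_cons] at h1
    have hb : (body a).used ⊆ F := fun x hx => hF (Finset.mem_insert_of_mem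
      (Finset.mem_biUnion.2 ⟨a, Finset.mem_univ _, hx⟩))
    exact (h1.trans (ih (fun l => ι (some ⟨a, l⟩)) _ (fun l => hM (some ⟨a, l⟩)) hb _)).trans
      (ih' ι exit hM hF _)
  | @loopB_nil j body s h0 =>
    intro ι exit hM hF v
    have hi : .inr j ∈ F := hF (by simp [used])
    have := runs_one (M := M) (ι (entry (.loopB j body))) v (stk F s)
    simp only [hM, code_loopB_entry, hi, dif_pos, Turing.TM2.stepAux] at this
    erw [update_stk_inr] at this
    simp only [stk, h0, List.head?_nil, Option.map_none, List.tail_nil] at this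
    rwa [← h0, update_eq_self] at this
  | @loopB_cons j body s a l s' s'' n n' h0 _ _ ih ih' =>
    intro ι exit hM hF v
    have hi : .inr j ∈ F := hF (by simp [used])
    have h1 := runs_one (M := M) (ι (entry (.loopB j body))) v (stk F s)
    simp only [hM, code_loopB_entry, hi, dif_pos, Turing.TM2.stepAux] at h1
    erw [update_stk_inr] at h1
    simp only [stk, h0, List.head?_cons, Option.map_some, List.tail_cons] at h1
    have hb : (body a).used ⊆ F := fun x hx => hF (Finset.mem_insert_of_mem
      (Finset.mem_biUnion.2 ⟨a, Finset.mem_univ _, hx⟩))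
    exact (h1.trans (ih (fun l => ι (some ⟨a, l⟩)) _ (fun l => hM (some ⟨a, l⟩)) hb _)).trans
      (ih' ι exit hM hF _)

/-- The machine that runs a program with input stack `i` and output stack `j`. -/
noncomputable def machine [Fintype A] (p : Prog A I J) (i : I) (j : J) : Turing.FinTM2 :=
  letI F : Finset (I ⊕ J) := insert (.inl i) (insert (.inr j) p.used)
  haveI := finite_lab p
  letI : Fintype (Option (Lab p)) := Fintype.ofFinite _
  { K := F
    k₀ := ⟨.inl i, by simp [F]⟩
    k₁ := ⟨.inr j, by simp [F]⟩
    Γ := Alphabet A F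
    Λ := Option (Lab p)
    main := some (entry p)
    σ := Option (A ⊕ Bool)
    initialState := none
    Γk₀Fin := (inferInstance : Fintype A)
    m := fun l => l.elim .halt (code F p some none) }

/-- The store with a single nonempty stack over `A`. -/
def inputStore (i : I) (w : List A) : Store A I J := (update (fun _ => []) i w, fun _ => [])

/-- The store with a single nonempty stack of bits. -/
def outputStore (j : J) (w : List Bool) : Store A I J := (fun _ => [], update (fun _ => []) j w)

theorem initList_machine [Fintype A] (p : Prog A I J) (i : I) (j : J) (w : List A) :
    Turing.initList (machine p i j) w =
      ⟨some (some (entry p)), none, stk _ (inputStore i w)⟩ := by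
  unfold Turing.initList
  congr 1
  funext x
  split_ifs with h
  · cases h
    simp [inputStore, stk, machine]
    rfl
  · obtain ⟨i' | j', hx⟩ := x
    · have hi : i' ≠ i := by
        rintro rfl
        exact h rfl
      simp [inputStore, stk, hi]
      rfl
    · rfl

theorem haltList_machine [Fintype A] (p : Prog A I J) (i : I) (j : J) (w : List Bool) :
    Turing.haltList (machine p i j) w = ⟨none, none, stk _ (outputStore j w)⟩ := by
  unfold Turing.haltList
  congr 1
  funext x
  split_ifs with h
  · cases h
    simp [outputStore, stk, machine]
    rfl
  · obtain ⟨i' | j', hx⟩ := x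
    · rfl
    · have hi : j' ≠ j := by
        rintro rfl
        exact h rfl
      simp [outputStore, stk, hi]
      rfl

/-- A function computed by a program in polynomial time is computed by a machine in polynomial
time. -/
theorem computable [Fintype A] {β : Type} {enc : β → List Bool} {f : List A → β}
    (p : Prog A I J) (i : I) (j : J) (time : Polynomial ℕ)
    (h : ∀ w, ∃ n ≤ time.eval w.length,
      Exec p (inputStore i w) (outputStore j (enc (f w))) n) :
    Nonempty (Turing.TM2ComputableInPolyTime (id : List A → List A) enc f) := by
  refine ⟨⟨⟨machine p i j, Equiv.refl A, Equiv.refl Bool⟩, time + 1, fun w => ?_⟩⟩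
  refine Classical.choice ?_
  obtain ⟨n, hn, hp⟩ := h w
  have h1 := hp.runs (F := insert (.inl i) (insert (.inr j) p.used))
    (M := (machine p i j).m) some none (fun l => rfl)
    ((Finset.subset_insert _ _).trans (Finset.subset_insert _ _)) none
  have h2 := h1.trans (runs_one none none _)
  refine ⟨⟨⟨n + 1, ?_⟩, by simpa using hn⟩⟩
  have e1 := initList_machine p i j w
  have e2 := haltList_machine p i j (enc (f w))
  simp only [Equiv.refl]
  erw [List.map_id, Option.map_some, List.map_id, e1, e2]
  exact h2

/-- The program transforms the store `s` into `s'` in at most `n` steps. -/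
def ExecLe (p : Prog A I J) (s s' : Store A I J) (n : ℕ) : Prop := ∃ m ≤ n, Exec p s s' m

theorem ExecLe.mono {p : Prog A I J} {s s' : Store A I J} {n n' : ℕ} (h : ExecLe p s s' n)
    (hn : n ≤ n') : ExecLe p s s' n' :=
  let ⟨m, hm, h⟩ := h
  ⟨m, hm.trans hn, h⟩

theorem ExecLe.seq {p q : Prog A I J} {s s' s'' : Store A I J} {n n' : ℕ}
    (h : ExecLe p s s' n) (h' : ExecLe q s' s'' n') : ExecLe (.seq p q) s s'' (n + n') :=
  let ⟨_, hm, h⟩ := h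
  let ⟨_, hm', h'⟩ := h'
  ⟨_, Nat.add_le_add hm hm', .seq h h'⟩

theorem execLe_nop (s : Store A I J) : ExecLe .nop s s 1 := ⟨1, le_rfl, .nop s⟩

theorem execLe_pushA {i : I} {a : A} {s s' : Store A I J}
    (h : (update s.1 i (a :: s.1 i), s.2) = s') : ExecLe (.pushA i a) s s' 1 :=
  h ▸ ⟨1, le_rfl, .pushA i a s⟩

theorem execLe_pushB {j : J} {b : Bool} {s s' : Store A I J}
    (h : (s.1, update s.2 j (b :: s.2 j)) = s') : ExecLe (.pushB j b) s s' 1 :=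
  h ▸ ⟨1, le_rfl, .pushB j b s⟩

theorem ExecLe.loopA {i : I} {body : A → Prog A I J} {c : ℕ} (l : List A) (S : ℕ → Store A I J)
    (h0 : ∀ t ≤ l.length, (S t).1 i = l.drop t)
    (hb : ∀ t a, l[t]? = some a →
      ExecLe (body a) (update (S t).1 i (l.drop (t + 1)), (S t).2) (S (t + 1)) c) :
    ExecLe (.loopA i body) (S 0) (S l.length) (l.length * (c + 1) + 1) := by
  induction l generalizing S with
  | nil => exact ⟨1, by simp, .loopA_nil (by simpa using h0 0)⟩
  | cons a l ih =>
    obtain ⟨n, hn, h1⟩ := hb 0 a rfl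
    obtain ⟨n', hn', h2⟩ := ih (fun t => S (t + 1))
      (fun t ht => h0 (t + 1) (by simpa using ht)) (fun t a' h => hb (t + 1) a' (by simpa using h))
    refine ⟨_, ?_, .loopA_cons (by simpa using h0 0) h1 h2⟩
    simp only [List.length_cons]
    nlinarith

theorem ExecLe.loopB {j : J} {body : Bool → Prog A I J} {c : ℕ} (l : List Bool)
    (S : ℕ → Store A I J) (h0 : ∀ t ≤ l.length, (S t).2 j = l.drop t)
    (hb : ∀ t b, l[t]? = some b →
      ExecLe (body b) ((S t).1, update (S t).2 j (l.drop (t + 1))) (S (t + 1)) c) :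
    ExecLe (.loopB j body) (S 0) (S l.length) (l.length * (c + 1) + 1) := by
  induction l generalizing S with
  | nil => exact ⟨1, by simp, .loopB_nil (by simpa using h0 0)⟩
  | cons a l ih =>
    obtain ⟨n, hn, h1⟩ := hb 0 a rfl
    obtain ⟨n', hn', h2⟩ := ih (fun t => S (t + 1))
      (fun t ht => h0 (t + 1) (by simpa using ht)) (fun t a' h => hb (t + 1) a' (by simpa using h))
    refine ⟨_, ?_, .loopB_cons (by simpa using h0 0) h1 h2⟩
    simp only [List.length_cons]
    nlinarith

end Prog

/-! ### Printers and their running time -/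

/-- A valuation of variables extended by the value of the new variable `none`. -/
def extend {V X : Type} (ρ : V → X) (x : X) (o : Option V) : X := o.elim x ρ

/-- Expressions for bit strings that depend on an input word over `A` and on numerical variables
from `V`: constants, concatenation, the value of a variable in unary, the concatenation of a body
for all numbers below the length of a string, and the concatenation of bodies for all letters of
the word; in these loops, the new variable is the number of the current iteration. -/
inductive Printer (A : Type) : Type → Type 1
  | emit {V : Type} (l : List Bool) : Printer A V
  | seq {V : Type} (p q : Printer A V) : Printer A V
  | count {V : Type} (v : V) : Printer A V
  | rep {V : Type} (p : Printer A V) (body : Printer A (Option V)) : Printer A V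
  | word {V : Type} (body : A → Printer A (Option V)) : Printer A V

namespace Printer

open Function Prog

variable {A : Type}

/-- The string that is denoted by an expression. -/
def denote (w : List A) : {V : Type} → Printer A V → (V → ℕ) → List Bool
  | _, emit l, _ => l
  | _, seq p q, ρ => denote w p ρ ++ denote w q ρ
  | _, count v, ρ => List.replicate (ρ v) true
  | _, rep p body, ρ =>
    (List.range (denote w p ρ).length).flatMap fun i => denote w body (extend ρ i)
  | _, word body, ρ => w.zipIdx.flatMap fun x => denote w (body x.1) (extend ρ x.2)

/-- The stacks of letters used by printers: the input, an auxiliary stack, and for each nesting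
level of loops the part of the input to which the loop has not yet come. -/
inductive WordStack : Type
  | inp
  | aux
  | rem (l : ℕ)
  deriving DecidableEq

/-- The stacks of bits used by printers: the output, the reverse of the output, an auxiliary stack,
and for each nesting level of loops the numbers of completed and of remaining iterations. -/
inductive BitStack : Type
  | out
  | acc
  | aux
  | var (l : ℕ)
  | rem (l : ℕ)
  deriving DecidableEq

/-- The program that pushes the denoted string onto the stack `tgt`, with the bits modified by
`φ`; the values of the variables are found at the levels `vars`, and the levels from `lvl` on are
free. -/
def compile (tgt : BitStack) (φ : Bool → Bool) :
    {V : Type} → Printer A V → (V → ℕ) → ℕ → Prog A WordStack BitStack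
  | _, emit l, _, _ => l.foldr (fun b p => .seq (.pushB tgt (φ b)) p) .nop
  | _, seq p q, vars, lvl => .seq (compile tgt φ p vars lvl) (compile tgt φ q vars lvl)
  | _, count v, vars, _ =>
    .seq (.loopB (.var (vars v)) fun _ => .pushB .aux true)
      (.loopB .aux fun _ => .seq (.pushB (.var (vars v)) true) (.pushB tgt (φ true)))
  | _, rep p body, vars, lvl =>
    .seq (compile (.rem lvl) (fun _ => true) p vars (lvl + 1))
      (.seq (.loopB (.rem lvl) fun _ =>
          .seq (compile tgt φ body (extend vars lvl) (lvl + 1)) (.pushB (.var lvl) true))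
        (.loopB (.var lvl) fun _ => .nop))
  | _, word body, vars, lvl =>
    .seq (.loopA .inp fun a => .pushA .aux a)
      (.seq (.loopA .aux fun a => .seq (.pushA .inp a) (.pushA (.rem lvl) a))
        (.seq (.loopA (.rem lvl) fun a =>
            .seq (compile tgt φ (body a) (extend vars lvl) (lvl + 1)) (.pushB (.var lvl) true))
          (.loopB (.var lvl) fun _ => .nop)))

/-- The store represents the word and the values of the variables, and the auxiliary stacks and
those of the free levels are empty. -/
structure Ready {V : Type} (w : List A) (ρ : V → ℕ) (vars : V → ℕ) (lvl : ℕ)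
    (s : Store A WordStack BitStack) : Prop where
  inp : s.1 .inp = w
  auxA : s.1 .aux = []
  remA : ∀ l, lvl ≤ l → s.1 (.rem l) = []
  aux : s.2 .aux = []
  free : ∀ l, lvl ≤ l → s.2 (.var l) = []
  rem : ∀ l, lvl ≤ l → s.2 (.rem l) = []
  val : ∀ v, s.2 (.var (vars v)) = List.replicate (ρ v) true
  vars_lt : ∀ v, vars v < lvl

/-- The stack can be the target of a printer with the free levels from `lvl` on. -/
def BitStack.IsTarget (lvl : ℕ) : BitStack → Prop
  | .acc => True
  | .rem l => l < lvl
  | _ => False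

/-- The store after pushing a string. -/
def pushed (tgt : BitStack) (φ : Bool → Bool) (l : List Bool) (s : Store A WordStack BitStack) :
    Store A WordStack BitStack := (s.1, update s.2 tgt ((l.map φ).reverse ++ s.2 tgt))

theorem Ready.pushed {V : Type} {w : List A} {ρ vars : V → ℕ} {lvl : ℕ}
    {s : Store A WordStack BitStack} (h : Ready w ρ vars lvl s) {tgt : BitStack}
    (ht : tgt.IsTarget lvl) (φ : Bool → Bool) (l : List Bool) :
    Ready w ρ vars lvl (pushed tgt φ l s) := by
  obtain ⟨h1, h2, h3, h4, h5, h6, h7, h8⟩ := h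
  rcases tgt with _ | _ | _ | _ | k <;> try exact absurd ht id
  · exact ⟨h1, h2, h3, by simpa [Printer.pushed], by simpa [Printer.pushed],
      by simpa [Printer.pushed], by simpa [Printer.pushed], h8⟩
  · refine ⟨h1, h2, h3, by simpa [Printer.pushed], by simpa [Printer.pushed], fun l hl => ?_,
      by simpa [Printer.pushed], h8⟩
    have : l ≠ k := by
      simp only [BitStack.IsTarget] at ht
      omega
    simpa [Printer.pushed, this] using h6 l hl

theorem pushed_pushed (tgt : BitStack) (φ : Bool → Bool) (l l' : List Bool)
    (s : Store A WordStack BitStack) :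
    pushed tgt φ l' (pushed tgt φ l s) = pushed tgt φ (l ++ l') s := by
  simp [pushed]

theorem pushed_nil (tgt : BitStack) (φ : Bool → Bool) (s : Store A WordStack BitStack) :
    pushed tgt φ [] s = s := by
  simp [pushed]

theorem execLe_emit (tgt : BitStack) (φ : Bool → Bool) (l : List Bool)
    (s : Store A WordStack BitStack) :
    ExecLe (l.foldr (fun b p => .seq (.pushB tgt (φ b)) p) .nop) s (pushed tgt φ l s)
      (l.length + 1) := by
  induction l generalizing s with
  | nil => simpa [pushed_nil] using execLe_nop s
  | cons b l ih =>
    have h := ih (pushed tgt φ [b] s)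
    rw [pushed_pushed] at h
    exact ((execLe_pushB (by simp [pushed])).seq h).mono (by simp; omega)

/-- A time bound for an expression that is polynomial in a bound for the length of the word and for
the values of the variables. -/
def PolyTime {V : Type} (p : Printer A V) (k : ℕ) : Prop :=
  ∀ (w : List A) (ρ : V → ℕ) (B : ℕ), 2 ≤ B → w.length ≤ B → (∀ v, ρ v ≤ B) →
    (denote w p ρ).length ≤ B ^ k ∧
    ∀ (tgt : BitStack) (φ : Bool → Bool) (vars : V → ℕ) (lvl : ℕ) (s : Store A WordStack BitStack),
      tgt.IsTarget lvl → Ready w ρ vars lvl s →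
      ExecLe (compile tgt φ p vars lvl) s (pushed tgt φ (denote w p ρ) s) (B ^ k)

theorem PolyTime.mono {V : Type} {p : Printer A V} {k k' : ℕ} (h : PolyTime p k) (hk : k ≤ k') :
    PolyTime p k' := by
  intro w ρ B hB hw hρ
  have h1 : B ^ k ≤ B ^ k' := Nat.pow_le_pow_right (by omega) hk
  obtain ⟨h2, h3⟩ := h w ρ B hB hw hρ
  exact ⟨h2.trans h1, fun tgt φ vars lvl s ht hs => (h3 tgt φ vars lvl s ht hs).mono h1⟩

theorem polyTime_emit {V : Type} (l : List Bool) :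
    PolyTime (emit l : Printer A V) (l.length + 1) := by
  intro w ρ B hB hw hρ
  have : l.length + 1 ≤ B ^ (l.length + 1) := (Nat.lt_pow_self (by omega)).le
  exact ⟨by simp only [denote]; omega,
    fun tgt φ vars lvl s _ _ => (execLe_emit tgt φ l s).mono this⟩

theorem PolyTime.seq {V : Type} {p q : Printer A V} {k : ℕ} (hp : PolyTime p k)
    (hq : PolyTime q k) : PolyTime (p.seq q) (k + 1) := by
  intro w ρ B hB hw hρ
  obtain ⟨h1, h2⟩ := hp w ρ B hB hw hρ
  obtain ⟨h3, h4⟩ := hq w ρ B hB hw hρ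
  have h5 : B ^ k + B ^ k ≤ B ^ (k + 1) := by
    rw [pow_succ]
    nlinarith
  refine ⟨by simp only [denote, List.length_append]; omega, fun tgt φ vars lvl s ht hs => ?_⟩
  refine ExecLe.mono ((h2 tgt φ vars lvl s ht hs).seq ?_) h5
  have := h4 tgt φ vars lvl _ ht (hs.pushed ht φ (denote w p ρ))
  rwa [pushed_pushed] at this

theorem BitStack.IsTarget.ne_aux {tgt : BitStack} {lvl : ℕ} (h : tgt.IsTarget lvl) :
    tgt ≠ .aux := by
  rintro rfl
  exact h

theorem BitStack.IsTarget.ne_var {tgt : BitStack} {lvl : ℕ} (h : tgt.IsTarget lvl) (l : ℕ) :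
    tgt ≠ .var l := by
  rintro rfl
  exact h

theorem BitStack.IsTarget.ne_rem {tgt : BitStack} {lvl : ℕ} (h : tgt.IsTarget lvl) {l : ℕ}
    (hl : lvl ≤ l) : tgt ≠ .rem l := by
  rintro rfl
  exact absurd h (by simpa [IsTarget] using hl)

theorem polyTime_count {V : Type} (v : V) : PolyTime (count v : Printer A V) 5 := by
  intro w ρ B hB hw hρ
  have hv := hρ v
  have h1 : B * 16 ≤ B ^ 5 := by
    have : 2 ^ 4 ≤ B ^ 4 := Nat.pow_le_pow_left hB 4
    rw [pow_succ, mul_comm]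
    exact Nat.mul_le_mul_right _ (by simpa using this)
  refine ⟨by simp only [denote, List.length_replicate]; omega, fun tgt φ vars lvl s ht hs => ?_⟩
  have n1 := ht.ne_aux
  have n2 := ht.ne_var (vars v)
  have hval := hs.val v
  have haux := hs.aux
  have e1 := ExecLe.loopB (j := .var (vars v)) (c := 1)
    (body := fun _ => (.pushB .aux true : Prog A WordStack BitStack)) (List.replicate (ρ v) true)
    (fun t => (s.1, update (update s.2 (.var (vars v)) (List.replicate (ρ v - t) true))
      .aux (List.replicate t true)))
    (fun t _ => by simp) (fun t b ht => execLe_pushB (by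
      simp [update_comm, List.replicate_succ]))
  have e2 := ExecLe.loopB (j := .aux) (c := 2)
    (body := fun _ => (.seq (.pushB (.var (vars v)) true) (.pushB tgt (φ true)) :
      Prog A WordStack BitStack)) (List.replicate (ρ v) true)
    (fun t => (s.1, update (update (update s.2 (.var (vars v)) (List.replicate t true))
      .aux (List.replicate (ρ v - t) true)) tgt (List.replicate t (φ true) ++ s.2 tgt)))
    (fun t _ => by simp [n1.symm]) (fun t b htb => by
      refine ExecLe.seq (n := 1) (n' := 1) (execLe_pushB rfl) (execLe_pushB ?_)
      refine Prod.ext rfl (funext fun r => ?_)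
      simp only [update_apply, List.drop_replicate]
      split_ifs <;> simp_all [List.replicate_succ])
  refine ExecLe.mono (ExecLe.seq (n := ρ v * 2 + 1) (n' := ρ v * 3 + 1)
    (s' := (s.1, update (update s.2 (.var (vars v)) []) .aux (List.replicate (ρ v) true)))
    ?_ ?_) (by omega)
  · convert e1 using 1
    · refine Prod.ext rfl (funext fun r => ?_)
      simp only [update_apply]
      split_ifs <;> simp_all
    · simp
    · simp
  · convert e2 using 1
    · refine Prod.ext rfl (funext fun r => ?_)
      simp only [update_apply]
      split_ifs <;> simp_all
    · refine Prod.ext rfl (funext fun r => ?_)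
      simp only [pushed, update_apply]
      split_ifs <;> simp_all [denote]
    · simp

theorem Ready.mono {V : Type} {w : List A} {ρ vars : V → ℕ} {lvl lvl' : ℕ}
    {s : Store A WordStack BitStack} (h : Ready w ρ vars lvl s) (hl : lvl ≤ lvl') :
    Ready w ρ vars lvl' s :=
  ⟨h.inp, h.auxA, fun l h' => h.remA l (hl.trans h'), h.aux, fun l h' => h.free l (hl.trans h'),
    fun l h' => h.rem l (hl.trans h'), h.val, fun v => (h.vars_lt v).trans_le hl⟩

theorem BitStack.IsTarget.mono {tgt : BitStack} {lvl lvl' : ℕ} (h : tgt.IsTarget lvl)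
    (hl : lvl ≤ lvl') : tgt.IsTarget lvl' := by
  rcases tgt with _ | _ | _ | _ | k <;> try exact h
  exact lt_of_lt_of_le h hl

/-- The store in the `t`-th iteration of a loop at level `lvl`: the new variable has the value `t`,
and `r` iterations remain. -/
def looping (lvl t : ℕ) (r : List Bool) (r' : List A) (s : Store A WordStack BitStack) :
    Store A WordStack BitStack :=
  (update s.1 (.rem lvl) r', update (update s.2 (.rem lvl) r) (.var lvl) (List.replicate t true))

theorem Ready.looping {V : Type} {w : List A} {ρ vars : V → ℕ} {lvl : ℕ}
    {s : Store A WordStack BitStack} (h : Ready w ρ vars lvl s) (t : ℕ) (r : List Bool)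
    (r' : List A) : Ready w (extend ρ t) (extend vars lvl) (lvl + 1) (looping lvl t r r' s) := by
  obtain ⟨h1, h2, h3, h4, h5, h6, h7, h8⟩ := h
  refine ⟨by simpa [Printer.looping], by simpa [Printer.looping], fun l hl => ?_,
    by simpa [Printer.looping], fun l hl => ?_, fun l hl => ?_, ?_, ?_⟩
  · simpa [Printer.looping, show l ≠ lvl by omega] using h3 l (by omega)
  · simpa [Printer.looping, show l ≠ lvl by omega] using h5 l (by omega)
  · simpa [Printer.looping, show l ≠ lvl by omega] using h6 l (by omega)
  · rintro (_ | v)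
    · simp [Printer.looping, extend]
    · simpa [Printer.looping, extend, (h8 v).ne] using h7 v
  · rintro (_ | v)
    · simp [extend]
    · simpa [extend] using (h8 v).trans (Nat.lt_succ_self lvl)

theorem looping_dropB {lvl t : ℕ} {r r₁ : List Bool} {r' : List A}
    {s : Store A WordStack BitStack} :
    ((looping lvl t r r' s).1, update (looping lvl t r r' s).2 (.rem lvl) r₁) =
      looping lvl t r₁ r' s := by
  simp [looping, update_comm (show BitStack.var lvl ≠ .rem lvl by simp)]

theorem looping_dropA {lvl t : ℕ} {r : List Bool} {r' r₁ : List A}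
    {s : Store A WordStack BitStack} :
    (update (looping lvl t r r' s).1 (.rem lvl) r₁, (looping lvl t r r' s).2) =
      looping lvl t r r₁ s := by
  simp [looping]

/-- The start of a loop for the numbers below the length of a string. -/
theorem pushed_rem {V : Type} {w : List A} {ρ vars : V → ℕ} {lvl : ℕ}
    {s : Store A WordStack BitStack} (h : Ready w ρ vars lvl s) (l : List Bool) :
    pushed (.rem lvl) (fun _ => true) l s =
      looping lvl 0 (List.replicate l.length true) [] s := by
  refine Prod.ext (funext fun r => ?_) (funext fun r => ?_)
  · simp only [looping, pushed, update_apply]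
    split_ifs with hr
    · rw [hr, h.remA lvl le_rfl]
    · rfl
  · simp only [looping, pushed, update_apply]
    split_ifs with hr hr' hr'
    · simp_all
    · rw [h.rem lvl le_rfl]
      simp
    · rw [hr', h.free lvl le_rfl, List.replicate_zero]
    · rfl

theorem looping_zero {V : Type} {w : List A} {ρ vars : V → ℕ} {lvl : ℕ}
    {s : Store A WordStack BitStack} (h : Ready w ρ vars lvl s) : looping lvl 0 [] [] s = s := by
  refine Prod.ext (funext fun r => ?_) (funext fun r => ?_)
  · simp only [looping, update_apply]
    split_ifs with hr
    · rw [hr, h.remA lvl le_rfl]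
    · rfl
  · simp only [looping, update_apply]
    split_ifs with hr hr
    · rw [hr, h.free lvl le_rfl, List.replicate_zero]
    · rw [hr, h.rem lvl le_rfl]
    · rfl

/-- The end of an iteration. -/
theorem execLe_count {lvl t : ℕ} {r : List Bool} {r' : List A} {tgt : BitStack} {φ : Bool → Bool}
    {l : List Bool} {s : Store A WordStack BitStack} (ht : tgt.IsTarget lvl) :
    ExecLe (.pushB (.var lvl) true) (pushed tgt φ l (looping lvl t r r' s))
      (looping lvl (t + 1) r r' (pushed tgt φ l s)) 1 := by
  have n1 := ht.ne_var lvl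
  have n2 := ht.ne_rem (le_refl lvl)
  refine execLe_pushB (Prod.ext rfl (funext fun x => ?_))
  simp only [pushed, looping, update_apply]
  split_ifs <;> simp_all [List.replicate_succ]

/-- The removal of the variable of a loop. -/
theorem execLe_clear {V : Type} {w : List A} {ρ vars : V → ℕ} {lvl : ℕ}
    {s : Store A WordStack BitStack} (h : Ready w ρ vars lvl s) (t : ℕ) :
    ExecLe (.loopB (.var lvl) fun _ => .nop) (looping lvl t [] [] s) s (t * 2 + 1) := by
  have := ExecLe.loopB (j := .var lvl) (c := 1) (body := fun _ => .nop) (List.replicate t true)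
    (fun i => looping lvl (t - i) [] [] s) (fun i _ => by simp [looping])
    (fun i b _ => by
      rw [show looping lvl (t - (i + 1)) [] [] s = ((looping lvl (t - i) [] [] s).1,
        update (looping lvl (t - i) [] [] s).2 (.var lvl) ((List.replicate t true).drop (i + 1))) by
          simp [looping]]
      exact execLe_nop _)
  simpa [looping_zero h] using this

/-- The number of iterations is at most `B ^ k`, so that the body is run with variables up to
`B ^ (k + 1)`, in time `(B ^ (k + 1)) ^ k'`; the exponent `k' + 5` leaves room for the number of
iterations and for the overhead. -/
theorem PolyTime.rep {V : Type} {p : Printer A V} {body : Printer A (Option V)} {k k' : ℕ}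
    (hp : PolyTime p k) (hb : PolyTime body k') : PolyTime (p.rep body) ((k + 1) * (k' + 5)) := by
  intro w ρ B hB hw hρ
  obtain ⟨h1, h2⟩ := hp w ρ B hB hw hρ
  set x := (denote w p ρ).length with hx
  have hBB : B ≤ B ^ (k + 1) := Nat.le_self_pow (by omega) B
  have hk : B ^ k ≤ B ^ (k + 1) := Nat.pow_le_pow_right (by omega) (by omega)
  have hb' := fun i (hi : i < x) => hb w (extend ρ i) (B ^ (k + 1)) (hB.trans hBB)
    (hw.trans hBB) (by
      rintro (_ | v)
      · exact (hi.le.trans h1).trans hk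
      · exact (hρ v).trans hBB)
  rw [pow_mul]
  generalize B ^ (k + 1) = C at *
  have hC : 16 ≤ C ^ 4 := by simpa using Nat.pow_le_pow_left (hB.trans hBB) 4
  have hC1 : 1 ≤ C ^ k' := Nat.one_le_pow _ _ (by omega)
  have hCC : 16 * (C * C ^ k') ≤ C ^ (k' + 5) := by
    calc 16 * (C * C ^ k') ≤ C ^ 4 * (C * C ^ k') := Nat.mul_le_mul_right _ hC
      _ = C ^ (k' + 5) := by ring
  have hlen : ∀ t ≤ x, ((List.range t).flatMap fun i => denote w body (extend ρ i)).length ≤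
      t * C ^ k' := by
    intro t ht
    induction t with
    | zero => simp
    | succ t ih =>
      have := (hb' t (by omega)).1
      have := ih (by omega)
      rw [List.range_succ, List.flatMap_append, List.length_append, add_mul, List.flatMap_singleton]
      omega
  have hxC : x * C ^ k' ≤ C * C ^ k' := Nat.mul_le_mul_right _ (h1.trans hk)
  have hCk : C ≤ C * C ^ k' := Nat.le_mul_of_pos_right _ hC1
  refine ⟨(hlen x le_rfl).trans (by omega), fun tgt φ vars lvl s ht hs => ?_⟩
  have e1 := h2 (.rem lvl) (fun _ => true) vars (lvl + 1) s (Nat.lt_succ_self lvl)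
    (hs.mono (by omega))
  have e2 := ExecLe.loopB (j := .rem lvl) (c := C ^ k' + 1) (body := fun _ =>
    .seq (compile tgt φ body (extend vars lvl) (lvl + 1)) (.pushB (.var lvl) true))
    (List.replicate x true)
    (fun t => looping lvl t (List.replicate (x - t) true) [] (pushed tgt φ
      ((List.range t).flatMap fun i => denote w body (extend ρ i)) s))
    (fun t _ => by simp [looping]) (fun t b htb => by
      have htx : t < x := by
        obtain ⟨h, -⟩ := List.getElem?_eq_some_iff.1 htb
        simpa using h
      have := (hb' t htx).2 tgt φ (extend vars lvl) (lvl + 1) _ (ht.mono (by omega))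
        ((hs.pushed ht φ ((List.range t).flatMap fun i => denote w body (extend ρ i))).looping t
          (List.replicate (x - (t + 1)) true) [])
      rw [List.range_succ, List.flatMap_append, List.flatMap_singleton, ← pushed_pushed]
      rw [looping_dropB, List.drop_replicate]
      exact this.seq (execLe_count ht))
  have e3 := execLe_clear (hs.pushed ht φ (denote w (p.rep body) ρ)) x
  rw [pushed_rem hs] at e1
  simp only [List.length_replicate, Nat.sub_self, List.replicate_zero, Nat.sub_zero,
    List.range_zero, List.flatMap_nil, pushed_nil] at e2
  refine (e1.seq (e2.seq e3)).mono ?_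
  have : x * (C ^ k' + 1 + 1) = x * C ^ k' + 2 * x := by ring
  omega

theorem PolyTime.word {V : Type} {body : A → Printer A (Option V)} {k : ℕ}
    (hb : ∀ a, PolyTime (body a) k) : PolyTime (Printer.word body) (k + 5) := by
  intro w ρ B hB hw hρ
  have hb' := fun a i (hi : i < w.length) => hb a w (extend ρ i) B hB hw (by
      rintro (_ | v)
      · exact hi.le.trans hw
      · exact hρ v)
  have hC : 16 ≤ B ^ 4 := by simpa using Nat.pow_le_pow_left hB 4
  have hC1 : 1 ≤ B ^ k := Nat.one_le_pow _ _ (by omega)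
  have hCC : 16 * (B * B ^ k) ≤ B ^ (k + 5) := by
    calc 16 * (B * B ^ k) ≤ B ^ 4 * (B * B ^ k) := Nat.mul_le_mul_right _ hC
      _ = B ^ (k + 5) := by ring
  have hxC : w.length * B ^ k ≤ B * B ^ k := Nat.mul_le_mul_right _ hw
  have hCk : B ≤ B * B ^ k := Nat.le_mul_of_pos_right _ hC1
  have htake : ∀ t a, w[t]? = some a → (w.zipIdx.take (t + 1)).flatMap
      (fun x => denote w (body x.1) (extend ρ x.2)) = (w.zipIdx.take t).flatMap
      (fun x => denote w (body x.1) (extend ρ x.2)) ++ denote w (body a) (extend ρ t) := by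
    intro t a hta
    simp [List.take_add_one, hta]
  have hlen : ∀ t ≤ w.length, ((w.zipIdx.take t).flatMap
      fun x => denote w (body x.1) (extend ρ x.2)).length ≤ t * B ^ k := by
    intro t ht
    induction t with
    | zero => simp
    | succ t ih =>
      have h1 := (hb' w[t] t (by omega)).1
      have h2 := ih (by omega)
      rw [htake t _ (List.getElem?_eq_getElem (by omega)), List.length_append, add_mul]
      omega
  have htot : (w.zipIdx.take w.length).flatMap
      (fun x => denote w (body x.1) (extend ρ x.2)) = denote w (Printer.word body) ρ := by
    rw [List.take_of_length_le (by simp)]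
    rfl
  refine ⟨?_, fun tgt φ vars lvl s ht hs => ?_⟩
  · rw [← htot]
    exact (hlen _ le_rfl).trans (by omega)
  -- the word is moved to the auxiliary stack, then copied back to the input and to the loop stack
  have e1 := ExecLe.loopA (i := .inp) (c := 1)
    (body := fun a => (.pushA .aux a : Prog A WordStack BitStack)) w
    (fun t => (update (update s.1 .inp (w.drop t)) .aux (w.take t).reverse, s.2))
    (fun t _ => by simp) (fun t a hta => execLe_pushA (by
      simp [update_comm (show WordStack.aux ≠ .inp by simp), List.take_add_one, hta]))
  have e2 := ExecLe.loopA (i := .aux) (c := 2)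
    (body := fun a => (.seq (.pushA .inp a) (.pushA (.rem lvl) a) :
      Prog A WordStack BitStack)) w.reverse
    (fun t => (update (update (update s.1 .inp (w.reverse.take t).reverse) .aux
      (w.reverse.drop t)) (.rem lvl) (w.reverse.take t).reverse, s.2))
    (fun t _ => by simp) (fun t a hta => by
      refine ExecLe.seq (n := 1) (n' := 1) (execLe_pushA rfl) (execLe_pushA ?_)
      refine Prod.ext (funext fun r => ?_) rfl
      simp only [update_apply, List.take_add_one, hta]
      split_ifs <;> simp_all)
  have e3 := ExecLe.loopA (i := .rem lvl) (c := B ^ k + 1) (body := fun a =>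
    .seq (compile tgt φ (body a) (extend vars lvl) (lvl + 1)) (.pushB (.var lvl) true)) w
    (fun t => looping lvl t [] (w.drop t) (pushed tgt φ ((w.zipIdx.take t).flatMap
      fun x => denote w (body x.1) (extend ρ x.2)) s))
    (fun t _ => by simp [looping]) (fun t a hta => by
      obtain ⟨htw, -⟩ := List.getElem?_eq_some_iff.1 hta
      have := (hb' a t htw).2 tgt φ (extend vars lvl) (lvl + 1) _ (ht.mono (by omega))
        ((hs.pushed ht φ ((w.zipIdx.take t).flatMap
          fun x => denote w (body x.1) (extend ρ x.2))).looping t [] (w.drop (t + 1)))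
      rw [htake t a hta, ← pushed_pushed, looping_dropA]
      exact this.seq (execLe_count ht))
  have e4 := execLe_clear (hs.pushed ht φ (denote w (Printer.word body) ρ)) w.length
  rw [htot] at e3
  simp only [List.drop_length, List.drop_zero, List.take_zero, List.flatMap_nil, pushed_nil] at e3
  -- the end of each loop is the start of the next one
  have m1 : (update (update s.1 .inp (w.drop 0)) .aux (w.take 0).reverse, s.2) = s := by
    refine Prod.ext (funext fun r => ?_) rfl
    simp only [update_apply]
    split_ifs <;> simp_all [hs.inp, hs.auxA]
  have m2 : (update (update (update s.1 .inp (w.reverse.take 0).reverse) .aux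
      (w.reverse.drop 0)) (.rem lvl) (w.reverse.take 0).reverse, s.2) =
      (update (update s.1 .inp (w.drop w.length)) .aux (w.take w.length).reverse, s.2) := by
    refine Prod.ext (funext fun r => ?_) rfl
    simp only [update_apply]
    split_ifs <;> simp_all [hs.remA lvl le_rfl]
  have m3 : (update (update (update s.1 .inp (w.reverse.take w.reverse.length).reverse) .aux
      (w.reverse.drop w.reverse.length)) (.rem lvl) (w.reverse.take w.reverse.length).reverse,
      s.2) = looping lvl 0 [] w s := by
    rw [List.take_length, List.drop_length, List.reverse_reverse]
    refine Prod.ext (funext fun r => ?_) (funext fun r => ?_)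
    · simp only [looping, update_apply]
      split_ifs <;> simp_all [hs.inp, hs.auxA]
    · simp only [looping, update_apply]
      split_ifs <;> simp_all [hs.free lvl le_rfl, hs.rem lvl le_rfl]
  rw [m1] at e1
  rw [m2, m3, List.length_reverse] at e2
  refine (e1.seq (e2.seq (e3.seq e4))).mono ?_
  have : w.length * (B ^ k + 1 + 1) = w.length * B ^ k + 2 * w.length := by ring
  omega

theorem exists_polyTime [Finite A] {V : Type} (p : Printer A V) : ∃ k, PolyTime p k := by
  induction p with
  | emit l => exact ⟨_, polyTime_emit l⟩
  | seq p q ihp ihq =>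
    obtain ⟨k, hk⟩ := ihp
    obtain ⟨k', hk'⟩ := ihq
    exact ⟨_, (hk.mono (le_max_left k k')).seq (hk'.mono (le_max_right k k'))⟩
  | count v => exact ⟨_, polyTime_count v⟩
  | rep p body ihp ihb =>
    obtain ⟨k, hk⟩ := ihp
    obtain ⟨k', hk'⟩ := ihb
    exact ⟨_, hk.rep hk'⟩
  | word body ih =>
    choose k hk using ih
    obtain ⟨K, hK⟩ := (Set.finite_range k).bddAbove
    exact ⟨_, PolyTime.word fun a => (hk a).mono (hK ⟨a, rfl⟩)⟩

/-- Strings denoted by expressions are computable in polynomial time: the string is printed in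
reverse order, moved to the output, and the input is erased. -/
theorem computable [Fintype A] {β : Type} {enc : β → List Bool} {f : List A → β}
    (p : Printer A Empty) (h : ∀ w, denote w p Empty.elim = enc (f w)) :
    Nonempty (Turing.TM2ComputableInPolyTime (id : List A → List A) enc f) := by
  obtain ⟨k, hk⟩ := exists_polyTime p
  refine Prog.computable (.seq (compile .acc id p Empty.elim 0)
    (.seq (.loopB .acc fun b => .pushB .out b) (.loopA .inp fun _ => .nop))) .inp .out
    ((Polynomial.X + 2) ^ k * 3 + 2 * Polynomial.X + 2) fun w => ?_
  obtain ⟨h1, h2⟩ := hk w Empty.elim (w.length + 2) (by omega) (by omega) (fun v => v.elim)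
  set l := denote w p Empty.elim with hl
  have e1 := h2 .acc id Empty.elim 0 (inputStore .inp w) trivial
    ⟨by simp [inputStore], by simp [inputStore], by simp [inputStore], by simp [inputStore],
      by simp [inputStore], by simp [inputStore], fun v => v.elim, fun v => v.elim⟩
  have e2 := ExecLe.loopB (j := .acc) (c := 1)
    (body := fun b => (.pushB .out b : Prog A WordStack BitStack)) l.reverse
    (fun t => (update (fun _ => []) .inp w, update (update (fun _ => []) .acc (l.reverse.drop t))
      .out (l.reverse.take t).reverse))
    (fun t _ => by simp) (fun t a hta => execLe_pushB (by
      simp [update_comm (show BitStack.out ≠ .acc by simp), List.take_add_one, hta]))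
  have e3 := ExecLe.loopA (i := .inp) (c := 1)
    (body := fun _ => (.nop : Prog A WordStack BitStack)) w
    (fun t => (update (fun _ => []) .inp (w.drop t), update (fun _ => []) .out l))
    (fun t _ => by simp) (fun t a hta => by
      simpa using execLe_nop _)
  -- the end of each loop is the start of the next one
  have m1 : pushed .acc id l (inputStore .inp w) = (update (fun _ => []) .inp w,
      update (update (fun _ => []) .acc (l.reverse.drop 0)) .out (l.reverse.take 0).reverse) := by
    refine Prod.ext rfl (funext fun r => ?_)
    simp only [pushed, inputStore, update_apply]
    split_ifs <;> simp_all
  have m2 : ((update (fun _ => []) .inp (w.drop 0), update (fun _ => []) .out l) :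
      Store A WordStack BitStack) =
      (update (fun _ => []) .inp w, update (update (fun _ => []) .acc
        (l.reverse.drop l.reverse.length)) .out (l.reverse.take l.reverse.length).reverse) := by
    rw [List.take_length, List.drop_length, List.reverse_reverse]
    refine Prod.ext rfl (funext fun r => ?_)
    simp only [update_apply]
    split_ifs <;> simp_all
  have m3 : ((update (fun _ => []) .inp (w.drop w.length), update (fun _ => []) .out l) :
      Store A WordStack BitStack) = outputStore .out l := by
    simp [outputStore]
  rw [m1] at e1
  rw [m2, m3] at e3
  rw [← h w]
  obtain ⟨n, hn, he⟩ := e1.seq (e2.seq e3)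
  refine ⟨n, hn.trans ?_, he⟩
  simp only [List.length_reverse, Polynomial.eval_add, Polynomial.eval_mul, Polynomial.eval_pow,
    Polynomial.eval_X, Polynomial.eval_ofNat]
  omega

end Printer

/-! ### Printable strings, numbers and lists -/

section printable

variable {A : Type} {V : Type}

/-- Strings that depend on a word and on variables and are denoted by an expression. -/
def Printable (f : List A → (V → ℕ) → List Bool) : Prop :=
  ∃ p : Printer A V, ∀ w ρ, p.denote w ρ = f w ρ

/-- Numbers that are printable in unary. -/
def Unary (x : List A → (V → ℕ) → ℕ) : Prop :=
  Printable fun w ρ => List.replicate (x w ρ) true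

/-- Lists of strings that are printable with the marks used by `encList`. -/
def Pieces (L : List A → (V → ℕ) → List (List Bool)) : Prop :=
  Printable fun w ρ => (L w ρ).flatMap (true :: ·)

theorem Printable.congr {f g : List A → (V → ℕ) → List Bool} (h : Printable f)
    (hfg : ∀ w ρ, g w ρ = f w ρ) : Printable g :=
  let ⟨p, hp⟩ := h
  ⟨p, fun w ρ => (hp w ρ).trans (hfg w ρ).symm⟩

theorem printable_const (l : List Bool) : Printable fun (_ : List A) (_ : V → ℕ) => l :=
  ⟨.emit l, fun _ _ => rfl⟩

theorem Printable.append {f g : List A → (V → ℕ) → List Bool} (hf : Printable f)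
    (hg : Printable g) : Printable fun w ρ => f w ρ ++ g w ρ :=
  let ⟨p, hp⟩ := hf
  let ⟨q, hq⟩ := hg
  ⟨p.seq q, fun w ρ => by rw [Printer.denote, hp, hq]⟩

theorem Printable.flatMap_range {x : List A → (V → ℕ) → ℕ} (hx : Unary x)
    {f : List A → (V → ℕ) → ℕ → List Bool}
    (hf : Printable (V := Option V) fun w ρ => f w (fun v => ρ (some v)) (ρ none)) :
    Printable fun w ρ => (List.range (x w ρ)).flatMap (f w ρ) :=
  let ⟨p, hp⟩ := hx
  let ⟨q, hq⟩ := hf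
  ⟨p.rep q, fun w ρ => by
    rw [Printer.denote, hp, List.length_replicate]
    simp only [hq]
    rfl⟩

theorem Printable.flatMap_word {f : A → List A → (V → ℕ) → ℕ → List Bool}
    (hf : ∀ a, Printable (V := Option V) fun w ρ => f a w (fun v => ρ (some v)) (ρ none)) :
    Printable fun w ρ => w.zipIdx.flatMap fun y => f y.1 w ρ y.2 := by
  choose q hq using hf
  refine ⟨.word q, fun w ρ => ?_⟩
  rw [Printer.denote]
  simp only [hq]
  rfl

theorem unary_var (v : V) : Unary fun (_ : List A) (ρ : V → ℕ) => ρ v :=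
  ⟨.count v, fun _ _ => rfl⟩

theorem unary_const (n : ℕ) : Unary fun (_ : List A) (_ : V → ℕ) => n := printable_const _

theorem unary_length : Unary fun (w : List A) (_ : V → ℕ) => w.length := by
  refine (Printable.flatMap_word (f := fun _ _ _ _ => [true]) fun _ => printable_const _).congr
    fun w ρ => ?_
  have : ∀ l : List (A × ℕ), (l.flatMap fun _ => [true]) = List.replicate l.length true := by
    intro l
    induction l with
    | nil => rfl
    | cons a l ih => simp [ih, List.replicate_succ]
  rw [this, List.length_zipIdx]

theorem Unary.add {x y : List A → (V → ℕ) → ℕ} (hx : Unary x) (hy : Unary y) :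
    Unary fun w ρ => x w ρ + y w ρ :=
  (Printable.append hx hy).congr fun _ _ => List.replicate_add ..

/-- Expressions with renamed variables. -/
def Printer.rename : {V V' : Type} → (V → V') → Printer A V → Printer A V'
  | _, _, _, .emit l => .emit l
  | _, _, h, .seq p q => .seq (rename h p) (rename h q)
  | _, _, h, .count v => .count (h v)
  | _, _, h, .rep p body => .rep (rename h p) (rename (Option.map h) body)
  | _, _, h, .word body => .word fun a => rename (Option.map h) (body a)

theorem Printer.denote_rename (w : List A) {V V' : Type} (h : V → V') (p : Printer A V)
    (ρ : V' → ℕ) : (p.rename h).denote w ρ = p.denote w fun v => ρ (h v) := by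
  have key : ∀ {V V' : Type} (h : V → V') (ρ : V' → ℕ) (i : ℕ),
      (fun v => extend ρ i (Option.map h v)) = extend (fun v => ρ (h v)) i := by
    intro V V' h ρ i
    funext v
    cases v <;> rfl
  induction p generalizing V' with
  | emit l => rfl
  | seq p q ihp ihq => simp only [rename, denote, ihp, ihq]
  | count v => rfl
  | rep p body ihp ihb => simp only [rename, denote, ihp, ihb, key]
  | word body ih => simp only [rename, denote, ih, key]

theorem Unary.weaken {x : List A → (V → ℕ) → ℕ} (hx : Unary x) :
    Unary (V := Option V) fun w ρ => x w fun v => ρ (some v) :=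
  let ⟨p, hp⟩ := hx
  ⟨p.rename some, fun w ρ => by rw [Printer.denote_rename, hp]⟩

theorem Unary.mul {x y : List A → (V → ℕ) → ℕ} (hx : Unary x) (hy : Unary y) :
    Unary fun w ρ => x w ρ * y w ρ := by
  refine (Printable.flatMap_range (f := fun w ρ _ => List.replicate (y w ρ) true) hx
    hy.weaken).congr fun w ρ => ?_
  dsimp only
  generalize x w ρ = n
  induction n with
  | zero => simp
  | succ n ih =>
    rw [List.range_succ, List.flatMap_append, ← ih, List.flatMap_singleton, add_mul, one_mul,
      List.replicate_add]

theorem Unary.eval (p : Polynomial ℕ) {x : List A → (V → ℕ) → ℕ} (hx : Unary x) :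
    Unary fun w ρ => p.eval (x w ρ) := by
  induction p using Polynomial.induction_on with
  | C a => simpa using unary_const a
  | add p q hp hq => simpa using hp.add hq
  | monomial n a h => simpa [pow_succ, ← mul_assoc] using h.mul hx

theorem Unary.encNat {x : List A → (V → ℕ) → ℕ} (hx : Unary x) :
    Printable fun w ρ => encNat (x w ρ) :=
  Printable.append hx (printable_const _)

theorem Pieces.congr {L L' : List A → (V → ℕ) → List (List Bool)} (h : Pieces L)
    (hL : ∀ w ρ, L' w ρ = L w ρ) : Pieces L' :=
  Printable.congr h fun w ρ => by rw [hL]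

theorem pieces_nil : Pieces fun (_ : List A) (_ : V → ℕ) => [] := printable_const []

theorem Pieces.append {L L' : List A → (V → ℕ) → List (List Bool)} (h : Pieces L)
    (h' : Pieces L') : Pieces fun w ρ => L w ρ ++ L' w ρ :=
  (Printable.append h h').congr fun _ _ => List.flatMap_append

theorem Pieces.cons {f : List A → (V → ℕ) → List Bool} {L : List A → (V → ℕ) → List (List Bool)}
    (hf : Printable f) (h : Pieces L) : Pieces fun w ρ => f w ρ :: L w ρ :=
  ((printable_const [true]).append (hf.append h)).congr fun w ρ => by simp

theorem Printable.singleton {f : List A → (V → ℕ) → List Bool} (hf : Printable f) :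
    Pieces fun w ρ => [f w ρ] :=
  pieces_nil.cons hf

theorem Pieces.flatMap_range {x : List A → (V → ℕ) → ℕ} (hx : Unary x)
    {L : List A → (V → ℕ) → ℕ → List (List Bool)}
    (hL : Pieces (V := Option V) fun w ρ => L w (fun v => ρ (some v)) (ρ none)) :
    Pieces fun w ρ => (List.range (x w ρ)).flatMap (L w ρ) :=
  (Printable.flatMap_range hx (f := fun w ρ i => (L w ρ i).flatMap (true :: ·)) hL).congr
    fun _ _ => List.flatMap_assoc

theorem Pieces.map_range {x : List A → (V → ℕ) → ℕ} (hx : Unary x)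
    {f : List A → (V → ℕ) → ℕ → List Bool}
    (hf : Printable (V := Option V) fun w ρ => f w (fun v => ρ (some v)) (ρ none)) :
    Pieces fun w ρ => (List.range (x w ρ)).map (f w ρ) :=
  (Pieces.flatMap_range hx (L := fun w ρ i => [f w ρ i]) hf.singleton).congr
    fun w ρ => by simp [List.map_eq_flatMap]

theorem Pieces.map_word {f : A → List A → (V → ℕ) → ℕ → List Bool}
    (hf : ∀ a, Printable (V := Option V) fun w ρ => f a w (fun v => ρ (some v)) (ρ none)) :
    Pieces fun w ρ => w.zipIdx.map fun y => f y.1 w ρ y.2 :=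
  (Printable.flatMap_word (f := fun a w ρ i => true :: f a w ρ i)
    fun a => (printable_const [true]).append (hf a)).congr fun w ρ => by simp [List.flatMap_map]

theorem Pieces.flatMap_const {β : Type} (l : List β)
    {L : β → List A → (V → ℕ) → List (List Bool)} (hL : ∀ b ∈ l, Pieces (L b)) :
    Pieces fun w ρ => l.flatMap fun b => L b w ρ := by
  induction l with
  | nil => exact pieces_nil
  | cons b l ih =>
    exact (hL b List.mem_cons_self).append (ih fun b' hb' => hL b' (List.mem_cons_of_mem _ hb'))

theorem Pieces.map_const {β : Type} (l : List β)
    {f : β → List A → (V → ℕ) → List Bool} (hf : ∀ b ∈ l, Printable (f b)) :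
    Pieces fun w ρ => l.map fun b => f b w ρ := by
  induction l with
  | nil => exact pieces_nil
  | cons b l ih =>
    exact (ih fun b' hb' => hf b' (List.mem_cons_of_mem _ hb')).cons (hf b List.mem_cons_self)

theorem Pieces.replicate {x : List A → (V → ℕ) → ℕ} (hx : Unary x)
    {f : List A → (V → ℕ) → List Bool}
    (hf : Printable (V := Option V) fun w ρ => f w fun v => ρ (some v)) :
    Pieces fun w ρ => List.replicate (x w ρ) (f w ρ) :=
  (Pieces.map_range hx (f := fun w ρ _ => f w ρ) hf).congr fun w ρ => by simp

theorem encList_eq {α : Type} (e : α → List Bool) (l : List α) :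
    encList e l = (l.map e).flatMap (true :: ·) ++ [false] := by
  induction l with
  | nil => rfl
  | cons a l ih => simp [encList, ih]

theorem Pieces.encList {α : Type} {e : α → List Bool} {l : List A → (V → ℕ) → List α}
    (h : Pieces fun w ρ => (l w ρ).map e) : Printable fun w ρ => encList e (l w ρ) :=
  (Printable.append h (printable_const [false])).congr fun _ _ => encList_eq e _

/-- The length of a list is printable if the list of its codes is, where each element has the empty
code. -/
theorem Pieces.length {α : Type} {l : List A → (V → ℕ) → List α}
    (h : Pieces fun w ρ => (l w ρ).map fun _ => []) : Unary fun w ρ => (l w ρ).length :=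
  Printable.congr h fun w ρ => by
    dsimp only
    generalize l w ρ = l
    induction l with
    | nil => rfl
    | cons a l ih => simp_all [List.replicate_succ]

end printable

/-! ### The inputs of the reduction are printable -/

section

variable {A V : Type} {K : ℕ} {m : List A → (V → ℕ) → ℕ}

/-- Functions of two numbers that preserve printability. -/
def Unary₂ (A : Type) (G : ℕ → ℕ → ℕ) : Prop :=
  ∀ ⦃V : Type⦄ ⦃x y : List A → (V → ℕ) → ℕ⦄,
    Unary x → Unary y → Unary fun w ρ => G (x w ρ) (y w ρ)

theorem unary₂_pairNum : Unary₂ A pairNum := fun _ _ _ hx hy => ((hx.add hy).mul (hx.add hy)).add hx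

theorem unary₂_var_t : Unary₂ A fun b j => (Pos.t b j : Pos K).var := fun _ _ _ hx hy =>
  ((unary_const _).mul (unary₂_pairNum hx hy)).add (unary_const _)

theorem unary₂_var_i : Unary₂ A fun b j => (Pos.i b j : Pos K).var := fun _ _ _ hx hy =>
  ((unary_const _).mul (unary₂_pairNum hx hy)).add (unary_const _)

theorem unary₂_fresh_t : Unary₂ A fun b j => (Pos.t b j : Pos K).fresh := fun _ _ _ hx hy =>
  ((unary_const _).mul (unary₂_pairNum hx hy)).add (unary_const _)

theorem unary₂_fresh_i : Unary₂ A fun b j => (Pos.i b j : Pos K).fresh := fun _ _ _ hx hy =>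
  ((unary_const _).mul (unary₂_pairNum hx hy)).add (unary_const _)

/-- Marks are printed block by block. -/
theorem pieces_marks (hm : Unary m) {F : ℕ → ℕ → List Bool}
    (hF : Pieces (A := A) (V := Option V) fun _ ρ => (List.range (ρ none + 1)).map (F (ρ none))) :
    Pieces fun w ρ => (marks (m w ρ)).map fun q => F q.1 q.2 :=
  (Pieces.flatMap_range hm (L := fun _ _ b => (List.range (b + 1)).map (F b)) hF).congr
    fun w ρ => by simp [marks, List.map_flatMap, Function.comp_def]

theorem pieces_marks_plain (hm : Unary m) {G : ℕ → ℕ → ℕ} (hG : Unary₂ A G) :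
    Pieces fun w ρ => (marks (m w ρ)).map fun q => encNat (G q.1 q.2) :=
  pieces_marks hm (F := fun b j => encNat (G b j)) <|
    Pieces.map_range ((unary_var none).add (unary_const 1))
      (f := fun _ ρ j => encNat (G (ρ none) j))
      (hG (unary_var (some none)) (unary_var none)).encNat

/-- The first mark of each block is treated separately. -/
theorem pieces_marks_zero (hm : Unary m) {G : ℕ → ℕ → ℕ} (hG : Unary₂ A G) (c : ℕ) :
    Pieces fun w ρ => (marks (m w ρ)).map fun q => encNat (if q.2 = 0 then c else G q.1 q.2) :=
  pieces_marks hm (F := fun b j => encNat (if j = 0 then c else G b j)) <|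
    Pieces.congr (Pieces.cons (unary_const c).encNat
      (Pieces.map_range (unary_var none) (f := fun _ ρ j => encNat (G (ρ none) (j + 1)))
      (hG (unary_var (some none)) ((unary_var none).add (unary_const 1))).encNat))
      fun w ρ => by simp [List.range_succ_eq_map, Function.comp_def]

/-- The rotations of the blocks by `1`, `0` and `-1` positions. -/
theorem pieces_marks_rotate (hm : Unary m) {G : ℕ → ℕ → ℕ} (hG : Unary₂ A G) (d : Fin 3) :
    Pieces fun w ρ => (marks (m w ρ)).map fun q =>
      encNat (G q.1 ((q.2 + 1 + d * q.1) % (q.1 + 1))) := by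
  refine pieces_marks hm (F := fun b j => encNat (G b ((j + 1 + d * b) % (b + 1)))) ?_
  have hb : Unary (A := A) (V := Option V) fun _ ρ => ρ none := unary_var none
  have hj : Unary (A := A) (V := Option (Option V)) fun _ ρ => ρ none := unary_var none
  have hb' : Unary (A := A) (V := Option (Option V)) fun _ ρ => ρ (some none) :=
    unary_var (some none)
  fin_cases d
  · refine Pieces.congr (Pieces.append (Pieces.map_range hb
      (f := fun _ ρ j => encNat (G (ρ none) (j + 1))) (hG hb' (hj.add (unary_const 1))).encNat)
      (hG hb (unary_const 0)).encNat.singleton) fun w ρ => ?_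
    rw [List.range_succ, List.map_append, List.map_singleton]
    congr 1
    · refine List.map_congr_left fun j hj => ?_
      rw [List.mem_range] at hj
      simp [Nat.mod_eq_of_lt (show j + 1 < ρ none + 1 by omega)]
    · simp
  · refine Pieces.congr (Pieces.map_range (hb.add (unary_const 1))
      (f := fun _ ρ j => encNat (G (ρ none) j)) (hG hb' hj).encNat) fun w ρ => ?_
    refine List.map_congr_left fun j hj => ?_
    rw [List.mem_range] at hj
    simp [show j + 1 + ρ none = j + (ρ none + 1) by ring, Nat.mod_eq_of_lt hj]
  · refine Pieces.congr (Pieces.cons (hG hb hb).encNat (Pieces.map_range hb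
      (f := fun _ ρ j => encNat (G (ρ none) j)) (hG hb' hj).encNat)) fun w ρ => ?_
    rw [List.range_succ_eq_map, List.map_cons, List.map_map]
    congr 1
    · simp [show 1 + 2 * ρ none = ρ none + (ρ none + 1) by ring]
    · refine List.map_congr_left fun j hj => ?_
      rw [List.mem_range] at hj
      simp [show j + 1 + 1 + 2 * ρ none = j + (ρ none + 1) + (ρ none + 1) by ring,
        Nat.mod_eq_of_lt (show j < ρ none + 1 by omega)]

/-- The arguments of an atom are printable if those at each kind of positions are. -/
theorem pieces_positions {F : List A → (V → ℕ) → Pos K → List Bool}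
    (hf : ∀ p ∈ flagPositions K, Printable fun w ρ => F w ρ p)
    (ht : Pieces fun w ρ => (marks (m w ρ)).map fun q => F w ρ (.t q.1 q.2))
    (hi : Pieces fun w ρ => (marks (m w ρ)).map fun q => F w ρ (.i q.1 q.2)) :
    Pieces fun w ρ => (positions K (m w ρ)).map (F w ρ) :=
  (((Pieces.map_const (flagPositions K) hf).append ht).append hi).congr fun w ρ => by
    simp [positions, Function.comp_def]

theorem unary_length_positions (hm : Unary m) :
    Unary fun w ρ => (positions K (m w ρ)).length :=
  Pieces.length (pieces_positions (F := fun _ _ _ => []) (fun _ _ => printable_const _)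
    (pieces_marks hm (F := fun _ _ => []) (Pieces.map_range ((unary_var _).add (unary_const 1))
      (f := fun _ _ _ => []) (printable_const _)))
    (pieces_marks hm (F := fun _ _ => []) (Pieces.map_range ((unary_var _).add (unary_const 1))
      (f := fun _ _ _ => []) (printable_const _))))

theorem pieces_vars (hm : Unary m) :
    Pieces fun w ρ => ((positions K (m w ρ)).map Pos.var).map encNat :=
  (pieces_positions (F := fun _ _ p => encNat p.var) (fun _ _ => printable_const _)
    (pieces_marks_plain hm unary₂_var_t) (pieces_marks_plain hm unary₂_var_i)).congr
      fun _ _ => List.map_map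

theorem printable_atom {r : List A → (V → ℕ) → ℕ} {l : List A → (V → ℕ) → List ℕ} (hr : Unary r)
    (hl : Pieces fun w ρ => (l w ρ).map encNat) :
    Printable fun w ρ => encAtom ⟨r w ρ, l w ρ⟩ :=
  hr.encNat.append hl.encList

theorem printable_encList_singleton {α : Type} {e : α → List Bool} {a : List A → (V → ℕ) → α}
    (h : Printable fun w ρ => e (a w ρ)) : Printable fun w ρ => encList e [a w ρ] :=
  Pieces.encList h.singleton

/-- Whether an atom equates a mark with `c` depends only on whether it is the first of its block. -/
theorem printable_eqAtom (hm : Unary m) {r : List A → (V → ℕ) → ℕ} (hr : Unary r)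
    {eq : Pos K → Bool} {ct ci : Bool} (ht : ∀ b j, eq (.t b j) = (ct && decide (j = 0)))
    (hi : ∀ b j, eq (.i b j) = (ci && decide (j = 0))) :
    Printable fun w ρ => encAtom (eqAtom (m w ρ) (r w ρ) eq) := by
  have key : ∀ {G : ℕ → ℕ → ℕ}, Unary₂ A G → ∀ c : Bool, Pieces fun w ρ =>
      (marks (m w ρ)).map fun q => encNat (if c && decide (q.2 = 0) then (Pos.c : Pos K).var
        else G q.1 q.2) := by
    rintro G hG (_ | _)
    · simpa using pieces_marks_plain hm hG
    · simpa using pieces_marks_zero hm hG _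
  refine printable_atom hr ((pieces_positions (F := fun _ _ p => encNat
    (if eq p then (Pos.c : Pos K).var else p.var)) (fun _ _ => printable_const _) ?_ ?_).congr
      fun _ _ => List.map_map)
  · simpa only [ht] using key unary₂_var_t ct
  · simpa only [hi] using key unary₂_var_i ci

/-- A rule given by the source, the target and the variables in the head. -/
theorem printable_rule (hm : Unary m) {r r' : List A → (V → ℕ) → ℕ} (hr : Unary r) (hr' : Unary r')
    {f : List A → (V → ℕ) → Pos K → Option (Pos K)}
    (hf : ∀ p ∈ flagPositions K, Unary fun w ρ => (⟨r w ρ, r' w ρ, f w ρ⟩ : Rule K).headVar p)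
    (ht : Pieces fun w ρ => (marks (m w ρ)).map fun q =>
      encNat ((⟨r w ρ, r' w ρ, f w ρ⟩ : Rule K).headVar (.t q.1 q.2)))
    (hi : Pieces fun w ρ => (marks (m w ρ)).map fun q =>
      encNat ((⟨r w ρ, r' w ρ, f w ρ⟩ : Rule K).headVar (.i q.1 q.2))) :
    Printable fun w ρ => encTGD ((⟨r w ρ, r' w ρ, f w ρ⟩ : Rule K).toTGD (m w ρ)) :=
  (printable_encList_singleton (printable_atom hr (pieces_vars hm))).append
    (printable_encList_singleton (printable_atom hr' ((pieces_positions
      (F := fun w ρ p => encNat ((⟨r w ρ, r' w ρ, f w ρ⟩ : Rule K).headVar p))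
      (fun p hp => (hf p hp).encNat) ht hi).congr fun _ _ => List.map_map)))

theorem pieces_nonzeroMarks (hm : Unary m) {F : List A → (V → ℕ) → ℕ → ℕ → List Bool}
    (hF : Printable (V := Option (Option V)) fun w ρ =>
      F w (fun v => ρ (some (some v))) (ρ (some none)) (ρ none + 1)) :
    Pieces fun w ρ => (nonzeroMarks (m w ρ)).map fun q => F w ρ q.1 q.2 :=
  (Pieces.flatMap_range hm (L := fun w ρ b => (List.range b).map fun j => F w ρ b (j + 1))
    (Pieces.map_range (unary_var none)
      (f := fun w ρ j => F w (fun v => ρ (some v)) (ρ none) (j + 1)) hF)).congr fun w ρ => by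
    simp [nonzeroMarks, List.map_flatMap, Function.comp_def]

theorem printable_test (hm : Unary m) {r : List A → (V → ℕ) → ℕ} (hr : Unary r)
    {q : List A → (V → ℕ) → Pos K} (hq : Unary fun w ρ => (q w ρ).var) :
    Printable fun w ρ => encTGD ((⟨r w ρ, 2, pullTest (q w ρ)⟩ : Rule K).toTGD (m w ρ)) := by
  refine printable_rule hm hr (unary_const 2) (fun p hp => ?_)
    (pieces_marks_plain hm unary₂_fresh_t) (pieces_marks_plain hm unary₂_fresh_i)
  rcases p with _ | _ | _ | _ | _ | _ | _
  · exact unary_const _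
  · exact hq
  all_goals exact unary_const _

theorem printable_init (hm : Unary m) :
    Printable fun w ρ => encTGD ((⟨0, 1, pullInit⟩ : Rule K).toTGD (m w ρ)) :=
  printable_rule (f := fun _ _ => pullInit) hm (unary_const 0) (unary_const 1)
    (fun _ _ => unary_const _) (pieces_marks_plain hm unary₂_var_t)
    (pieces_marks_plain hm unary₂_var_i)

theorem printable_move (hm : Unary m) (d : Fin 3) :
    Printable fun w ρ => encTGD ((⟨1, 1, pullMove d⟩ : Rule K).toTGD (m w ρ)) :=
  printable_rule (f := fun _ _ => pullMove d) hm (unary_const 1) (unary_const 1)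
    (fun p _ => unary_const _)
    ((pieces_marks_rotate hm (unary₂_var_t (K := K)) 0).congr fun w ρ => by
      simp [Rule.headVar, pullMove])
    (pieces_marks_rotate hm unary₂_var_i d)

theorem printable_look (hm : Unary m) :
    Printable fun w ρ => encTGD ((⟨1, 4, pullLook⟩ : Rule K).toTGD (m w ρ)) :=
  printable_rule (f := fun _ _ => pullLook) hm (unary_const 1) (unary_const 4)
    (fun _ _ => unary_const _) (pieces_marks_plain hm unary₂_fresh_t)
    (pieces_marks_plain hm unary₂_var_i)

theorem printable_next {k : List A → (V → ℕ) → ℕ} (hm : Unary m) (hk : Unary k) :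
    Printable fun w ρ => encTGD ((⟨4 + k w ρ, 5 + k w ρ, pullNext⟩ : Rule K).toTGD (m w ρ)) :=
  printable_rule (f := fun _ _ => pullNext) hm ((unary_const 4).add hk) ((unary_const 5).add hk)
    (fun p _ => unary_const (((pullNext p).map Pos.var).getD p.fresh))
    (pieces_marks_plain hm unary₂_fresh_t)
    ((pieces_marks_rotate hm (unary₂_var_i (K := K)) 0).congr fun w ρ => by
      simp [Rule.headVar, pullNext])

/-- The tests of one counter for the facts of one relation. -/
theorem pieces_tests {r : List A → (V → ℕ) → ℕ} (hm : Unary m) (hr : Unary r)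
    {q : ℕ → ℕ → Pos K} (hq : Unary₂ A fun b j => (q b j).var) :
    Pieces fun w ρ => (nonzeroMarks (m w ρ)).map fun p =>
      encTGD ((⟨r w ρ, 2, pullTest (q p.1 p.2)⟩ : Rule K).toTGD (m w ρ)) :=
  pieces_nonzeroMarks hm (F := fun w ρ b j =>
    encTGD ((⟨r w ρ, 2, pullTest (q b j)⟩ : Rule K).toTGD (m w ρ)))
    (printable_test hm.weaken.weaken hr.weaken.weaken
      (hq (unary_var (some none)) ((unary_var none).add (unary_const 1))))

/-- The rules of the level `k` of the search in the initial row. -/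
def levelRules (K m k : ℕ) : List (Rule K) :=
  ⟨4 + k, 5 + k, pullNext⟩ ::
    (nonzeroMarks m).map fun p => ⟨4 + k, 2, pullTest (.i p.1 p.2)⟩

theorem pieces_levelRules {k : List A → (V → ℕ) → ℕ} (hm : Unary m) (hk : Unary k) :
    Pieces fun w ρ =>
      (levelRules K (m w ρ) (k w ρ)).map fun r => encTGD (r.toTGD (m w ρ)) := by
  refine Pieces.congr
    ((pieces_tests (K := K) (q := .i) hm ((unary_const 4).add hk) unary₂_var_i).cons
    (printable_next (K := K) hm hk)) fun w ρ => ?_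
  simp only [levelRules, List.map_cons, List.map_map, Function.comp_def]

theorem pieces_rules {n : List A → (V → ℕ) → ℕ} (hm : Unary m) (hn : Unary n) :
    Pieces fun w ρ => ((rules K (m w ρ) (n w ρ)).map (Rule.toTGD (m w ρ))).map encTGD := by
  have hmove := printable_move (K := K) hm
  have h1 := ((((printable_look (K := K) hm).singleton.cons (hmove 2)).cons (hmove 1)).cons
    (hmove 0)).cons (printable_init (K := K) hm)
  have h2 := pieces_tests (K := K) (q := .t) hm (unary_const 1) unary₂_var_t
  have h3 := Pieces.flatMap_range hn
    (L := fun w ρ k => (levelRules K (m w ρ) k).map fun r => encTGD (r.toTGD (m w ρ)))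
    (pieces_levelRules hm.weaken (unary_var none))
  refine Pieces.congr (h1.append (h2.append h3)) fun w ρ => ?_
  rw [rules, List.map_append, List.map_append, List.map_append, List.map_append,
    List.map_flatMap, List.map_flatMap, List.map_map, List.map_map]
  simp only [List.map_cons, List.map_nil, levelRules, List.map_map, Function.comp_def]

theorem printable_initCQ (hm : Unary m) : Printable fun w ρ => encCQ (initCQ K (m w ρ)) := by
  have h : ∀ {G : ℕ → ℕ → ℕ}, Unary₂ A G → Pieces fun w ρ =>
      (List.range (m w ρ)).map fun b => encNat (G b 0) := fun {G} hG =>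
    Pieces.map_range hm (f := fun _ _ b => encNat (G b 0))
      (hG (unary_var none) (unary_const 0)).encNat
  refine Printable.append (Pieces.encList ?_)
    (printable_encList_singleton (printable_atom (unary_const 0) (pieces_vars hm)))
  refine Pieces.congr (((h (unary₂_var_t (K := K))).append (h (unary₂_var_i (K := K)))).cons
    (printable_const (encNat (Pos.c : Pos K).var))) fun w ρ => ?_
  simp [initCQ, exposed, Function.comp_def]

theorem printable_policyCQ (hm : Unary m) : Printable fun w ρ => encCQ (policyCQ K (m w ρ)) :=
  (printable_const [false]).append (printable_encList_singleton
    (printable_eqAtom (ct := false) (ci := false) hm (unary_const 0) (fun _ _ => rfl)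
      fun _ _ => rfl))

theorem printable_sourceSchema {n : List A → (V → ℕ) → ℕ} (hm : Unary m) (hn : Unary n) :
    Printable fun w ρ => encList encNat (sourceSchema K (m w ρ) (n w ρ)) := by
  have h {x : List A → (V → ℕ) → ℕ} (hx : Unary x) := Pieces.replicate hx
    (f := fun w ρ => encNat (positions K (m w ρ)).length) (unary_length_positions hm.weaken).encNat
  refine Pieces.encList (Pieces.congr ((h (unary_const 3)).append
    ((h (hn.add (unary_const 1))).cons (printable_const (encNat 1))))
      fun w ρ => ?_)
  simp [sourceSchema]

/-- The lists of the patterns for the words `start :: w.map letter` are printable, in any encoding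
of patterns that can be printed for a given relation. -/
theorem pieces_patterns (B : Automaton K) (start : Fin K) (letter : A → Fin K)
    {enc : ℕ → Pat K → List Bool} (hm : Unary m)
    (henc : ∀ {V : Type} {m r : List A → (V → ℕ) → ℕ}, Unary m → Unary r →
      ∀ P : Pat K, (∃ c : Bool, ∀ b j, P.eq (.t b j) = (c && decide (j = 0))) →
      (∃ c : Bool, ∀ b j, P.eq (.i b j) = (c && decide (j = 0))) →
      Printable fun w ρ => enc (m w ρ) ⟨r w ρ, P.eq, P.out⟩) :
    Pieces fun w ρ => (patterns B (start :: w.map letter)).map (enc (m w ρ)) := by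
  have hletter : ∀ {V : Type} {m r : List A → (V → ℕ) → ℕ}, Unary m → Unary r → ∀ s,
      Printable fun w ρ => enc (m w ρ) (letterPat (r w ρ) s) := fun hm hr s =>
    henc hm ((unary_const 4).add hr) (letterPat 0 s) ⟨false, fun _ _ => rfl⟩ ⟨true, fun _ _ => rfl⟩
  have h1 : Pieces fun w ρ => (List.finRange K).flatMap fun s₁ => (List.finRange K).flatMap
      fun s₂ => (List.finRange K).map fun s₃ => enc (m w ρ) (stepPat B s₁ s₂ s₃) :=
    Pieces.flatMap_const _ fun s₁ _ => Pieces.flatMap_const _ fun s₂ _ => Pieces.map_const _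
      fun s₃ _ => henc hm (unary_const 1) (stepPat B s₁ s₂ s₃) ⟨false, fun _ _ => rfl⟩
        ⟨false, fun _ _ => rfl⟩
  have h2 : Pieces fun w ρ => (List.finRange K).map fun s => enc (m w ρ) (basePat s) :=
    Pieces.map_const _ fun s _ => henc hm (unary_const 1) (basePat s) ⟨true, fun _ _ => rfl⟩
      ⟨false, fun _ _ => rfl⟩
  have h3 : Pieces fun w ρ => ((List.finRange K).filter B.acc).map
      fun s => enc (m w ρ) (acceptPat s) :=
    Pieces.map_const _ fun s _ => henc hm (unary_const 1) (acceptPat s) ⟨false, fun _ _ => rfl⟩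
      ⟨false, fun _ _ => rfl⟩
  have h4 : Printable fun w ρ => enc (m w ρ) testPat :=
    henc hm (unary_const 2) testPat ⟨false, fun _ _ => rfl⟩ ⟨false, fun _ _ => rfl⟩
  have h5 : Pieces fun w ρ => w.zipIdx.map fun y =>
      enc (m w ρ) (letterPat (y.2 + 1) (letter y.1)) :=
    Pieces.map_word (f := fun a w ρ k => enc (m w ρ) (letterPat (k + 1) (letter a)))
      fun a => hletter hm.weaken ((unary_var none).add (unary_const 1)) _
  have h6 : Pieces fun w ρ => (List.range (w.length + 1)).flatMap fun k =>
      (List.finRange K).map fun s => enc (m w ρ) (nextPat k s) :=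
    Pieces.flatMap_range (unary_length.add (unary_const 1)) (L := fun w ρ k =>
      (List.finRange K).map fun s => enc (m w ρ) (nextPat k s)) <| Pieces.map_const _ fun s _ =>
        henc hm.weaken ((unary_const 4).add (unary_var none)) (nextPat 0 s)
          ⟨false, fun _ _ => rfl⟩ ⟨false, fun _ _ => rfl⟩
  have h7 : Printable fun w ρ => enc (m w ρ) (blankPat B (w.length + 1)) :=
    henc hm ((unary_const 4).add (unary_length.add (unary_const 1))) (blankPat B 0)
      ⟨false, fun _ _ => rfl⟩ ⟨false, fun _ _ => rfl⟩
  refine Pieces.congr (h1.append (h2.append (h3.append (Pieces.cons h4 (Pieces.append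
    (Pieces.cons (hletter hm (unary_const 0) start) h5) (h6.append h7.singleton)))))) fun w ρ => ?_
  simp [patterns, List.map_flatMap, Function.comp_def, List.zipIdx_cons, List.zipIdx_map,
    List.zipIdx_succ]

theorem printable_incDepInput (B : Automaton K) (start : Fin K) (letter : A → Fin K)
    (hm : Unary m) : Printable fun w ρ => encInput (incDepInput (m w ρ) (w.length + 1)
      (rules K (m w ρ) (w.length + 1)) (patterns B (start :: w.map letter))) := by
  have hn : Unary fun (w : List A) (_ : V → ℕ) => w.length + 1 := unary_length.add (unary_const 1)
  refine (printable_sourceSchema hm hn).append ((Pieces.encList (pieces_rules hm hn)).append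
    ((Pieces.encList ?_).append (printable_policyCQ (K := K) hm)))
  refine Pieces.congr (Pieces.cons (printable_initCQ (K := K) hm) (pieces_patterns
    (enc := fun m P => encCQ (P.toCQ m)) B start letter hm ?_)) fun w ρ => by
      simp [incDepInput, Function.comp_def]
  rintro V m r hm hr P ⟨ct, ht⟩ ⟨ci, hi⟩
  exact (printable_const (encList encNat [P.out.var])).append
    (printable_encList_singleton (printable_eqAtom hm hr ht hi))

theorem printable_linearInput (B : Automaton K) (start : Fin K) (letter : A → Fin K)
    (hm : Unary m) : Printable fun w ρ => encInput (linearInput (m w ρ) (w.length + 1)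
      (rules K (m w ρ) (w.length + 1)) (patterns B (start :: w.map letter))) := by
  have hn : Unary fun (w : List A) (_ : V → ℕ) => w.length + 1 := unary_length.add (unary_const 1)
  refine (printable_sourceSchema hm hn).append ((Pieces.encList ?_).append
    ((Pieces.encList (Pieces.cons (printable_initCQ (K := K) hm)
      (printable_const (encCQ unaryCQ)).singleton)).append (printable_policyCQ (K := K) hm)))
  refine Pieces.congr ((pieces_rules (K := K) hm hn).append (pieces_patterns
    (enc := fun m P => encTGD (P.toTGD m)) B start letter hm ?_)) fun w ρ => by
      simp [linearInput, Function.comp_def]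
  rintro V m r hm hr P ⟨ct, ht⟩ ⟨ci, hi⟩
  exact (printable_encList_singleton (printable_eqAtom hm hr ht hi)).append
    (printable_const (encList encAtom [⟨3, [P.out.var]⟩]))

end

/-! ### EXPTIME-hardness -/

/-- Every language in EXPTIME is recognized by a cellular automaton on a space-time diagram of
exponential size. -/
theorem InExpTime.exists_automaton {A : Type} {L : Language A} (h : InExpTime L) :
    ∃ (K : ℕ) (B : Automaton K) (start : Fin K) (letter : A → Fin K) (p : Polynomial ℕ),
      ∀ w, w ∈ L ↔ ∃ r < period (p.eval w.length), ∃ i,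
        B.acc (row B (p.eval w.length) (start :: w.map letter) r i) := by
  obtain ⟨⟨Γ, Λ, M, input, -, accept, time, decides⟩⟩ := h
  obtain ⟨K, ⟨e⟩⟩ := Finite.exists_equiv_fin (Option (Option Λ) × Γ)
  refine ⟨K, machineAutomaton (delayed M) e (some '' accept), e (some none, default),
    fun a => e (none, input a), 2 * (time + Polynomial.X + 4), fun w => ?_⟩
  obtain ⟨c, hrun, hc, hL⟩ := decides w
  rw [← hL, accepts_iff_exists_acc e hrun hc rfl]
  simp [delayedWord, Function.comp_def]

theorem expTimeHard_incDep_atomic : ExpTimeHard (disclose TGD.IsIncDep CQ.IsAtomic) := by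
  intro A _ L hL
  have := Fintype.ofFinite A
  obtain ⟨K, B, start, letter, p, h⟩ := hL.exists_automaton
  obtain ⟨P, hP⟩ := printable_incDepInput (V := Empty) B start letter (unary_length.eval p)
  refine ⟨fun w => ⟨incDepInput (p.eval w.length) (start :: w.map letter).length
    (rules K _ _) (patterns B (start :: w.map letter)),
    incDepInput_wf valid_rules valid_patterns, incDepInput_classes valid_rules⟩,
    Printer.computable P fun w => (hP w _).trans ?_,
    fun w => (h w).trans incDepInput_admitsDisclosure_iff.symm⟩
  simp [disclose]

theorem expTimeHard_linear_projection :
    ExpTimeHard (disclose TGD.IsLinear CQ.IsProjection) := by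
  intro A _ L hL
  have := Fintype.ofFinite A
  obtain ⟨K, B, start, letter, p, h⟩ := hL.exists_automaton
  obtain ⟨P, hP⟩ := printable_linearInput (V := Empty) B start letter (unary_length.eval p)
  refine ⟨fun w => ⟨linearInput (p.eval w.length) (start :: w.map letter).length
    (rules K _ _) (patterns B (start :: w.map letter)),
    linearInput_wf valid_rules valid_patterns, linearInput_classes⟩,
    Printer.computable P fun w => (hP w _).trans ?_,
    fun w => (h w).trans linearInput_admitsDisclosure_iff.symm⟩
  simp [disclose]

end Disclosure

theorem mainTheorem4 :
    Disclosure.ExpTimeHard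
      (Disclosure.disclose Disclosure.TGD.IsIncDep Disclosure.CQ.IsAtomic) ∧
    Disclosure.ExpTimeHard
      (Disclosure.disclose Disclosure.TGD.IsLinear Disclosure.CQ.IsProjection) := by
  exact ⟨Disclosure.expTimeHard_incDep_atomic, Disclosure.expTimeHard_linear_projection⟩
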